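/- For a Schwartz function $\varphi$ on $\mathbb R^3$ let $(-\Delta)^{1/2}\varphi=(|\xi|\hat\varphi(\xi))^\vee$, and let $(-\Delta)^{1/2}$ act on functions $u$ with $\langle x\rangle^{-t}u\in L^2(\mathbb R^3)$ for some $t<5/2$ by duality, $\int ((-\Delta)^{1/2}u)\,\varphi\,dx=\int u\,(-\Delta)^{1/2}\varphi\,dx$ for all Schwartz functions $\varphi$, where $\langle x\rangle=(1+|x|^2)^{1/2}$; thus $(-\Delta)^{1/2}u$ is a tempered distribution. For $s\in\mathbb R$ let $L^{2,s}(\mathbb R^3)=\{f:\langle x\rangle^s f\in L^2(\mathbb R^3)\}$. Let $\lambda>0$ and $s\ge 1$, let $g_{++},g_{+-},g_{-+},g_{--}\in C^\infty(\mathbb S^2)$ be complex-valued, and let $u_+,u_-:\mathbb R^3\to\mathbb C$ be such that, with $\theta=x/|x|$, the functions $$u_+ - e^{-i\lambda|x|}|x|^{-1}g_{+-}(\theta)-e^{i\lambda|x|}|x|^{-1}g_{++}(\theta),\qquad u_- - e^{-i\lambda|x|}|x|^{-1}g_{--}(\theta)-e^{i\lambda|x|}|x|^{-1}g_{-+}(\theta)$$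 both lie in $L^2(\mathbb R^3)$. Suppose that the tempered distributions $((-\Delta)^{1/2}-\lambda)u_+$ and $((-\Delta)^{1/2}-\lambda)u_-$ both belong to $L^{2,s}(\mathbb R^3)$. Then, with the pairings $\langle f,h\rangle=\int f\,\overline h$ over $\mathbb R^3$ with Lebesgue measure and over $\mathbb S^2$ with surface measure, the two pairings on the left-hand side below are absolutely convergent integrals and $$\langle u_+,((-\Delta)^{1/2}-\lambda)u_-\rangle-\langle((-\Delta)^{1/2}-\lambda)u_+,u_-\rangle=i\bigl(\langle g_{++},g_{-+}\rangle-\langle g_{+-},g_{--}\rangle\bigr).$$ -/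

import Mathlib

open MeasureTheory
open scoped Manifold ContDiff FourierTransform SchwartzMap

namespace BoundaryPairing

/-- Three-dimensional Euclidean space. -/
abbrev R3 : Type := EuclideanSpace ℝ (Fin 3)

/-- The unit sphere of three-dimensional Euclidean space. -/
abbrev S2 : Type := Metric.sphere (0 : R3) 1

instance factFinrank : Fact (Module.finrank ℝ R3 = 2 + 1) := ⟨by simp⟩

/-- The pointwise action of `(-Δ)^{1/2}` on Schwartz functions, `f ↦ (|ξ| f^)^∨`.
With Mathlib's normalization `e^{-2πi⟨x, ξ⟩}` of the Fourier transform, the symbol `|ξ|`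
becomes `2π‖ξ‖`. -/
noncomputable def halfLaplacian (φ : 𝓢(R3, ℂ)) : R3 → ℂ :=
  𝓕⁻ (fun ξ : R3 => ((2 * Real.pi * ‖ξ‖ : ℝ) : ℂ) * 𝓕 (φ : R3 → ℂ) ξ)

/-- `((-Δ)^{1/2} - lam) u = f` in the sense of tempered distributions, `(-Δ)^{1/2}` acting on `u`
by duality. (For a Schwartz function `φ`, `(1 + |x|^2)^{t/2} (-Δ)^{1/2} φ` lies in `L²` for all
`t < 5/2`, so that the pairings below are absolutely convergent integrals whenever
`(1 + |x|^2)^{-t/2} u` and `(1 + |x|^2)^{-t/2} f` lie in `L²` for some `t < 5/2`.) -/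
def HalfLaplacianSubEq (lam : ℝ) (u f : R3 → ℂ) : Prop :=
  ∀ φ : 𝓢(R3, ℂ),
    ∫ x, u x * (halfLaplacian φ x - (lam : ℂ) * φ x) = ∫ x, f x * φ x

/-- The weighted space `L^{2,s}`: `(1 + |x|^2)^{s/2} f` lies in `L²`. -/
def MemWeightedL2 (s : ℝ) (f : R3 → ℂ) : Prop :=
  MemLp (fun x : R3 => (((1 + ‖x‖ ^ 2) ^ (s / 2) : ℝ) : ℂ) * f x) 2 volume

/-- The function `x ↦ g (x / |x|)`, with value `0` at the origin. -/
noncomputable def angular (g : S2 → ℂ) (x : R3) : ℂ :=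
  open Classical in
  if hx : x = 0 then 0
  else g ⟨‖x‖⁻¹ • x, by
    rw [mem_sphere_zero_iff_norm, norm_smul, norm_inv, norm_norm,
      inv_mul_cancel₀ (norm_ne_zero_iff.mpr hx)]⟩

/-- The spherical wave `e^{i κ |x|} |x|^{-1} g(x / |x|)`. -/
noncomputable def sphericalWave (κ : ℝ) (g : S2 → ℂ) (x : R3) : ℂ :=
  Complex.exp (Complex.I * (κ : ℂ) * (‖x‖ : ℂ)) * ((‖x‖ : ℂ))⁻¹ * angular g x

/-- The pairing `∫ g \bar h` over the unit sphere with respect to surface measure. -/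
noncomputable def spherePairing (g h : S2 → ℂ) : ℂ :=
  ∫ θ : S2, g θ * (starRingEnd ℂ) (h θ) ∂((volume : Measure R3).toSphere)

end BoundaryPairing

/-!
The operator `A = (-Δ)^{1/2} - λ` is symmetric on `L²` (`integral_mul_conj_halfSymbol`), but `u_±`
are not square integrable, and the right-hand side of the identity is the boundary term at infinity.
It is computed by giving the waves complex frequencies. With `b` a cutoff vanishing near `0`, the
wave `W_κ = b(|x|) e^{iκ|x|} |x|⁻¹ g(x/|x|)` (`regWave`) decays exponentially for `Im κ > 0`, and
one takes `κ = σλ + iε` with `σ = 1` for the outgoing and `σ = -1` for the incoming wave.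

An explicit computation in polar coordinates gives `(-Δ - κ²) W_κ = h_κ = O(|x|⁻³)` uniformly in `ε`
(`exists_regSource_bound`, `integral_regWave_mul_helmholtz`), so `h_κ` depends continuously on
`ε ≥ 0` in `L^{2,1}`. Put `μ = σκ`, so that `μ² = κ²` and `Re μ = λ > 0`. From the factorization
`|ξ|² - μ² = (|ξ| + μ) (|ξ| - μ)` it follows that `((-Δ)^{1/2} - μ) W_κ = f_κ` with
`f_κ = ((-Δ)^{1/2} + μ)⁻¹ h_κ`. The symbol `(|ξ| + μ)⁻¹` is bounded and Lipschitz, and such a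
multiplier is bounded on `L^{2,1}` (`eLpNorm_weight_mul_multiplier_le`: on the Fourier side a weight
is a derivative, hence a limit of difference quotients). So `f_κ` is continuous up to `ε = 0` in
`L^{2,1}` too (`exists_regWave_halfSource_seq`).

Now `w = u - W_λ - W_{-λ}` and `A w` are both in `L²`, and `U = w + W_{λ+iε} + W_{-λ+iε}` is an
`L²` function with `A U = F + iε (W_{λ+iε} - W_{-λ+iε})`, where `F → A u` in `L^{2,1}` and `U → u`
in `L^{2,-1}` (`exists_regularization`). Symmetry of `A`, applied to two such functions, expresses
`∫ U conj(K) - ∫ F conj(V)` through `iε` times integrals of products of `L²` functions. The terms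
between outgoing and incoming waves cancel (`integral_sub_integral_eq_of_symm`), those
containing `w` vanish in the limit because `ε ‖W_κ‖ = O(ε^{1/2})`, and for the diagonal ones
`ε ∫ |b|² e^{-2εr} dr → 1/2` yields `ε ∫ W_κ conj(V_κ) → ⟨g, g'⟩ / 2`
(`tendsto_im_mul_integral_regWave_mul_conj`).
-/

namespace BoundaryPairing

/-! ### The Fourier transform of square-integrable functions -/

/-- `v` is a representative of the `L²` Fourier transform of the square-integrable function `u`.
The relation is stated for functions rather than for elements of `Lp`, so that pointwise identities
between symbols can be used directly. -/
def HasL2Fourier (u v : R3 → ℂ) : Prop :=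
  ∃ (hu : MemLp u 2 volume) (hv : MemLp v 2 volume), 𝓕 (hu.toLp u) = hv.toLp v

namespace HasL2Fourier

variable {u v u₁ v₁ u₂ v₂ : R3 → ℂ}

lemma memLp_left (h : HasL2Fourier u v) : MemLp u 2 volume := h.1

lemma memLp_right (h : HasL2Fourier u v) : MemLp v 2 volume := h.2.1

lemma congr_right {w : R3 → ℂ} (h : HasL2Fourier u v) (hw : v =ᵐ[volume] w) :
    HasL2Fourier u w := by
  obtain ⟨hu, hv, e⟩ := h
  refine ⟨hu, (memLp_congr_ae hw).1 hv, ?_⟩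
  rw [e, MemLp.toLp_eq_toLp_iff]
  exact hw

lemma add (h₁ : HasL2Fourier u₁ v₁) (h₂ : HasL2Fourier u₂ v₂) :
    HasL2Fourier (fun x => u₁ x + u₂ x) (fun x => v₁ x + v₂ x) := by
  obtain ⟨hu, hv, e⟩ := h₁
  obtain ⟨hu', hv', e'⟩ := h₂
  refine ⟨hu.add hu', hv.add hv', ?_⟩
  have := FourierTransform.fourier_add (hu.toLp u₁) (hu'.toLp u₂)
  rw [e, e'] at this
  exact this

lemma const_mul (c : ℂ) (h : HasL2Fourier u v) :
    HasL2Fourier (fun x => c * u x) (fun x => c * v x) := by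
  obtain ⟨hu, hv, e⟩ := h
  refine ⟨hu.const_mul c, hv.const_mul c, ?_⟩
  have := FourierTransform.fourier_smul c (hu.toLp u)
  rw [e] at this
  exact this

lemma sub (h₁ : HasL2Fourier u₁ v₁) (h₂ : HasL2Fourier u₂ v₂) :
    HasL2Fourier (fun x => u₁ x - u₂ x) (fun x => v₁ x - v₂ x) := by
  simpa [sub_eq_add_neg] using h₁.add (h₂.const_mul (-1))

/-- Plancherel's theorem for the norm. -/
lemma eLpNorm_eq (h : HasL2Fourier u v) : eLpNorm u 2 volume = eLpNorm v 2 volume := by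
  obtain ⟨hu, hv, e⟩ := h
  have := Lp.norm_fourier_eq (hu.toLp u)
  rw [e, Lp.norm_toLp, Lp.norm_toLp, ENNReal.toReal_eq_toReal_iff' hv.2.ne hu.2.ne] at this
  exact this.symm

end HasL2Fourier

lemma inner_toLp {u v : R3 → ℂ} (hu : MemLp u 2 volume) (hv : MemLp v 2 volume) :
    inner ℂ (hv.toLp v) (hu.toLp u) = ∫ x, u x * (starRingEnd ℂ) (v x) := by
  rw [L2.inner_def]
  refine integral_congr_ae ?_
  filter_upwards [hu.coeFn_toLp, hv.coeFn_toLp] with x h1 h2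
  rw [h1, h2, RCLike.inner_apply]

namespace HasL2Fourier

variable {u v u₁ v₁ u₂ v₂ : R3 → ℂ}

/-- Plancherel's theorem for the inner product. -/
lemma integral_mul_conj (h₁ : HasL2Fourier u₁ v₁) (h₂ : HasL2Fourier u₂ v₂) :
    ∫ x, u₁ x * (starRingEnd ℂ) (u₂ x) = ∫ x, v₁ x * (starRingEnd ℂ) (v₂ x) := by
  obtain ⟨hu, hv, e⟩ := h₁
  obtain ⟨hu', hv', e'⟩ := h₂
  rw [← inner_toLp hu hu', ← inner_toLp hv hv', ← e, ← e', Lp.inner_fourier_eq]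

lemma exists_right (hu : MemLp u 2 volume) : ∃ v, HasL2Fourier u v :=
  ⟨(𝓕 (hu.toLp u) : Lp ℂ 2 (volume : Measure R3)), hu, Lp.memLp _, by rw [Lp.toLp_coeFn]⟩

lemma exists_left (hv : MemLp v 2 volume) : ∃ u, HasL2Fourier u v :=
  ⟨(𝓕⁻ (hv.toLp v) : Lp ℂ 2 (volume : Measure R3)), Lp.memLp _, hv, by
    rw [Lp.toLp_coeFn, FourierTransform.fourier_fourierInv_eq]⟩

/-- The duality formula `∫ u 𝓕φ = ∫ 𝓕u φ` against Schwartz functions. -/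
lemma integral_mul_fourier (h : HasL2Fourier u v) (φ : 𝓢(R3, ℂ)) :
    ∫ x, u x * 𝓕 (φ : R3 → ℂ) x = ∫ x, v x * φ x := by
  obtain ⟨hu, hv, e⟩ := h
  have := congrArg (fun T => T φ) (Lp.fourier_toTemperedDistribution_eq (hu.toLp u))
  simp only [TemperedDistribution.fourier_apply, e, Lp.toTemperedDistribution_apply,
    smul_eq_mul] at this
  calc ∫ x, u x * 𝓕 (φ : R3 → ℂ) x
      = ∫ x, (𝓕 φ : 𝓢(R3, ℂ)) x * (hu.toLp u) x := by
        refine integral_congr_ae ?_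
        filter_upwards [hu.coeFn_toLp] with x hx
        rw [hx, SchwartzMap.fourier_coe, mul_comm]
    _ = ∫ x, φ x * (hv.toLp v) x := this
    _ = ∫ x, v x * φ x := by
        refine integral_congr_ae ?_
        filter_upwards [hv.coeFn_toLp] with x hx
        rw [hx, mul_comm]

end HasL2Fourier

/-- Locally integrable functions that agree as tempered distributions are equal. -/
lemma ae_eq_of_forall_schwartz {f g : R3 → ℂ} (hf : LocallyIntegrable f)
    (hg : LocallyIntegrable g)
    (h : ∀ φ : 𝓢(R3, ℂ), ∫ x, f x * φ x = ∫ x, g x * φ x) : f =ᵐ[volume] g := by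
  refine ae_eq_of_integral_contDiff_smul_eq hf hg fun η hη hc => ?_
  have hc' : HasCompactSupport (Complex.ofRealCLM ∘ η) := hc.comp_left rfl
  have hη' : ContDiff ℝ ∞ (Complex.ofRealCLM ∘ η) := by fun_prop
  have := h (hc'.toSchwartzMap hη')
  simpa [mul_comm] using this

namespace HasL2Fourier

variable {u v u₁ v₁ u₂ v₂ : R3 → ℂ}

lemma of_forall_schwartz (hu : MemLp u 2 volume) (hv : MemLp v 2 volume)
    (h : ∀ φ : 𝓢(R3, ℂ), ∫ x, u x * 𝓕 (φ : R3 → ℂ) x = ∫ x, v x * φ x) : HasL2Fourier u v := by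
  obtain ⟨w, hw⟩ := exists_right hu
  refine hw.congr_right (ae_eq_of_forall_schwartz (hw.memLp_right.locallyIntegrable one_le_two)
    (hv.locallyIntegrable one_le_two) fun φ => ?_)
  rw [← hw.integral_mul_fourier, h]

/-- On `L¹ ∩ L²` the `L²` Fourier transform is given by the Fourier integral. -/
lemma of_integrable (hu : MemLp u 2 volume) (hi : Integrable u) : HasL2Fourier u (𝓕 u) := by
  obtain ⟨w, hw⟩ := exists_right hu
  have hcont : Continuous (𝓕 u) :=
    VectorFourier.fourierIntegral_continuous Real.continuous_fourierChar
      (by exact continuous_inner) hi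
  refine hw.congr_right (ae_eq_of_forall_schwartz (hw.memLp_right.locallyIntegrable one_le_two)
    hcont.locallyIntegrable fun φ => ?_)
  rw [← hw.integral_mul_fourier]
  have := VectorFourier.integral_fourierIntegral_smul_eq_flip (L := innerₗ R3) (f := u)
    (g := φ) (μ := volume) (ν := volume) Real.continuous_fourierChar continuous_inner hi
    φ.integrable
  simpa using! this.symm

/-- Modulation becomes translation under the Fourier transform. -/
lemma modulate (h : HasL2Fourier u v) (y : R3) :
    HasL2Fourier (fun x => (Real.fourierChar (inner ℝ x y) : ℂ) * u x) (fun ξ => v (ξ - y)) := by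
  have hc : Continuous fun x : R3 => (Real.fourierChar (inner ℝ x y) : ℂ) :=
    continuous_induced_dom.comp (Real.continuous_fourierChar.comp (by fun_prop))
  have hu : MemLp (fun x => (Real.fourierChar (inner ℝ x y) : ℂ) * u x) 2 volume := by
    refine h.memLp_left.of_le (hc.aestronglyMeasurable.mul h.memLp_left.1) (ae_of_all _ fun x => ?_)
    rw [norm_mul, Circle.norm_coe, one_mul]
  have hv : MemLp (fun ξ => v (ξ - y)) 2 volume :=
    h.memLp_right.comp_measurePreserving (measurePreserving_sub_right volume y)
  refine of_forall_schwartz hu hv fun φ => ?_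
  have key : ∀ x, 𝓕 ((SchwartzMap.compSubConstCLM ℂ (-y) φ : 𝓢(R3, ℂ)) : R3 → ℂ) x
      = (Real.fourierChar (inner ℝ x y) : ℂ) * 𝓕 (φ : R3 → ℂ) x := by
    intro x
    rw [Real.fourier_eq, Real.fourier_eq, ← integral_const_mul]
    rw [← integral_sub_right_eq_self _ y]
    congr 1 with z
    simp only [SchwartzMap.compSubConstCLM_apply, sub_neg_eq_add, sub_add_cancel,
      Circle.smul_def, smul_eq_mul, ← mul_assoc]
    congr 1
    rw [← Circle.coe_mul, ← AddChar.map_add_eq_mul, inner_sub_left, real_inner_comm x y]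
    congr 2
    ring
  calc ∫ x, (Real.fourierChar (inner ℝ x y) : ℂ) * u x * 𝓕 (φ : R3 → ℂ) x
      = ∫ x, u x * 𝓕 ((SchwartzMap.compSubConstCLM ℂ (-y) φ : 𝓢(R3, ℂ)) : R3 → ℂ) x := by
        congr 1 with x
        rw [key]; ring
    _ = ∫ x, v x * φ (x + y) := by
        rw [h.integral_mul_fourier]
        simp
    _ = ∫ x, v (x - y) * φ x := by
        rw [← integral_sub_right_eq_self _ y]
        simp

/-- The duality formula `∫ u 𝓕q = ∫ 𝓕u q` for square-integrable functions. -/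
lemma integral_mul_eq (h₁ : HasL2Fourier u₁ v₁) (h₂ : HasL2Fourier u₂ v₂) :
    ∫ x, u₁ x * v₂ x = ∫ x, v₁ x * u₂ x := by
  obtain ⟨hu₁, hv₁, e₁⟩ := h₁
  obtain ⟨hu₂, hv₂, e₂⟩ := h₂
  have hu₁' : MemLp (fun x => (starRingEnd ℂ) (u₁ x)) 2 volume := hu₁.star
  have hv₁' : MemLp (fun x => (starRingEnd ℂ) (v₁ x)) 2 volume := hv₁.star
  have key : ∀ q : Lp ℂ 2 (volume : Measure R3),
      inner ℂ (hu₁'.toLp _) (𝓕 q) = inner ℂ (hv₁'.toLp _) q := by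
    intro q
    refine DenseRange.induction_on
      (SchwartzMap.denseRange_toLpCLM (p := 2) (E := R3) (F := ℂ) (μ := volume)
        ENNReal.ofNat_ne_top) q ?_ ?_
    · refine isClosed_eq ?_ ?_
      · exact continuous_const.inner (FourierTransform.continuous_fourier)
      · exact continuous_const.inner continuous_id
    · intro φ
      rw [SchwartzMap.toLpCLM_apply, SchwartzMap.toLp_fourier_eq]
      erw [inner_toLp ((𝓕 φ : 𝓢(R3, ℂ)).memLp 2) hu₁', inner_toLp (φ.memLp 2) hv₁']
      have := integral_mul_fourier ⟨hu₁, hv₁, e₁⟩ φ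
      simp only [Complex.conj_conj, SchwartzMap.fourier_coe]
      simpa [mul_comm] using this
  have := key (hu₂.toLp u₂)
  rw [e₂, inner_toLp, inner_toLp] at this
  simpa [mul_comm] using this

end HasL2Fourier

/-! ### Fourier multipliers acting on distributions by duality -/

lemma exists_schwartz_one_add_sq_mul (φ : 𝓢(R3, ℂ)) :
    ∃ ψ : 𝓢(R3, ℂ), ∀ x, ψ x = ((1 + ‖x‖ ^ 2 : ℝ) : ℂ) * φ x := by
  have hg : (fun x : R3 => ((1 + ‖x‖ ^ 2 : ℝ) : ℂ)).HasTemperateGrowth :=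
    Function.HasTemperateGrowth.comp (by fun_prop : Function.HasTemperateGrowth Complex.ofReal)
      ((Function.HasTemperateGrowth.const 1).add (Function.hasTemperateGrowth_norm_sq R3))
  exact ⟨SchwartzMap.smulLeftCLM ℂ (fun x : R3 => ((1 + ‖x‖ ^ 2 : ℝ) : ℂ)) φ, fun x => by
    rw [SchwartzMap.smulLeftCLM_apply_apply hg, smul_eq_mul]⟩

section Symbol

variable {σ : R3 → ℂ} {C : ℝ}

lemma norm_symbol_mul_le (hC : ∀ ξ, ‖σ ξ‖ ≤ C * (1 + ‖ξ‖ ^ 2)) {φ ψ : 𝓢(R3, ℂ)}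
    (hψ : ∀ x, ψ x = ((1 + ‖x‖ ^ 2 : ℝ) : ℂ) * φ x) (ξ : R3) :
    ‖σ ξ * φ ξ‖ ≤ ‖(C : ℂ) * ψ ξ‖ := by
  have h0 : 0 ≤ C * (1 + ‖ξ‖ ^ 2) := (norm_nonneg _).trans (hC ξ)
  have hC0 : 0 ≤ C := nonneg_of_mul_nonneg_left h0 (by positivity)
  rw [hψ, ← mul_assoc, norm_mul, norm_mul, norm_mul, Complex.norm_real, Complex.norm_real,
    Real.norm_of_nonneg hC0, Real.norm_of_nonneg (by positivity : (0:ℝ) ≤ 1 + ‖ξ‖ ^ 2)]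
  gcongr
  exact hC ξ

lemma integrable_symbol_mul (hσ : Continuous σ) (hC : ∀ ξ, ‖σ ξ‖ ≤ C * (1 + ‖ξ‖ ^ 2))
    (φ : 𝓢(R3, ℂ)) : Integrable (fun ξ => σ ξ * φ ξ) := by
  obtain ⟨ψ, hψ⟩ := exists_schwartz_one_add_sq_mul φ
  exact (ψ.integrable.const_mul (C : ℂ)).mono (hσ.mul φ.continuous).aestronglyMeasurable
    (ae_of_all _ (norm_symbol_mul_le hC hψ))

lemma memLp_symbol_mul (hσ : Continuous σ) (hC : ∀ ξ, ‖σ ξ‖ ≤ C * (1 + ‖ξ‖ ^ 2))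
    (φ : 𝓢(R3, ℂ)) : MemLp (fun ξ => σ ξ * φ ξ) 2 volume := by
  obtain ⟨ψ, hψ⟩ := exists_schwartz_one_add_sq_mul φ
  exact ((ψ.memLp 2).const_mul (C : ℂ)).of_le (hσ.mul φ.continuous).aestronglyMeasurable
    (ae_of_all _ (norm_symbol_mul_le hC hψ))

lemma fourierInv_symbol_mul_fourier (hσ : ∀ ξ, σ (-ξ) = σ ξ) (η : 𝓢(R3, ℂ)) :
    𝓕⁻ (fun ξ => σ ξ * 𝓕 ((𝓕 η : 𝓢(R3, ℂ)) : R3 → ℂ) ξ) = 𝓕 (fun ξ => σ ξ * η ξ) := by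
  rw [Real.fourierInv_eq_fourier_comp_neg]
  congr 1
  ext ξ
  rw [hσ, ← Real.fourierInv_eq_fourier_neg, ← SchwartzMap.fourierInv_coe,
    FourierTransform.fourierInv_fourier_eq]

/-- A distributional identity `σ(D) u = f` between square-integrable functions holds if and only
if it holds almost everywhere on the Fourier side. -/
lemma forall_integral_symbol_iff (hσc : Continuous σ) (hC : ∀ ξ, ‖σ ξ‖ ≤ C * (1 + ‖ξ‖ ^ 2))
    (hσ : ∀ ξ, σ (-ξ) = σ ξ) {u v f g : R3 → ℂ} (hu : HasL2Fourier u v)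
    (hf : HasL2Fourier f g) :
    (∀ φ : 𝓢(R3, ℂ), ∫ x, u x * 𝓕⁻ (fun ξ => σ ξ * 𝓕 (φ : R3 → ℂ) ξ) x = ∫ x, f x * φ x)
      ↔ (fun ξ => σ ξ * v ξ) =ᵐ[volume] g := by
  have key : ∀ η : 𝓢(R3, ℂ),
      ∫ x, u x * 𝓕⁻ (fun ξ => σ ξ * 𝓕 ((𝓕 η : 𝓢(R3, ℂ)) : R3 → ℂ) ξ) x
        = ∫ ξ, σ ξ * v ξ * η ξ := by
    intro η
    rw [fourierInv_symbol_mul_fourier hσ]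
    have h := HasL2Fourier.of_integrable (memLp_symbol_mul hσc hC η)
      (integrable_symbol_mul hσc hC η)
    rw [hu.integral_mul_eq h]
    congr 1 with ξ
    ring
  have key' : ∀ η : 𝓢(R3, ℂ), ∫ x, f x * (𝓕 η : 𝓢(R3, ℂ)) x = ∫ ξ, g ξ * η ξ := fun η => by
    rw [← hf.integral_mul_fourier η, SchwartzMap.fourier_coe]
  constructor
  · intro h
    refine ae_eq_of_forall_schwartz ?_ (hf.memLp_right.locallyIntegrable one_le_two) fun η => ?_
    · have hl : LocallyIntegrable v := hu.memLp_right.locallyIntegrable one_le_two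
      rw [← locallyIntegrableOn_univ] at hl ⊢
      exact hl.continuousOn_mul hσc.continuousOn isOpen_univ.isLocallyClosed
    · rw [← key, h, key']
  · intro h φ
    have hφ : (𝓕 (𝓕⁻ φ : 𝓢(R3, ℂ)) : 𝓢(R3, ℂ)) = φ := FourierTransform.fourier_fourierInv_eq φ
    have h1 := key (𝓕⁻ φ)
    have h2 := key' (𝓕⁻ φ)
    rw [hφ] at h1 h2
    rw [h1, h2]
    refine integral_congr_ae ?_
    filter_upwards [h] with ξ hξ
    rw [hξ]

end Symbol

/-! ### The symbols of the half-Laplacian and of the Laplacian -/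

/-- The symbol `|ξ| - μ` of `(-Δ)^{1/2} - μ`, in the normalization of the Fourier transform with
frequency `2πξ`. -/
noncomputable def halfSymbol (μ : ℂ) (ξ : R3) : ℂ := ((2 * Real.pi * ‖ξ‖ : ℝ) : ℂ) - μ

lemma continuous_halfSymbol (μ : ℂ) : Continuous (halfSymbol μ) := by
  unfold halfSymbol; fun_prop

lemma halfSymbol_neg (μ : ℂ) (ξ : R3) : halfSymbol μ (-ξ) = halfSymbol μ ξ := by
  simp [halfSymbol]

lemma norm_halfSymbol_le (μ : ℂ) (ξ : R3) :
    ‖halfSymbol μ ξ‖ ≤ (2 * Real.pi + ‖μ‖) * (1 + ‖ξ‖ ^ 2) := by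
  have h1 : ‖halfSymbol μ ξ‖ ≤ 2 * Real.pi * ‖ξ‖ + ‖μ‖ := by
    refine (norm_sub_le _ _).trans ?_
    rw [Complex.norm_real, Real.norm_of_nonneg (by positivity)]
  have h2 : ‖ξ‖ ≤ 1 + ‖ξ‖ ^ 2 := by nlinarith [sq_nonneg (‖ξ‖ - 1), norm_nonneg ξ]
  have := Real.pi_pos
  nlinarith [norm_nonneg μ, sq_nonneg ‖ξ‖, mul_nonneg (norm_nonneg μ) (sq_nonneg ‖ξ‖)]

lemma fourierInv_sub_of_integrable {p q : R3 → ℂ} (hp : Integrable p) (hq : Integrable q)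
    (x : R3) : 𝓕⁻ (fun ξ => p ξ - q ξ) x = 𝓕⁻ p x - 𝓕⁻ q x := by
  simp only [Real.fourierInv_eq_fourier_neg, Real.fourier_eq]
  rw [← integral_sub]
  · simp only [smul_sub]
  · exact (Real.fourierIntegral_convergent_iff _).2 hp
  · exact (Real.fourierIntegral_convergent_iff _).2 hq

lemma fourierInv_const_mul_fourier (c : ℂ) (φ : 𝓢(R3, ℂ)) (x : R3) :
    𝓕⁻ (fun ξ => c * 𝓕 (φ : R3 → ℂ) ξ) x = c * φ x := by
  have h : φ x = 𝓕⁻ (𝓕 (φ : R3 → ℂ)) x := by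
    rw [← SchwartzMap.fourier_coe, ← SchwartzMap.fourierInv_coe,
      FourierTransform.fourierInv_fourier_eq]
  rw [h]
  simp only [Real.fourierInv_eq_fourier_neg, Real.fourier_eq]
  rw [← integral_const_mul]
  simp only [Circle.smul_def, smul_eq_mul]
  congr 1 with ξ
  ring

lemma halfLaplacian_sub_eq (μ : ℂ) (φ : 𝓢(R3, ℂ)) (x : R3) :
    halfLaplacian φ x - μ * φ x = 𝓕⁻ (fun ξ => halfSymbol μ ξ * 𝓕 (φ : R3 → ℂ) ξ) x := by
  simp only [halfSymbol, sub_mul]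
  rw [fourierInv_sub_of_integrable, fourierInv_const_mul_fourier, halfLaplacian]
  · have := integrable_symbol_mul (continuous_halfSymbol 0) (norm_halfSymbol_le 0)
      (𝓕 φ : 𝓢(R3, ℂ))
    simpa [halfSymbol, SchwartzMap.fourier_coe] using this
  · exact ((𝓕 φ : 𝓢(R3, ℂ)).integrable).const_mul μ

/-- The symbol `|ξ|² - μ²` of `-Δ - μ²`. -/
noncomputable def helmholtzSymbol (μ : ℂ) (ξ : R3) : ℂ :=
  ((2 * Real.pi * ‖ξ‖ : ℝ) : ℂ) ^ 2 - μ ^ 2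

lemma continuous_helmholtzSymbol (μ : ℂ) : Continuous (helmholtzSymbol μ) := by
  unfold helmholtzSymbol; fun_prop

lemma helmholtzSymbol_neg (μ : ℂ) (ξ : R3) : helmholtzSymbol μ (-ξ) = helmholtzSymbol μ ξ := by
  simp [helmholtzSymbol]

lemma norm_helmholtzSymbol_le (μ : ℂ) (ξ : R3) :
    ‖helmholtzSymbol μ ξ‖ ≤ ((2 * Real.pi) ^ 2 + ‖μ‖ ^ 2) * (1 + ‖ξ‖ ^ 2) := by
  have h1 : ‖helmholtzSymbol μ ξ‖ ≤ (2 * Real.pi * ‖ξ‖) ^ 2 + ‖μ‖ ^ 2 := by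
    refine (norm_sub_le _ _).trans ?_
    rw [norm_pow, norm_pow, Complex.norm_real, Real.norm_of_nonneg (by positivity)]
  nlinarith [sq_nonneg ‖μ‖, sq_nonneg (2 * Real.pi), mul_nonneg (sq_nonneg ‖μ‖) (sq_nonneg ‖ξ‖)]

open Laplacian in
lemma neg_laplacian_sub_eq (μ : ℂ) (φ : 𝓢(R3, ℂ)) (x : R3) :
    -(Δ φ : 𝓢(R3, ℂ)) x - μ ^ 2 * φ x
      = 𝓕⁻ (fun ξ => helmholtzSymbol μ ξ * 𝓕 (φ : R3 → ℂ) ξ) x := by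
  have hg : (fun ξ : R3 => ‖ξ‖ ^ 2).HasTemperateGrowth := Function.hasTemperateGrowth_norm_sq R3
  have hg' : (fun ξ : R3 => ((‖ξ‖ ^ 2 : ℝ) : ℂ)).HasTemperateGrowth :=
    Function.HasTemperateGrowth.comp (by fun_prop : Function.HasTemperateGrowth Complex.ofReal) hg
  simp only [helmholtzSymbol, sub_mul]
  rw [fourierInv_sub_of_integrable, fourierInv_const_mul_fourier,
    SchwartzMap.laplacian_eq_fourierMultiplierCLM]
  · congr 1
    have e : (fun ξ : R3 => ((2 * Real.pi * ‖ξ‖ : ℝ) : ℂ) ^ 2 * 𝓕 (φ : R3 → ℂ) ξ)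
        = (((((2 * Real.pi) ^ 2 : ℝ) : ℂ) • SchwartzMap.smulLeftCLM ℂ
            (fun ξ : R3 => ‖ξ‖ ^ 2) (𝓕 φ) : 𝓢(R3, ℂ)) : R3 → ℂ) := by
      ext ξ
      rw [smul_apply, SchwartzMap.smulLeftCLM_apply_apply hg,
        SchwartzMap.fourier_coe]
      simp only [smul_eq_mul, Complex.real_smul]
      push_cast
      ring
    rw [e, ← SchwartzMap.fourierInv_coe, FourierTransform.fourierInv_smul,
      SchwartzMap.fourierMultiplierCLM_apply, smul_apply, smul_apply]
    simp only [Complex.real_smul, smul_eq_mul]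
    push_cast
    rw [neg_mul, neg_neg]
  · have := integrable_symbol_mul (continuous_helmholtzSymbol 0) (norm_helmholtzSymbol_le 0)
      (𝓕 φ : 𝓢(R3, ℂ))
    simpa [helmholtzSymbol, SchwartzMap.fourier_coe] using this
  · exact ((𝓕 φ : 𝓢(R3, ℂ)).integrable).const_mul (μ ^ 2)

/-- `((-Δ)^{1/2} - μ) u = f` between square-integrable functions, read on the Fourier side. -/
lemma forall_integral_halfLaplacian_sub_iff (μ : ℂ) {u v f g : R3 → ℂ} (hu : HasL2Fourier u v)
    (hf : HasL2Fourier f g) :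
    (∀ φ : 𝓢(R3, ℂ), ∫ x, u x * (halfLaplacian φ x - μ * φ x) = ∫ x, f x * φ x)
      ↔ (fun ξ => halfSymbol μ ξ * v ξ) =ᵐ[volume] g := by
  simp only [halfLaplacian_sub_eq]
  exact forall_integral_symbol_iff (continuous_halfSymbol μ) (norm_halfSymbol_le μ)
    (halfSymbol_neg μ) hu hf

open Laplacian in
/-- `(-Δ - μ²) u = f` between square-integrable functions, read on the Fourier side. -/
lemma forall_integral_neg_laplacian_sub_iff (μ : ℂ) {u v f g : R3 → ℂ} (hu : HasL2Fourier u v)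
    (hf : HasL2Fourier f g) :
    (∀ φ : 𝓢(R3, ℂ), ∫ x, u x * (-(Δ φ : 𝓢(R3, ℂ)) x - μ ^ 2 * φ x) = ∫ x, f x * φ x)
      ↔ (fun ξ => helmholtzSymbol μ ξ * v ξ) =ᵐ[volume] g := by
  simp only [neg_laplacian_sub_eq]
  exact forall_integral_symbol_iff (continuous_helmholtzSymbol μ) (norm_helmholtzSymbol_le μ)
    (helmholtzSymbol_neg μ) hu hf

/-! ### Fourier multipliers on the weighted space -/

/-- The weight `1 + |x|`, comparable to `(1 + |x|^2)^{1/2}`. -/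
noncomputable def weight (x : R3) : ℂ := ((1 + ‖x‖ : ℝ) : ℂ)

lemma norm_weight (x : R3) : ‖weight x‖ = 1 + ‖x‖ := by
  rw [weight, Complex.norm_real, Real.norm_of_nonneg (by positivity)]

lemma weight_ne_zero (x : R3) : weight x ≠ 0 := by
  rw [← norm_ne_zero_iff, norm_weight]; positivity

@[fun_prop]
lemma continuous_weight : Continuous weight := by unfold weight; fun_prop

lemma eLpNorm_le_eLpNorm_weight_mul (f : R3 → ℂ) :
    eLpNorm f 2 volume ≤ eLpNorm (fun x => weight x * f x) 2 volume := by
  refine eLpNorm_mono fun x => ?_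
  rw [norm_mul, norm_weight]
  nlinarith [norm_nonneg x, norm_nonneg (f x), mul_nonneg (norm_nonneg x) (norm_nonneg (f x))]

lemma memLp_of_weight_mul {f : R3 → ℂ} (hf : MemLp (fun x => weight x * f x) 2 volume) :
    MemLp f 2 volume := by
  have hm : AEStronglyMeasurable f volume := by
    have := (continuous_weight.inv₀ weight_ne_zero).aestronglyMeasurable (μ := volume) |>.mul hf.1
    refine this.congr (ae_of_all _ fun x => ?_)
    simp [inv_mul_cancel_left₀ (weight_ne_zero x)]
  exact ⟨hm, (eLpNorm_le_eLpNorm_weight_mul f).trans_lt hf.2⟩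

section Multiplier

variable {m h k f : R3 → ℂ} {A B : ℝ}

lemma eLpNorm_multiplier_le (hA : ∀ ξ, ‖m ξ‖ ≤ A) (hh : HasL2Fourier h k)
    (hf : HasL2Fourier f (fun ξ => m ξ * k ξ)) :
    eLpNorm f 2 volume ≤ ENNReal.ofReal A * eLpNorm h 2 volume := by
  rw [hf.eLpNorm_eq, hh.eLpNorm_eq]
  refine eLpNorm_le_mul_eLpNorm_of_ae_le_mul (ae_of_all _ fun ξ => ?_) 2
  rw [norm_mul]
  gcongr
  exact hA ξ

lemma exists_multiplier (hm : Continuous m) (hA : ∀ ξ, ‖m ξ‖ ≤ A) (hh : HasL2Fourier h k) :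
    ∃ f, HasL2Fourier f (fun ξ => m ξ * k ξ) := by
  refine HasL2Fourier.exists_left ?_
  refine (hh.memLp_right.const_mul (A : ℂ)).of_le
    (hm.aestronglyMeasurable.mul hh.memLp_right.1) (ae_of_all _ fun ξ => ?_)
  rw [norm_mul, norm_mul, Complex.norm_real]
  gcongr
  exact (hA ξ).trans (le_abs_self A)

/-- Modulation by a frequency `y` translates the symbol, so a Lipschitz multiplier commutes with
it up to an error `O(|y|)`. -/
lemma eLpNorm_modulate_sub_multiplier_le (hA : ∀ ξ, ‖m ξ‖ ≤ A)
    (hB : ∀ ξ η, ‖m ξ - m η‖ ≤ B * ‖ξ - η‖) (hm : Continuous m) (hh : HasL2Fourier h k)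
    (hf : HasL2Fourier f (fun ξ => m ξ * k ξ)) (y : R3) :
    eLpNorm (fun x => ((Real.fourierChar (inner ℝ x y) : ℂ) * f x - f x)) 2 volume
      ≤ ENNReal.ofReal A *
          eLpNorm (fun x => ((Real.fourierChar (inner ℝ x y) : ℂ) * h x - h x)) 2 volume
        + ENNReal.ofReal (B * ‖y‖) * eLpNorm h 2 volume := by
  have h1 := (hf.modulate y).sub hf
  have h2 := (hh.modulate y).sub hh
  rw [h1.eLpNorm_eq, h2.eLpNorm_eq, hh.eLpNorm_eq]
  have e : (fun ξ => m (ξ - y) * k (ξ - y) - m ξ * k ξ)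
      = (fun ξ => m (ξ - y) * (k (ξ - y) - k ξ)) + fun ξ => (m (ξ - y) - m ξ) * k ξ := by
    ext ξ; simp only [Pi.add_apply]; ring
  have hm' : Continuous fun ξ => m (ξ - y) := hm.comp (by fun_prop)
  rw [e]
  refine (eLpNorm_add_le (hm'.aestronglyMeasurable.mul h2.memLp_right.1)
    ((hm'.sub hm).aestronglyMeasurable.mul hh.memLp_right.1) one_le_two).trans (add_le_add ?_ ?_)
  · refine eLpNorm_le_mul_eLpNorm_of_ae_le_mul (ae_of_all _ fun ξ => ?_) 2
    rw [Pi.mul_apply, norm_mul]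
    gcongr
    exact hA _
  · refine eLpNorm_le_mul_eLpNorm_of_ae_le_mul (ae_of_all _ fun ξ => ?_) 2
    rw [Pi.mul_apply, norm_mul]
    gcongr
    simpa using hB (ξ - y) ξ

lemma norm_fourierChar_sub_one_le (t : ℝ) :
    ‖(Real.fourierChar t : ℂ) - 1‖ ≤ 2 * Real.pi * |t| := by
  have := Real.norm_exp_I_mul_ofReal_sub_one_le (x := 2 * Real.pi * t)
  rw [Real.fourierChar_apply, mul_comm _ Complex.I]
  refine this.trans ?_
  rw [Real.norm_eq_abs, abs_mul, abs_of_pos (by positivity : (0:ℝ) < 2 * Real.pi)]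

/-- A bounded Lipschitz multiplier preserves first moments in each direction. The bound for
`⟨x, e⟩ f` is obtained from the one for the difference quotients of modulations, by Fatou. -/
lemma eLpNorm_inner_mul_multiplier_le (hA : ∀ ξ, ‖m ξ‖ ≤ A)
    (hB : ∀ ξ η, ‖m ξ - m η‖ ≤ B * ‖ξ - η‖) (hm : Continuous m) (hh : HasL2Fourier h k)
    (hf : HasL2Fourier f (fun ξ => m ξ * k ξ)) {e : R3} (he : ‖e‖ = 1) :
    eLpNorm (fun x => 2 * Real.pi * Complex.I * (inner ℝ x e : ℝ) * f x) 2 volume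
      ≤ ENNReal.ofReal (2 * Real.pi * A + B) * eLpNorm (fun x => weight x * h x) 2 volume := by
  have hA0 : 0 ≤ A := (norm_nonneg _).trans (hA 0)
  have hB0 : 0 ≤ B := by
    have := (norm_nonneg _).trans (hB e 0)
    rwa [sub_zero, he, mul_one] at this
  have hpi := Real.pi_pos
  set t : ℕ → ℝ := fun n => 1 / ((n : ℝ) + 1) with ht
  have htpos : ∀ n, 0 < t n := fun n => by positivity
  have ht0 : Filter.Tendsto t Filter.atTop (nhds 0) := tendsto_one_div_add_atTop_nhds_zero_nat
  have hc : ∀ y : R3, Continuous fun x : R3 => (Real.fourierChar (inner ℝ x y) : ℂ) := fun y =>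
    continuous_induced_dom.comp (Real.continuous_fourierChar.comp (by fun_prop))
  refine Lp.eLpNorm_le_of_ae_tendsto (u := Filter.atTop)
    (f := fun n x => ((t n)⁻¹ : ℂ) * ((Real.fourierChar (inner ℝ x (t n • e)) : ℂ) * f x - f x))
    (Filter.Eventually.of_forall fun n => ?_) (fun n => ?_) (ae_of_all _ fun x => ?_)
  · have e1 : eLpNorm (fun x => ((t n)⁻¹ : ℂ) *
        ((Real.fourierChar (inner ℝ x (t n • e)) : ℂ) * f x - f x)) 2 volume
        = ENNReal.ofReal (t n)⁻¹ *
          eLpNorm (fun x => (Real.fourierChar (inner ℝ x (t n • e)) : ℂ) * f x - f x) 2 volume := by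
      have := eLpNorm_const_smul ((t n)⁻¹ : ℂ)
        (fun x => (Real.fourierChar (inner ℝ x (t n • e)) : ℂ) * f x - f x) 2 volume
      simp only [Pi.smul_def, smul_eq_mul] at this
      rw [this]
      congr 1
      rw [← ofReal_norm, norm_inv, Complex.norm_real, Real.norm_of_nonneg (htpos n).le]
    have e2 : eLpNorm (fun x => (Real.fourierChar (inner ℝ x (t n • e)) : ℂ) * h x - h x) 2 volume
        ≤ ENNReal.ofReal (2 * Real.pi * t n) * eLpNorm (fun x => weight x * h x) 2 volume := by
      refine eLpNorm_le_mul_eLpNorm_of_ae_le_mul (ae_of_all _ fun x => ?_) 2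
      have : (Real.fourierChar (inner ℝ x (t n • e)) : ℂ) * h x - h x
          = ((Real.fourierChar (inner ℝ x (t n • e)) : ℂ) - 1) * h x := by ring
      rw [this, norm_mul, norm_mul, norm_weight, ← mul_assoc]
      gcongr
      refine (norm_fourierChar_sub_one_le _).trans ?_
      rw [real_inner_smul_right, abs_mul, abs_of_pos (htpos n), ← mul_assoc]
      gcongr
      have := abs_real_inner_le_norm x e
      rw [he, mul_one] at this
      linarith
    have e3 := eLpNorm_le_eLpNorm_weight_mul h
    rw [e1]
    calc _ ≤ ENNReal.ofReal (t n)⁻¹ * (ENNReal.ofReal A * (ENNReal.ofReal (2 * Real.pi * t n) *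
            eLpNorm (fun x => weight x * h x) 2 volume)
            + ENNReal.ofReal (B * ‖t n • e‖) * eLpNorm (fun x => weight x * h x) 2 volume) := by
          gcongr
          refine (eLpNorm_modulate_sub_multiplier_le hA hB hm hh hf _).trans ?_
          gcongr
      _ = _ := by
          rw [norm_smul, he, mul_one, Real.norm_of_nonneg (htpos n).le, ← mul_assoc, ← add_mul,
            ← mul_assoc, ← ENNReal.ofReal_mul hA0,
            ← ENNReal.ofReal_add (by have := htpos n; positivity) (by have := htpos n; positivity),
            ← ENNReal.ofReal_mul (by have := htpos n; positivity)]
          congr 2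
          have := (htpos n).ne'
          field_simp
  · exact (((hc _).aestronglyMeasurable.mul hf.memLp_left.1).sub hf.memLp_left.1).const_mul _
  · have hd : HasDerivAt (fun s : ℝ => (Real.fourierChar (s * inner ℝ x e) : ℂ))
        (2 * Real.pi * Complex.I * (inner ℝ x e : ℝ)) 0 := by
      have h1 := (Real.hasDerivAt_fourierChar (0 * inner ℝ x e)).scomp 0
        ((hasDerivAt_id (0:ℝ)).mul_const (inner ℝ x e))
      simp only [one_mul, zero_mul, AddChar.map_zero_eq_one, Circle.coe_one, mul_one,
        Complex.real_smul] at h1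
      refine h1.congr_deriv ?_
      ring
    have h2 := (hd.tendsto_slope_zero_right).comp
      (tendsto_nhdsWithin_iff.2 ⟨ht0, Filter.Eventually.of_forall fun n => htpos n⟩)
    have h3 := h2.mul_const (f x)
    refine h3.congr fun n => ?_
    simp only [Function.comp, zero_add, zero_mul, AddChar.map_zero_eq_one, Circle.coe_one,
      real_inner_smul_right, Complex.real_smul]
    push_cast
    ring

/-- Bounded Lipschitz Fourier multipliers are bounded on the weighted space `L^{2,1}`. -/
lemma eLpNorm_weight_mul_multiplier_le (hA : ∀ ξ, ‖m ξ‖ ≤ A)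
    (hB : ∀ ξ η, ‖m ξ - m η‖ ≤ B * ‖ξ - η‖) (hm : Continuous m) (hh : HasL2Fourier h k)
    (hf : HasL2Fourier f (fun ξ => m ξ * k ξ)) :
    eLpNorm (fun x => weight x * f x) 2 volume
      ≤ ENNReal.ofReal (A + 3 * (2 * Real.pi * A + B)) *
        eLpNorm (fun x => weight x * h x) 2 volume := by
  have hA0 : 0 ≤ A := (norm_nonneg _).trans (hA 0)
  set e : Fin 3 → R3 := fun j => EuclideanSpace.single j 1
  have he : ∀ j, ‖e j‖ = 1 := fun j => by simp [e]
  have hB0 : 0 ≤ B := by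
    have := (norm_nonneg _).trans (hB (e 0) 0)
    rwa [sub_zero, he, mul_one] at this
  have hpi := Real.pi_pos
  set F : Fin 3 → R3 → ℂ := fun j x => 2 * Real.pi * Complex.I * (inner ℝ x (e j) : ℝ) * f x
  have hin : ∀ x : R3, ∀ j, inner ℝ x (e j) = x j := fun x j => by
    simp [e, EuclideanSpace.inner_single_right]
  have hFm : ∀ j, AEStronglyMeasurable (F j) volume := fun j =>
    AEStronglyMeasurable.mul (Continuous.aestronglyMeasurable (by fun_prop)) hf.memLp_left.1
  have hF : ∀ j, eLpNorm (F j) 2 volume ≤ ENNReal.ofReal (2 * Real.pi * A + B) *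
      eLpNorm (fun x => weight x * h x) 2 volume := fun j =>
    eLpNorm_inner_mul_multiplier_le hA hB hm hh hf (he j)
  have hf0 : eLpNorm f 2 volume ≤ ENNReal.ofReal A * eLpNorm (fun x => weight x * h x) 2 volume :=
    (eLpNorm_multiplier_le hA hh hf).trans (by gcongr; exact eLpNorm_le_eLpNorm_weight_mul h)
  have hle : ∀ x, ‖weight x * f x‖ ≤ ‖f x‖ + ∑ j, ‖F j x‖ := by
    intro x
    have h1 : ∀ j, ‖F j x‖ = 2 * Real.pi * |x j| * ‖f x‖ := fun j => by
      simp only [F, hin, norm_mul, Complex.norm_I, Complex.norm_real, Complex.norm_ofNat,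
        Real.norm_eq_abs, abs_of_pos hpi, mul_one]
    have h2 : ‖x‖ ≤ ∑ j, |x j| := by
      have : x = ∑ j, x j • e j := by
        ext i
        simp [e, Finset.sum_apply, Pi.single_apply]
      calc ‖x‖ = ‖∑ j, x j • e j‖ := by rw [← this]
        _ ≤ ∑ j, ‖x j • e j‖ := norm_sum_le _ _
        _ = _ := by simp [norm_smul, he]
    rw [norm_mul, norm_weight, add_mul, one_mul]
    simp only [h1]
    rw [← Finset.sum_mul, ← Finset.mul_sum]
    gcongr
    refine h2.trans ?_
    have : 0 ≤ ∑ j, |x j| := by positivity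
    nlinarith [Real.pi_gt_three]
  have hmeas : ∀ j, AEStronglyMeasurable (fun x => ‖F j x‖) volume := fun j => (hFm j).norm
  calc eLpNorm (fun x => weight x * f x) 2 volume
      ≤ eLpNorm ((fun x => ‖f x‖) + ∑ j, fun x => ‖F j x‖) 2 volume := by
        refine eLpNorm_mono_real fun x => ?_
        simpa using hle x
    _ ≤ eLpNorm (fun x => ‖f x‖) 2 volume + ∑ j, eLpNorm (fun x => ‖F j x‖) 2 volume := by
        refine (eLpNorm_add_le hf.memLp_left.1.norm
          (Finset.aestronglyMeasurable_sum _ fun j _ => hmeas j) one_le_two).trans ?_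
        gcongr
        exact eLpNorm_sum_le (fun j _ => hmeas j) one_le_two
    _ ≤ ENNReal.ofReal A * eLpNorm (fun x => weight x * h x) 2 volume
        + ∑ _j : Fin 3, ENNReal.ofReal (2 * Real.pi * A + B) *
          eLpNorm (fun x => weight x * h x) 2 volume := by
        simp only [eLpNorm_norm]
        gcongr with j
        exact hF j
    _ = _ := by
        rw [Finset.sum_const, Finset.card_univ, Fintype.card_fin, nsmul_eq_mul, ← mul_assoc,
          ← add_mul, ENNReal.ofReal_add hA0 (by positivity), ENNReal.ofReal_mul (by norm_num)]
        norm_num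

end Multiplier

/-! ### The resolvent of the half-Laplacian -/

/-- Applying the Fourier transform twice is the reflection. -/
lemma HasL2Fourier.flip {u v : R3 → ℂ} (h : HasL2Fourier u v) :
    HasL2Fourier v (fun x => u (-x)) := by
  have hu : MemLp (fun x => u (-x)) 2 volume :=
    h.memLp_left.comp_measurePreserving (Measure.measurePreserving_neg volume)
  refine HasL2Fourier.of_forall_schwartz h.memLp_right hu fun φ => ?_
  have h1 := h.integral_mul_fourier (𝓕 φ : 𝓢(R3, ℂ))
  rw [SchwartzMap.fourier_coe] at h1
  rw [← h1, ← integral_neg_eq_self]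
  congr 1 with x
  rw [← Real.fourierInv_eq_fourier_neg, ← SchwartzMap.fourier_coe, ← SchwartzMap.fourierInv_coe,
    FourierTransform.fourierInv_fourier_eq]

lemma HasL2Fourier.of_integrable_right {q : R3 → ℂ} (hq : MemLp q 2 volume) (hi : Integrable q) :
    HasL2Fourier (𝓕⁻ q) q := by
  have h1 : MemLp (fun x => q (-x)) 2 volume :=
    hq.comp_measurePreserving (Measure.measurePreserving_neg volume)
  have := (HasL2Fourier.of_integrable h1 hi.comp_neg).flip
  simpa [Real.fourierInv_eq_fourier_comp_neg] using this

/-- The symbol `(|ξ| + μ)⁻¹` of `((-Δ)^{1/2} + μ)⁻¹`. -/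
noncomputable def resolventSymbol (μ : ℂ) (ξ : R3) : ℂ := (((2 * Real.pi * ‖ξ‖ : ℝ) : ℂ) + μ)⁻¹

section Resolvent

variable {μ : ℂ}

lemma re_le_norm_add (ξ : R3) : μ.re ≤ ‖((2 * Real.pi * ‖ξ‖ : ℝ) : ℂ) + μ‖ := by
  refine le_trans ?_ (Complex.re_le_norm _)
  rw [Complex.add_re, Complex.ofReal_re]
  have := Real.pi_pos
  have : 0 ≤ 2 * Real.pi * ‖ξ‖ := by positivity
  linarith

lemma add_ne_zero_of_re_pos (hμ : 0 < μ.re) (ξ : R3) : ((2 * Real.pi * ‖ξ‖ : ℝ) : ℂ) + μ ≠ 0 :=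
  norm_pos_iff.1 (hμ.trans_le (re_le_norm_add ξ))

lemma continuous_resolventSymbol (hμ : 0 < μ.re) : Continuous (resolventSymbol μ) := by
  unfold resolventSymbol
  exact Continuous.inv₀ (by fun_prop) (add_ne_zero_of_re_pos hμ)

lemma norm_resolventSymbol_le (hμ : 0 < μ.re) (ξ : R3) : ‖resolventSymbol μ ξ‖ ≤ μ.re⁻¹ := by
  rw [resolventSymbol, norm_inv]
  exact inv_anti₀ hμ (re_le_norm_add ξ)

lemma norm_resolventSymbol_sub_le (hμ : 0 < μ.re) (ξ η : R3) :
    ‖resolventSymbol μ ξ - resolventSymbol μ η‖ ≤ 2 * Real.pi * μ.re⁻¹ ^ 2 * ‖ξ - η‖ := by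
  have h1 := add_ne_zero_of_re_pos hμ ξ
  have h2 := add_ne_zero_of_re_pos hμ η
  have e : resolventSymbol μ ξ - resolventSymbol μ η
      = ((2 * Real.pi * (‖η‖ - ‖ξ‖) : ℝ) : ℂ) * resolventSymbol μ ξ * resolventSymbol μ η := by
    unfold resolventSymbol
    rw [inv_sub_inv h1 h2, div_eq_mul_inv, mul_inv, ← mul_assoc]
    congr 2
    push_cast
    ring
  rw [e, norm_mul, norm_mul, Complex.norm_real, Real.norm_eq_abs, abs_mul,
    abs_of_pos (by positivity : (0:ℝ) < 2 * Real.pi), abs_sub_comm]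
  have h3 := norm_resolventSymbol_le hμ ξ
  have h4 := norm_resolventSymbol_le hμ η
  have h5 := abs_norm_sub_norm_le ξ η
  calc 2 * Real.pi * |‖ξ‖ - ‖η‖| * ‖resolventSymbol μ ξ‖ * ‖resolventSymbol μ η‖
      ≤ 2 * Real.pi * ‖ξ - η‖ * μ.re⁻¹ * μ.re⁻¹ := by gcongr
    _ = _ := by ring

/-- The factorization `-Δ - μ² = ((-Δ)^{1/2} + μ) ((-Δ)^{1/2} - μ)`. -/
lemma halfSymbol_eq_resolventSymbol_mul (hμ : 0 < μ.re) (ξ : R3) :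
    halfSymbol μ ξ = resolventSymbol μ ξ * helmholtzSymbol μ ξ := by
  have h1 := add_ne_zero_of_re_pos hμ ξ
  rw [resolventSymbol, eq_inv_mul_iff_mul_eq₀ h1, halfSymbol, helmholtzSymbol]
  ring

/-- The bound for `((-Δ)^{1/2} + μ)⁻¹` on `L^{2,1}` in terms of `Re μ`. -/
noncomputable def resolventBound (r : ℝ) : ℝ :=
  r⁻¹ + 3 * (2 * Real.pi * r⁻¹ + 2 * Real.pi * r⁻¹ ^ 2)

lemma eLpNorm_weight_mul_resolvent_le (hμ : 0 < μ.re) {h k f : R3 → ℂ} (hh : HasL2Fourier h k)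
    (hf : HasL2Fourier f (fun ξ => resolventSymbol μ ξ * k ξ)) :
    eLpNorm (fun x => weight x * f x) 2 volume
      ≤ ENNReal.ofReal (resolventBound μ.re) * eLpNorm (fun x => weight x * h x) 2 volume :=
  eLpNorm_weight_mul_multiplier_le (norm_resolventSymbol_le hμ) (norm_resolventSymbol_sub_le hμ)
    (continuous_resolventSymbol hμ) hh hf

lemma memLp_weight_mul_resolvent (hμ : 0 < μ.re) {h k f : R3 → ℂ} (hh : HasL2Fourier h k)
    (hf : HasL2Fourier f (fun ξ => resolventSymbol μ ξ * k ξ))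
    (hw : MemLp (fun x => weight x * h x) 2 volume) :
    MemLp (fun x => weight x * f x) 2 volume :=
  ⟨continuous_weight.aestronglyMeasurable.mul hf.memLp_left.1,
    (eLpNorm_weight_mul_resolvent_le hμ hh hf).trans_lt (ENNReal.mul_lt_top ENNReal.ofReal_lt_top
      hw.2)⟩

end Resolvent

lemma memLp_weight_mul_schwartz (φ : 𝓢(R3, ℂ)) :
    MemLp (fun x => weight x * φ x) 2 volume := by
  refine memLp_symbol_mul (C := 2) continuous_weight (fun x => ?_) φ
  rw [norm_weight]
  nlinarith [sq_nonneg (‖x‖ - 1), norm_nonneg x]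

/-- For a Schwartz function `φ`, `((-Δ)^{1/2} - μ) φ` lies in `L^{2,1}`. It suffices to take
`μ = 1`, where it equals `((-Δ)^{1/2} + 1)⁻¹ (-Δ - 1) φ`. -/
lemma memLp_weight_mul_halfLaplacian_sub (μ : ℂ) (φ : 𝓢(R3, ℂ)) :
    MemLp (fun x => weight x * (halfLaplacian φ x - μ * φ x)) 2 volume := by
  open Laplacian in
  set ψ : 𝓢(R3, ℂ) := -(Δ φ : 𝓢(R3, ℂ)) - φ with hψ
  have hψ' : (ψ : R3 → ℂ) = 𝓕⁻ (fun ξ => helmholtzSymbol 1 ξ * 𝓕 (φ : R3 → ℂ) ξ) := by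
    ext x
    rw [← neg_laplacian_sub_eq]
    simp [hψ]
  have h1 : HasL2Fourier ψ (fun ξ => helmholtzSymbol 1 ξ * 𝓕 (φ : R3 → ℂ) ξ) := by
    rw [hψ']
    exact HasL2Fourier.of_integrable_right
      (memLp_symbol_mul (continuous_helmholtzSymbol 1) (norm_helmholtzSymbol_le 1) (𝓕 φ))
      (integrable_symbol_mul (continuous_helmholtzSymbol 1) (norm_helmholtzSymbol_le 1) (𝓕 φ))
  have h2 : HasL2Fourier (fun x => halfLaplacian φ x - 1 * φ x)
      (fun ξ => resolventSymbol 1 ξ * (helmholtzSymbol 1 ξ * 𝓕 (φ : R3 → ℂ) ξ)) := by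
    simp only [← mul_assoc, ← halfSymbol_eq_resolventSymbol_mul (μ := 1) (by simp)]
    simp only [halfLaplacian_sub_eq]
    exact HasL2Fourier.of_integrable_right
      (memLp_symbol_mul (continuous_halfSymbol 1) (norm_halfSymbol_le 1) (𝓕 φ))
      (integrable_symbol_mul (continuous_halfSymbol 1) (norm_halfSymbol_le 1) (𝓕 φ))
  have h3 := memLp_weight_mul_resolvent (by simp) h1 h2 (memLp_weight_mul_schwartz ψ)
  have h4 := h3.add ((memLp_weight_mul_schwartz φ).const_mul (1 - μ))
  refine (memLp_congr_ae (ae_of_all _ fun x => ?_)).1 h4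
  simp only [Pi.add_apply]
  ring

/-! ### Duality between weighted spaces -/

/-- The pairing of `L^{2,-1}` and `L^{2,1}` is absolutely convergent. -/
lemma integrable_mul_conj_of_weight {u v : R3 → ℂ}
    (hu : MemLp (fun x => (weight x)⁻¹ * u x) 2 volume)
    (hv : MemLp (fun x => weight x * v x) 2 volume) :
    Integrable (fun x => u x * (starRingEnd ℂ) (v x)) := by
  have h := MemLp.integrable_mul hu (show MemLp (fun x => (starRingEnd ℂ) (weight x * v x)) 2 volume
    from hv.star)
  refine h.congr (ae_of_all _ fun x => ?_)
  have := weight_ne_zero x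
  simp only [Pi.mul_apply, map_mul, weight, Complex.conj_ofReal] at this ⊢
  field_simp

lemma integrable_mul_of_weight {u v : R3 → ℂ}
    (hu : MemLp (fun x => (weight x)⁻¹ * u x) 2 volume)
    (hv : MemLp (fun x => weight x * v x) 2 volume) :
    Integrable (fun x => u x * v x) := by
  refine (MemLp.integrable_mul hu hv).congr (ae_of_all _ fun x => ?_)
  have := weight_ne_zero x
  simp only [Pi.mul_apply]
  field_simp

lemma tendsto_integral_mul_conj {a b : ℕ → R3 → ℂ} {a₀ b₀ : R3 → ℂ}
    (ha : ∀ n, MemLp (a n) 2 volume) (hb : ∀ n, MemLp (b n) 2 volume)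
    (ha₀ : MemLp a₀ 2 volume) (hb₀ : MemLp b₀ 2 volume)
    (hta : Filter.Tendsto (fun n => eLpNorm (a n - a₀) 2 volume) Filter.atTop (nhds 0))
    (htb : Filter.Tendsto (fun n => eLpNorm (b n - b₀) 2 volume) Filter.atTop (nhds 0)) :
    Filter.Tendsto (fun n => ∫ x, a n x * (starRingEnd ℂ) (b n x)) Filter.atTop
      (nhds (∫ x, a₀ x * (starRingEnd ℂ) (b₀ x))) := by
  have h1 := (Lp.tendsto_Lp_iff_tendsto_eLpNorm'' a ha a₀ ha₀).2 hta
  have h2 := (Lp.tendsto_Lp_iff_tendsto_eLpNorm'' b hb b₀ hb₀).2 htb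
  have h3 := h2.inner (𝕜 := ℂ) h1
  rw [inner_toLp] at h3
  exact h3.congr fun n => inner_toLp _ _

/-- The pairing `∫ u conj v` is jointly continuous on `L^{2,-1} × L^{2,1}`. -/
lemma tendsto_integral_mul_conj_of_weight {u v : ℕ → R3 → ℂ} {u₀ v₀ : R3 → ℂ}
    (hu : ∀ n, MemLp (fun x => (weight x)⁻¹ * u n x) 2 volume)
    (hv : ∀ n, MemLp (fun x => weight x * v n x) 2 volume)
    (hu₀ : MemLp (fun x => (weight x)⁻¹ * u₀ x) 2 volume)
    (hv₀ : MemLp (fun x => weight x * v₀ x) 2 volume)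
    (htu : Filter.Tendsto (fun n => eLpNorm (fun x => (weight x)⁻¹ * (u n x - u₀ x)) 2 volume)
      Filter.atTop (nhds 0))
    (htv : Filter.Tendsto (fun n => eLpNorm (fun x => weight x * (v n x - v₀ x)) 2 volume)
      Filter.atTop (nhds 0)) :
    Filter.Tendsto (fun n => ∫ x, u n x * (starRingEnd ℂ) (v n x)) Filter.atTop
      (nhds (∫ x, u₀ x * (starRingEnd ℂ) (v₀ x))) := by
  have key : ∀ p q : R3 → ℂ, (fun x => ((weight x)⁻¹ * p x) * (starRingEnd ℂ) (weight x * q x))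
      = fun x => p x * (starRingEnd ℂ) (q x) := by
    intro p q
    ext x
    have := weight_ne_zero x
    simp only [map_mul, weight, Complex.conj_ofReal] at this ⊢
    field_simp
  have := tendsto_integral_mul_conj hu hv hu₀ hv₀
    (htu.congr fun n => by congr 1; ext x; simp only [Pi.sub_apply]; ring)
    (htv.congr fun n => by congr 1; ext x; simp only [Pi.sub_apply]; ring)
  simpa only [key] using this

lemma MemWeightedL2.memLp_weight_mul {s : ℝ} (hs : 1 ≤ s) {f : R3 → ℂ} (hf : MemWeightedL2 s f) :
    MemLp (fun x => weight x * f x) 2 volume := by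
  have hpos : ∀ x : R3, 0 < (1 + ‖x‖ ^ 2) ^ (s / 2) := fun x => by positivity
  have hc : Continuous fun x : R3 => (((1 + ‖x‖ ^ 2) ^ (s / 2) : ℝ) : ℂ) := by
    refine Complex.continuous_ofReal.comp (Continuous.rpow_const (by fun_prop) fun x => Or.inl ?_)
    positivity
  have hne : ∀ x : R3, (((1 + ‖x‖ ^ 2) ^ (s / 2) : ℝ) : ℂ) ≠ 0 := fun x =>
    Complex.ofReal_ne_zero.2 (hpos x).ne'
  have hm : AEStronglyMeasurable f volume := by
    refine ((hc.inv₀ hne).aestronglyMeasurable (μ := volume) |>.mul hf.1).congr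
      (ae_of_all _ fun x => ?_)
    simp [inv_mul_cancel_left₀ (hne x)]
  refine (hf.const_mul 2).of_le (continuous_weight.aestronglyMeasurable.mul hm)
    (ae_of_all _ fun x => ?_)
  rw [norm_mul, norm_mul, norm_mul, norm_weight, Complex.norm_real, Real.norm_of_nonneg (hpos x).le,
    ← mul_assoc]
  gcongr
  have h1 : (1 + ‖x‖ ^ 2) ^ (1 / 2 : ℝ) ≤ (1 + ‖x‖ ^ 2) ^ (s / 2) :=
    Real.rpow_le_rpow_of_exponent_le (by nlinarith [sq_nonneg ‖x‖]) (by linarith)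
  rw [← Real.sqrt_eq_rpow] at h1
  have h2 : 1 ≤ √(1 + ‖x‖ ^ 2) := Real.one_le_sqrt.2 (by nlinarith [sq_nonneg ‖x‖])
  have h3 : ‖x‖ ≤ √(1 + ‖x‖ ^ 2) := Real.le_sqrt_of_sq_le (by linarith)
  simp only [Complex.norm_ofNat]
  linarith

/-! ### Homogeneous extensions of functions on the sphere -/

lemma angular_of_ne_zero (g : S2 → ℂ) {x : R3} (hx : x ≠ 0) (h : ‖x‖⁻¹ • x ∈ Metric.sphere 0 1) :
    angular g x = g ⟨‖x‖⁻¹ • x, h⟩ := by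
  rw [angular, dif_neg hx]

lemma angular_smul (g : S2 → ℂ) {c : ℝ} (hc : 0 < c) (x : R3) :
    angular g (c • x) = angular g x := by
  by_cases hx : x = 0
  · simp [hx]
  · have hcx : c • x ≠ 0 := smul_ne_zero hc.ne' hx
    rw [angular, angular, dif_neg hcx, dif_neg hx]
    congr 2
    rw [norm_smul, Real.norm_of_nonneg hc.le, smul_smul, mul_inv, mul_right_comm,
      inv_mul_cancel₀ hc.ne', one_mul]

/-- The homogeneous extension of a smooth function on the sphere is smooth off the origin. -/
lemma contDiffAt_angular {g : S2 → ℂ} (hg : ContMDiff (𝓡 2) 𝓘(ℝ, ℂ) ∞ g) {x : R3} (hx : x ≠ 0) :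
    ContDiffAt ℝ ∞ (angular g) x := by
  let U : TopologicalSpace.Opens R3 := ⟨{0}ᶜ, isOpen_compl_singleton⟩
  have hU : ∀ y : U, (y : R3) ≠ 0 := fun y => y.2
  have hsm : ContMDiff 𝓘(ℝ, R3) 𝓘(ℝ, R3) ∞ (fun y : U => ‖(y : R3)‖⁻¹ • (y : R3)) := by
    intro y
    refine (contMDiffAt_subtype_iff (f := fun z : R3 => ‖z‖⁻¹ • z)).2 ?_
    refine ContDiffAt.contMDiffAt ?_
    exact ((contDiffAt_norm ℝ (hU y)).inv (norm_ne_zero_iff.2 (hU y))).smul contDiffAt_id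
  have hmem : ∀ y : U, ‖(y : R3)‖⁻¹ • (y : R3) ∈ Metric.sphere (0 : R3) 1 := fun y => by
    rw [mem_sphere_zero_iff_norm, norm_smul, norm_inv, norm_norm,
      inv_mul_cancel₀ (norm_ne_zero_iff.mpr (hU y))]
  have h := hg.comp (hsm.codRestrict_sphere hmem)
  have h2 := (contMDiffAt_subtype_iff (U := U) (f := angular g) (x := ⟨x, hx⟩)
    (I := 𝓘(ℝ, R3)) (I' := 𝓘(ℝ, ℂ)) (n := ∞)).1 ?_
  · exact h2.contDiffAt
  · convert h ⟨x, hx⟩ using 1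
    ext y
    rw [angular_of_ne_zero g (hU y) (hmem y)]
    rfl

/-- `F` is positively homogeneous of degree `-n`. -/
def HomogeneousNeg (n : ℕ) (F : R3 → ℂ) : Prop :=
  ∀ c : ℝ, 0 < c → ∀ x, F (c • x) = ((c⁻¹ : ℝ) : ℂ) ^ n * F x

lemma HomogeneousNeg.fderiv {n : ℕ} {F : R3 → ℂ} (hF : HomogeneousNeg n F) (v : R3) :
    HomogeneousNeg (n + 1) (fun x => fderiv ℝ F x v) := by
  intro c hc x
  have h1 : (fun y => F (c • y)) = (c⁻¹ ^ n : ℝ) • F := by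
    ext y; rw [hF c hc y, Pi.smul_apply, Complex.real_smul, Complex.ofReal_pow]
  have hcn : (c⁻¹ ^ n : ℝ) ≠ 0 := by positivity
  have := invertibleOfNonzero hcn
  have h2 := congrArg (fun f => _root_.fderiv ℝ f x v) h1
  simp only [fderiv_comp_smul, fderiv_const_smul_of_invertible, smul_apply, Complex.real_smul] at h2
  have hc' : (c : ℂ) ≠ 0 := Complex.ofReal_ne_zero.2 hc.ne'
  rw [pow_succ, mul_right_comm, ← Complex.ofReal_pow, ← h2]
  push_cast
  field_simp

lemma HomogeneousNeg.exists_bound {n : ℕ} {F : R3 → ℂ} (hF : HomogeneousNeg n F)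
    (hc : ContinuousOn F {0}ᶜ) : ∃ C, 0 ≤ C ∧ ∀ x, x ≠ 0 → ‖F x‖ ≤ C * ‖x‖⁻¹ ^ n := by
  have hs : Metric.sphere (0 : R3) 1 ⊆ {0}ᶜ := fun y hy h0 => by
    simp only [Set.mem_singleton_iff] at h0
    simp [h0] at hy
  obtain ⟨C, hC⟩ := (isCompact_sphere (0 : R3) 1).exists_bound_of_continuousOn (hc.mono hs)
  refine ⟨|C|, abs_nonneg C, fun x hx => ?_⟩
  have hx' : 0 < ‖x‖ := norm_pos_iff.2 hx
  have h1 := hF ‖x‖ hx' (‖x‖⁻¹ • x)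
  rw [smul_smul, mul_inv_cancel₀ hx'.ne', one_smul] at h1
  have h2 : ‖F (‖x‖⁻¹ • x)‖ ≤ C := hC _ (by
    rw [mem_sphere_zero_iff_norm, norm_smul, norm_inv, norm_norm, inv_mul_cancel₀ hx'.ne'])
  rw [h1, norm_mul, norm_pow, Complex.norm_real, Real.norm_of_nonneg (by positivity), mul_comm]
  gcongr
  exact h2.trans (le_abs_self C)

/-- The `j`-th standard basis vector. -/
noncomputable abbrev basisVec (j : Fin 3) : R3 := EuclideanSpace.single j 1

lemma sum_smul_basisVec (x : R3) : ∑ j, x j • basisVec j = x := by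
  ext i
  simp [basisVec, Finset.sum_apply, Pi.single_apply]

/-- The first partial derivatives of `angular g` (meaningful away from the origin only). -/
noncomputable def angularD (g : S2 → ℂ) (j : Fin 3) (x : R3) : ℂ :=
  fderiv ℝ (angular g) x (basisVec j)

/-- The pure second partial derivatives of `angular g`; the mixed ones are not needed for the
Laplacian. -/
noncomputable def angularDD (g : S2 → ℂ) (j : Fin 3) (x : R3) : ℂ :=
  fderiv ℝ (angularD g j) x (basisVec j)

section Angular

variable {g : S2 → ℂ}

lemma homogeneousNeg_angular (g : S2 → ℂ) : HomogeneousNeg 0 (angular g) := fun c hc x => by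
  rw [angular_smul g hc, pow_zero, one_mul]

lemma homogeneousNeg_angularD (g : S2 → ℂ) (j : Fin 3) : HomogeneousNeg 1 (angularD g j) :=
  (homogeneousNeg_angular g).fderiv _

lemma homogeneousNeg_angularDD (g : S2 → ℂ) (j : Fin 3) : HomogeneousNeg 2 (angularDD g j) :=
  (homogeneousNeg_angularD g j).fderiv _

lemma contDiffAt_angularD (hg : ContMDiff (𝓡 2) 𝓘(ℝ, ℂ) ∞ g) (j : Fin 3) {x : R3} (hx : x ≠ 0) :
    ContDiffAt ℝ ∞ (angularD g j) x :=
  ((contDiffAt_angular hg hx).fderiv_right (m := ∞) le_rfl).clm_apply contDiffAt_const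

lemma contDiffAt_angularDD (hg : ContMDiff (𝓡 2) 𝓘(ℝ, ℂ) ∞ g) (j : Fin 3) {x : R3} (hx : x ≠ 0) :
    ContDiffAt ℝ ∞ (angularDD g j) x :=
  ((contDiffAt_angularD hg j hx).fderiv_right (m := ∞) le_rfl).clm_apply contDiffAt_const

/-- Euler's relation: the radial derivative of `angular g` vanishes. -/
lemma sum_mul_angularD (hg : ContMDiff (𝓡 2) 𝓘(ℝ, ℂ) ∞ g) {x : R3} (hx : x ≠ 0) :
    ∑ j, (x j : ℂ) * angularD g j x = 0 := by
  have h1 : ∑ j, (x j : ℂ) * angularD g j x = fderiv ℝ (angular g) x x := by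
    conv_rhs => rw [← sum_smul_basisVec x, map_sum, sum_smul_basisVec x]
    simp only [angularD, map_smul, Complex.real_smul]
  have h2 : HasDerivAt (fun t : ℝ => angular g (x + t • x)) (fderiv ℝ (angular g) x x) 0 := by
    have := ((contDiffAt_angular hg hx).differentiableAt (by simp)).hasFDerivAt.hasLineDerivAt x
    exact this
  have h3 : (fun t : ℝ => angular g (x + t • x)) =ᶠ[nhds 0] fun _ => angular g x := by
    filter_upwards [lt_mem_nhds (show (-1 : ℝ) < 0 by norm_num)] with t ht
    rw [← angular_smul g (by linarith : 0 < 1 + t) x, add_smul, one_smul]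
  rw [h1]
  exact h2.unique ((hasDerivAt_const (0:ℝ) (angular g x)).congr_of_eventuallyEq h3)

end Angular

/-! ### The weak Laplacian of a radial profile times an angular function -/

lemma hasDerivAt_norm_line {x : R3} (hx : x ≠ 0) (j : Fin 3) :
    HasDerivAt (fun t : ℝ => ‖x + t • basisVec j‖) (x j / ‖x‖) 0 := by
  have h1 : HasDerivAt (fun t : ℝ => x + t • basisVec j) (basisVec j) 0 := by
    simpa using ((hasDerivAt_id (0:ℝ)).smul_const (basisVec j)).const_add x
  have hx' : ‖x‖ ≠ 0 := norm_ne_zero_iff.2 hx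
  have h2 := h1.norm_sq.sqrt (by simpa using hx)
  simp only [zero_smul, add_zero, Real.sqrt_sq (norm_nonneg _)] at h2
  refine h2.congr_deriv ?_
  rw [EuclideanSpace.inner_single_right]
  simp
  field_simp

lemma hasDerivAt_coord_line (x : R3) (j : Fin 3) :
    HasDerivAt (fun t : ℝ => (((x + t • basisVec j) j : ℝ) : ℂ)) 1 0 := by
  have h1 : HasDerivAt (fun t : ℝ => x j + t) 1 0 := by
    simpa using (hasDerivAt_id (0:ℝ)).const_add (x j)
  have h2 := h1.ofReal_comp
  simpa [basisVec] using h2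

lemma hasLineDerivAt_zero_of_eq_zero {F : R3 → ℂ} (hF : ∀ y, ‖y‖ ≤ 1 → F y = 0) {x : R3}
    (hx : ‖x‖ < 1) (v : R3) : HasLineDerivAt ℝ F 0 x v := by
  have h : (fun t : ℝ => F (x + t • v)) =ᶠ[nhds 0] fun _ => 0 := by
    have hc : ContinuousAt (fun t : ℝ => ‖x + t • v‖) 0 := by fun_prop
    filter_upwards [hc.eventually (gt_mem_nhds (show ‖x + (0:ℝ) • v‖ < 1 by simpa using hx))]
      with t ht using hF _ ht.le
  exact (hasDerivAt_const (0:ℝ) (0:ℂ)).congr_of_eventuallyEq h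

lemma norm_coord_div_norm_le (x : R3) (j : Fin 3) : ‖((x j : ℂ) / (‖x‖ : ℂ))‖ ≤ 1 := by
  rw [norm_div, Complex.norm_real, Complex.norm_real, norm_norm]
  exact div_le_one_of_le₀ (PiLp.norm_apply_le x j) (norm_nonneg _)

/-- A radial profile `p`, vanishing on `(-∞, 1]`, together with its first two derivatives `p'` and
`p''` on `(0, ∞)`, all bounded by `M`. Vanishing near `0` removes the singularity of the angular
factor at the origin. -/
structure RadialProfile (p p' p'' : ℝ → ℂ) (M : ℝ) : Prop where
  hasDerivAt : ∀ r, 0 < r → HasDerivAt p (p' r) r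
  hasDerivAt' : ∀ r, 0 < r → HasDerivAt p' (p'' r) r
  eq_zero : ∀ r, r ≤ 1 → p r = 0
  eq_zero' : ∀ r, r ≤ 1 → p' r = 0
  eq_zero'' : ∀ r, r ≤ 1 → p'' r = 0
  norm_le : ∀ r, ‖p r‖ ≤ M
  norm_le' : ∀ r, ‖p' r‖ ≤ M
  norm_le'' : ∀ r, ‖p'' r‖ ≤ M
  measurable : Measurable p
  measurable' : Measurable p'
  measurable'' : Measurable p''

/-- The product `p(|x|) g(x/|x|)`. -/
noncomputable def radialMul (p : ℝ → ℂ) (g : S2 → ℂ) (x : R3) : ℂ := p ‖x‖ * angular g x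

/-- The partial derivatives of `radialMul p g`, where `p'` is the derivative of `p`. -/
noncomputable def radialMulD (p p' : ℝ → ℂ) (g : S2 → ℂ) (j : Fin 3) (x : R3) : ℂ :=
  p' ‖x‖ * ((x j : ℂ) / (‖x‖ : ℂ)) * angular g x + p ‖x‖ * angularD g j x

/-- The pure second partial derivatives of `radialMul p g`. -/
noncomputable def radialMulDD (p p' p'' : ℝ → ℂ) (g : S2 → ℂ) (j : Fin 3) (x : R3) : ℂ :=
  (p'' ‖x‖ * ((x j : ℂ) / (‖x‖ : ℂ)) ^ 2
      + p' ‖x‖ * (((‖x‖ : ℂ))⁻¹ * (1 - ((x j : ℂ) / (‖x‖ : ℂ)) ^ 2))) * angular g x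
    + 2 * (p' ‖x‖ * ((x j : ℂ) / (‖x‖ : ℂ)) * angularD g j x) + p ‖x‖ * angularDD g j x

/-- The Laplacian of `angular g`. -/
noncomputable def angularLaplacian (g : S2 → ℂ) (x : R3) : ℂ := ∑ j, angularDD g j x

variable {p p' p'' : ℝ → ℂ} {M : ℝ} {g : S2 → ℂ}

lemma hasLineDerivAt_angular (hg : ContMDiff (𝓡 2) 𝓘(ℝ, ℂ) ∞ g) (j : Fin 3) {x : R3}
    (hx : x ≠ 0) :
    HasDerivAt (fun t : ℝ => angular g (x + t • basisVec j)) (angularD g j x) 0 :=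
  ((contDiffAt_angular hg hx).differentiableAt (by simp)).hasFDerivAt.hasLineDerivAt _

lemma hasLineDerivAt_angularD (hg : ContMDiff (𝓡 2) 𝓘(ℝ, ℂ) ∞ g) (j : Fin 3) {x : R3}
    (hx : x ≠ 0) :
    HasDerivAt (fun t : ℝ => angularD g j (x + t • basisVec j)) (angularDD g j x) 0 :=
  ((contDiffAt_angularD hg j hx).differentiableAt (by simp)).hasFDerivAt.hasLineDerivAt _

lemma RadialProfile.hasLineDerivAt (hp : RadialProfile p p' p'' M)
    (hg : ContMDiff (𝓡 2) 𝓘(ℝ, ℂ) ∞ g) (j : Fin 3) (x : R3) :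
    HasLineDerivAt ℝ (radialMul p g) (radialMulD p p' g j x) x (basisVec j) := by
  rcases lt_or_ge ‖x‖ 1 with hx | hx
  · have e : radialMulD p p' g j x = 0 := by
      simp [radialMulD, hp.eq_zero _ hx.le, hp.eq_zero' _ hx.le]
    rw [e]
    exact hasLineDerivAt_zero_of_eq_zero (fun y hy => by simp [radialMul, hp.eq_zero _ hy]) hx _
  · have hx0 : x ≠ 0 := by rintro rfl; simp at hx; linarith
    have h1 : HasDerivAt (fun t : ℝ => p ‖x + t • basisVec j‖)
        (p' ‖x‖ * ((x j : ℂ) / (‖x‖ : ℂ))) 0 := by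
      have h := (hasDerivAt_norm_line hx0 j)
      have hp1 : HasDerivAt p (p' ‖x‖) ‖x + (0:ℝ) • basisVec j‖ := by
        simpa using hp.hasDerivAt ‖x‖ (norm_pos_iff.2 hx0)
      refine (hp1.scomp (0:ℝ) h).congr_deriv ?_
      rw [Complex.real_smul, Complex.ofReal_div, mul_comm]
    have h2 := h1.mul (hasLineDerivAt_angular hg j hx0)
    simp only [zero_smul, add_zero] at h2
    exact h2

lemma RadialProfile.hasLineDerivAt' (hp : RadialProfile p p' p'' M)
    (hg : ContMDiff (𝓡 2) 𝓘(ℝ, ℂ) ∞ g) (j : Fin 3) (x : R3) :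
    HasLineDerivAt ℝ (radialMulD p p' g j) (radialMulDD p p' p'' g j x) x (basisVec j) := by
  rcases lt_or_ge ‖x‖ 1 with hx | hx
  · have e : radialMulDD p p' p'' g j x = 0 := by
      simp [radialMulDD, hp.eq_zero _ hx.le, hp.eq_zero' _ hx.le, hp.eq_zero'' _ hx.le]
    rw [e]
    exact hasLineDerivAt_zero_of_eq_zero
      (fun y hy => by simp [radialMulD, hp.eq_zero _ hy, hp.eq_zero' _ hy]) hx _
  · have hx0 : x ≠ 0 := by rintro rfl; simp at hx; linarith
    have hxc : (‖x‖ : ℂ) ≠ 0 := Complex.ofReal_ne_zero.2 (norm_ne_zero_iff.2 hx0)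
    have h := hasDerivAt_norm_line hx0 j
    have hcomp : ∀ q q' : ℝ → ℂ, HasDerivAt q (q' ‖x‖) ‖x‖ →
        HasDerivAt (fun t : ℝ => q ‖x + t • basisVec j‖) (q' ‖x‖ * ((x j : ℂ) / (‖x‖ : ℂ))) 0 := by
      intro q q' hq
      have hq1 : HasDerivAt q (q' ‖x‖) ‖x + (0:ℝ) • basisVec j‖ := by simpa using hq
      refine (hq1.scomp (0:ℝ) h).congr_deriv ?_
      rw [Complex.real_smul, Complex.ofReal_div, mul_comm]
    have h0 := hcomp p p' (hp.hasDerivAt ‖x‖ (norm_pos_iff.2 hx0))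
    have h1 := hcomp p' p'' (hp.hasDerivAt' ‖x‖ (norm_pos_iff.2 hx0))
    have h3 : HasDerivAt (fun t : ℝ => (((x + t • basisVec j) j : ℝ) : ℂ) /
        ((‖x + t • basisVec j‖ : ℝ) : ℂ))
        (((‖x‖ : ℂ))⁻¹ * (1 - ((x j : ℂ) / (‖x‖ : ℂ)) ^ 2)) 0 := by
      have := (hasDerivAt_coord_line x j).div h.ofReal_comp (by simpa using hx0)
      simp only [zero_smul, add_zero] at this
      refine this.congr_deriv ?_
      push_cast
      field_simp
    have h4 := ((h1.mul h3).mul (hasLineDerivAt_angular hg j hx0)).add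
      (h0.mul (hasLineDerivAt_angularD hg j hx0))
    simp only [zero_smul, add_zero] at h4
    refine HasDerivAt.congr_deriv h4 ?_
    rw [radialMulDD]
    simp only [Pi.mul_apply, zero_smul, add_zero]
    ring

lemma measurable_angular (hg : ContMDiff (𝓡 2) 𝓘(ℝ, ℂ) ∞ g) : Measurable (angular g) :=
  measurable_of_continuousOn_compl_singleton 0 fun _ hx =>
    (contDiffAt_angular hg hx).continuousAt.continuousWithinAt

lemma measurable_angularD (hg : ContMDiff (𝓡 2) 𝓘(ℝ, ℂ) ∞ g) (j : Fin 3) :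
    Measurable (angularD g j) :=
  measurable_of_continuousOn_compl_singleton 0 fun _ hx =>
    (contDiffAt_angularD hg j hx).continuousAt.continuousWithinAt

lemma measurable_angularDD (hg : ContMDiff (𝓡 2) 𝓘(ℝ, ℂ) ∞ g) (j : Fin 3) :
    Measurable (angularDD g j) :=
  measurable_of_continuousOn_compl_singleton 0 fun _ hx =>
    (contDiffAt_angularDD hg j hx).continuousAt.continuousWithinAt

lemma exists_angular_bound (hg : ContMDiff (𝓡 2) 𝓘(ℝ, ℂ) ∞ g) :
    ∃ C, 0 ≤ C ∧ ∀ x, x ≠ 0 → ‖angular g x‖ ≤ C ∧ (∀ j, ‖angularD g j x‖ ≤ C * ‖x‖⁻¹) ∧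
      ∀ j, ‖angularDD g j x‖ ≤ C * ‖x‖⁻¹ ^ 2 := by
  obtain ⟨C₀, h0, hC₀⟩ := (homogeneousNeg_angular g).exists_bound fun _ hx =>
    (contDiffAt_angular hg hx).continuousAt.continuousWithinAt
  choose C₁ h1 hC₁ using fun j => (homogeneousNeg_angularD g j).exists_bound fun _ hx =>
    (contDiffAt_angularD hg j hx).continuousAt.continuousWithinAt
  choose C₂ h2 hC₂ using fun j => (homogeneousNeg_angularDD g j).exists_bound fun _ hx =>
    (contDiffAt_angularDD hg j hx).continuousAt.continuousWithinAt
  have s1 : 0 ≤ ∑ j, C₁ j := Finset.sum_nonneg fun j _ => h1 j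
  have s2 : 0 ≤ ∑ j, C₂ j := Finset.sum_nonneg fun j _ => h2 j
  have l1 : ∀ j, C₁ j ≤ ∑ j, C₁ j := fun j =>
    Finset.single_le_sum (fun i _ => h1 i) (Finset.mem_univ j)
  have l2 : ∀ j, C₂ j ≤ ∑ j, C₂ j := fun j =>
    Finset.single_le_sum (fun i _ => h2 i) (Finset.mem_univ j)
  refine ⟨C₀ + ∑ j, C₁ j + ∑ j, C₂ j, by positivity, fun x hx => ⟨?_, fun j => ?_, fun j => ?_⟩⟩
  · have := hC₀ x hx
    rw [pow_zero, mul_one] at this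
    linarith
  · have := hC₁ j x hx
    rw [pow_one] at this
    refine this.trans ?_
    gcongr
    linarith [l1 j]
  · refine (hC₂ j x hx).trans ?_
    gcongr
    linarith [l2 j]

lemma integrable_bdd_mul_schwartz {F : R3 → ℂ} (hF : Measurable F) {C : ℝ}
    (hC : ∀ x, ‖F x‖ ≤ C) (φ : 𝓢(R3, ℂ)) : Integrable (fun x => F x * φ x) :=
  φ.integrable.bdd_mul hF.aestronglyMeasurable (ae_of_all _ hC)

lemma RadialProfile.exists_bound (hp : RadialProfile p p' p'' M)
    (hg : ContMDiff (𝓡 2) 𝓘(ℝ, ℂ) ∞ g) :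
    ∃ C, ∀ x, ‖radialMul p g x‖ ≤ C ∧ (∀ j, ‖radialMulD p p' g j x‖ ≤ C) ∧
      ∀ j, ‖radialMulDD p p' p'' g j x‖ ≤ C := by
  obtain ⟨C, hC0, hC⟩ := exists_angular_bound hg
  have hM : 0 ≤ M := (norm_nonneg _).trans (hp.norm_le 0)
  refine ⟨6 * (M * C), fun x => ?_⟩
  have hMC : 0 ≤ M * C := by positivity
  rcases le_or_gt ‖x‖ 1 with hx | hx
  · simp [radialMul, radialMulD, radialMulDD, hp.eq_zero _ hx, hp.eq_zero' _ hx,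
      hp.eq_zero'' _ hx, hMC]
  · have hx0 : x ≠ 0 := by rintro rfl; simp at hx; linarith
    have hinv : ‖x‖⁻¹ ≤ 1 := inv_le_one_of_one_le₀ hx.le
    have hinv2 : ‖x‖⁻¹ ^ 2 ≤ 1 := pow_le_one₀ (by positivity) hinv
    obtain ⟨c0, c1, c2⟩ := hC x hx0
    replace c1 : ∀ j, ‖angularD g j x‖ ≤ C :=
      fun j => (c1 j).trans (mul_le_of_le_one_right hC0 hinv)
    replace c2 : ∀ j, ‖angularDD g j x‖ ≤ C :=
      fun j => (c2 j).trans (mul_le_of_le_one_right hC0 hinv2)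
    have q := norm_coord_div_norm_le x
    have q2 : ∀ j, ‖((x j : ℂ) / (‖x‖ : ℂ)) ^ 2‖ ≤ 1 := fun j => by
      rw [norm_pow]; exact pow_le_one₀ (norm_nonneg _) (q j)
    have q3 : ∀ j, ‖((‖x‖ : ℂ))⁻¹ * (1 - ((x j : ℂ) / (‖x‖ : ℂ)) ^ 2)‖ ≤ 2 := fun j => by
      rw [norm_mul, norm_inv, Complex.norm_real, norm_norm]
      have : ‖1 - ((x j : ℂ) / (‖x‖ : ℂ)) ^ 2‖ ≤ 2 := by
        refine (norm_sub_le _ _).trans ?_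
        rw [norm_one]
        linarith [q2 j]
      nlinarith [norm_nonneg (1 - ((x j : ℂ) / (‖x‖ : ℂ)) ^ 2), inv_nonneg.2 (norm_nonneg x)]
    have m0 := hp.norm_le ‖x‖
    have m1 := hp.norm_le' ‖x‖
    have m2 := hp.norm_le'' ‖x‖
    have t0 : ‖radialMul p g x‖ ≤ M * C := by
      rw [radialMul, norm_mul]; gcongr
    have t1 : ∀ j, ‖p' ‖x‖ * ((x j : ℂ) / (‖x‖ : ℂ))‖ ≤ M := fun j => by
      rw [norm_mul]
      calc _ ≤ M * 1 := by gcongr; exact q j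
        _ = M := mul_one M
    have t2 : ∀ j, ‖p'' ‖x‖ * ((x j : ℂ) / (‖x‖ : ℂ)) ^ 2‖ ≤ M := fun j => by
      rw [norm_mul]
      calc _ ≤ M * 1 := by gcongr; exact q2 j
        _ = M := mul_one M
    have t3 : ∀ j, ‖p' ‖x‖ * (((‖x‖ : ℂ))⁻¹ * (1 - ((x j : ℂ) / (‖x‖ : ℂ)) ^ 2))‖ ≤ M * 2 :=
      fun j => by
        rw [norm_mul]
        gcongr
        exact q3 j
    refine ⟨by linarith, fun j => ?_, fun j => ?_⟩
    · rw [radialMulD]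
      refine (norm_add_le _ _).trans ?_
      rw [norm_mul, norm_mul (p ‖x‖)]
      have a1 := mul_le_mul (t1 j) c0 (norm_nonneg _) hM
      have a2 := mul_le_mul m0 (c1 j) (norm_nonneg _) hM
      linarith
    · rw [radialMulDD]
      refine (norm_add_le _ _).trans ?_
      have a1 : ‖(p'' ‖x‖ * ((x j : ℂ) / (‖x‖ : ℂ)) ^ 2
          + p' ‖x‖ * (((‖x‖ : ℂ))⁻¹ * (1 - ((x j : ℂ) / (‖x‖ : ℂ)) ^ 2))) * angular g x‖
          ≤ (M + M * 2) * C := by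
        rw [norm_mul]
        have := (norm_add_le (p'' ‖x‖ * ((x j : ℂ) / (‖x‖ : ℂ)) ^ 2)
          (p' ‖x‖ * (((‖x‖ : ℂ))⁻¹ * (1 - ((x j : ℂ) / (‖x‖ : ℂ)) ^ 2)))).trans
          (add_le_add (t2 j) (t3 j))
        gcongr
      have a2 : ‖2 * (p' ‖x‖ * ((x j : ℂ) / (‖x‖ : ℂ)) * angularD g j x)‖ ≤ 2 * (M * C) := by
        rw [norm_mul, norm_mul (p' ‖x‖ * _), Complex.norm_ofNat]
        have := mul_le_mul (t1 j) (c1 j) (norm_nonneg _) hM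
        linarith
      have a3 : ‖p ‖x‖ * angularDD g j x‖ ≤ M * C := by
        rw [norm_mul]
        exact mul_le_mul m0 (c2 j) (norm_nonneg _) hM
      have a4 := (norm_add_le ((p'' ‖x‖ * ((x j : ℂ) / (‖x‖ : ℂ)) ^ 2
          + p' ‖x‖ * (((‖x‖ : ℂ))⁻¹ * (1 - ((x j : ℂ) / (‖x‖ : ℂ)) ^ 2))) * angular g x)
          (2 * (p' ‖x‖ * ((x j : ℂ) / (‖x‖ : ℂ)) * angularD g j x))).trans (add_le_add a1 a2)
      linarith

lemma sum_coord_div_norm_sq {x : R3} (hx : x ≠ 0) :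
    ∑ j, ((x j : ℂ) / (‖x‖ : ℂ)) ^ 2 = 1 := by
  have h : ∑ j, x j ^ 2 = ‖x‖ ^ 2 := (EuclideanSpace.real_norm_sq_eq x).symm
  have hx' : (‖x‖ : ℂ) ≠ 0 := Complex.ofReal_ne_zero.2 (norm_ne_zero_iff.2 hx)
  simp only [div_pow]
  rw [← Finset.sum_div, div_eq_one_iff_eq (pow_ne_zero _ hx')]
  exact_mod_cast h

/-- In polar coordinates the Laplacian of `p(|x|) g(x/|x|)` is
`(p'' + 2 p'/r) g + p Δ(g(x/|x|))`; the mixed term vanishes by Euler's relation. -/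
lemma sum_radialMulDD (hg : ContMDiff (𝓡 2) 𝓘(ℝ, ℂ) ∞ g) {x : R3} (hx : x ≠ 0) :
    ∑ j, radialMulDD p p' p'' g j x
      = (p'' ‖x‖ + 2 * p' ‖x‖ / (‖x‖ : ℂ)) * angular g x + p ‖x‖ * angularLaplacian g x := by
  have hx' : (‖x‖ : ℂ) ≠ 0 := Complex.ofReal_ne_zero.2 (norm_ne_zero_iff.2 hx)
  have h1 := sum_coord_div_norm_sq hx
  have h2 := sum_mul_angularD hg hx
  rw [angularLaplacian]
  simp only [Fin.sum_univ_three, radialMulDD] at h1 h2 ⊢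
  linear_combination (p'' ‖x‖ - p' ‖x‖ * ((‖x‖ : ℂ))⁻¹) * angular g x * h1
    + 2 * p' ‖x‖ * ((‖x‖ : ℂ))⁻¹ * h2

open LineDeriv Laplacian in
/-- The distributional Laplacian of `p(|x|) g(x/|x|)`. -/
lemma RadialProfile.integral_mul_laplacian (hp : RadialProfile p p' p'' M)
    (hg : ContMDiff (𝓡 2) 𝓘(ℝ, ℂ) ∞ g) (φ : 𝓢(R3, ℂ)) :
    ∫ x, radialMul p g x * (Δ φ : 𝓢(R3, ℂ)) x
      = ∫ x, ((p'' ‖x‖ + 2 * p' ‖x‖ / (‖x‖ : ℂ)) * angular g x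
          + p ‖x‖ * angularLaplacian g x) * φ x := by
  obtain ⟨C, hC⟩ := hp.exists_bound hg
  have mG := measurable_angular hg
  have mG1 := measurable_angularD hg
  have mG2 := measurable_angularDD hg
  have mp := hp.measurable.comp (measurable_norm (α := R3))
  have mp1 := hp.measurable'.comp (measurable_norm (α := R3))
  have mp2 := hp.measurable''.comp (measurable_norm (α := R3))
  have mx : ∀ j : Fin 3, Measurable fun x : R3 => (x j : ℂ) / (‖x‖ : ℂ) := fun j =>
    (Complex.measurable_ofReal.comp (by fun_prop)).div
      (Complex.measurable_ofReal.comp measurable_norm)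
  have m0 : Measurable (radialMul p g) := mp.mul mG
  have m1 : ∀ j, Measurable (radialMulD p p' g j) := fun j =>
    ((mp1.mul (mx j)).mul mG).add (mp.mul (mG1 j))
  have m2 : ∀ j, Measurable (radialMulDD p p' p'' g j) := fun j =>
    ((((mp2.mul ((mx j).pow_const 2)).add (mp1.mul
      ((Complex.measurable_ofReal.comp measurable_norm).inv.mul
        (((mx j).pow_const 2).const_sub 1)))).mul mG).add
      (((mp1.mul (mx j)).mul (mG1 j)).const_mul 2)).add (mp.mul (mG2 j))
  have i0 := integrable_bdd_mul_schwartz m0 (fun x => (hC x).1)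
  have i1 := fun j => integrable_bdd_mul_schwartz (m1 j) (fun x => (hC x).2.1 j)
  have i2 := fun j => integrable_bdd_mul_schwartz (m2 j) (fun x => (hC x).2.2 j)
  have hline : ∀ (ψ : 𝓢(R3, ℂ)) (v x : R3), HasLineDerivAt ℝ ψ ((∂_{v} ψ : 𝓢(R3, ℂ)) x) x v := by
    intro ψ v x
    rw [SchwartzMap.lineDerivOp_apply_eq_fderiv]
    exact (ψ.hasFDerivAt x).hasLineDerivAt v
  have hj : ∀ j, ∫ x, radialMul p g x * (∂_{basisVec j} (∂_{basisVec j} φ) : 𝓢(R3, ℂ)) x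
      = ∫ x, radialMulDD p p' p'' g j x * φ x := by
    intro j
    have e1 := integral_bilinear_hasLineDerivAt_right_eq_neg_left_of_integrable
      (μ := (volume : Measure R3)) (B := ContinuousLinearMap.mul ℝ ℂ) (v := basisVec j)
      (f := radialMul p g) (f' := radialMulD p p' g j) (g := (∂_{basisVec j} φ : 𝓢(R3, ℂ)))
      (g' := (∂_{basisVec j} (∂_{basisVec j} φ) : 𝓢(R3, ℂ)))
      (i1 j _) (i0 _) (i0 _) (fun x _ => hp.hasLineDerivAt hg j x) (fun x _ => hline _ _ x)
    have e2 := integral_bilinear_hasLineDerivAt_right_eq_neg_left_of_integrable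
      (μ := (volume : Measure R3)) (B := ContinuousLinearMap.mul ℝ ℂ) (v := basisVec j)
      (f := radialMulD p p' g j) (f' := radialMulDD p p' p'' g j) (g := φ)
      (g' := (∂_{basisVec j} φ : 𝓢(R3, ℂ)))
      (i2 j _) (i1 j _) (i1 j _) (fun x _ => hp.hasLineDerivAt' hg j x) (fun x _ => hline _ _ x)
    simp only [ContinuousLinearMap.mul_apply'] at e1 e2
    rw [e1, e2, neg_neg]
  have hlap : ∀ x, (Δ φ : 𝓢(R3, ℂ)) x
      = ∑ j, (∂_{basisVec j} (∂_{basisVec j} φ) : 𝓢(R3, ℂ)) x := by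
    intro x
    rw [SchwartzMap.laplacian_eq_sum (EuclideanSpace.basisFun (Fin 3) ℝ)]
    simp [basisVec]
  calc ∫ x, radialMul p g x * (Δ φ : 𝓢(R3, ℂ)) x
      = ∫ x, ∑ j, radialMul p g x * (∂_{basisVec j} (∂_{basisVec j} φ) : 𝓢(R3, ℂ)) x := by
        congr 1 with x
        rw [hlap, Finset.mul_sum]
    _ = ∑ j, ∫ x, radialMulDD p p' p'' g j x * φ x := by
        rw [integral_finsetSum _ fun j _ => i0 _]
        exact Finset.sum_congr rfl fun j _ => hj j
    _ = ∫ x, (∑ j, radialMulDD p p' p'' g j x) * φ x := by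
        rw [← integral_finsetSum _ fun j _ => i2 j φ]
        simp only [Finset.sum_mul]
    _ = _ := by
        refine integral_congr_ae ?_
        have h0 : ∀ᵐ x : R3, x ≠ 0 := by simp [ae_iff]
        filter_upwards [h0] with x hx
        rw [sum_radialMulDD hg hx]

/-! ### Regularized spherical waves -/

/-- A smooth cutoff, equal to `0` on `(-∞, 1]` and to `1` on `[2, ∞)`. -/
noncomputable def cutoff (r : ℝ) : ℝ := Real.smoothTransition (r - 1)

lemma contDiff_cutoff : ContDiff ℝ ∞ cutoff :=
  Real.smoothTransition.contDiff.comp (by fun_prop)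

lemma cutoff_of_le {r : ℝ} (h : r ≤ 1) : cutoff r = 0 :=
  Real.smoothTransition.zero_of_nonpos (by linarith)

lemma cutoff_of_ge {r : ℝ} (h : 2 ≤ r) : cutoff r = 1 :=
  Real.smoothTransition.one_of_one_le (by linarith)

lemma cutoff_nonneg (r : ℝ) : 0 ≤ cutoff r := Real.smoothTransition.nonneg _

lemma cutoff_le_one (r : ℝ) : cutoff r ≤ 1 := Real.smoothTransition.le_one _

/-- The first derivative of the cutoff. -/
noncomputable def cutoffD : ℝ → ℝ := deriv cutoff

/-- The second derivative of the cutoff. -/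
noncomputable def cutoffDD : ℝ → ℝ := deriv cutoffD

lemma contDiff_cutoffD : ContDiff ℝ ∞ cutoffD :=
  ((contDiff_succ_iff_deriv (n := ∞)).1 contDiff_cutoff).2.2

lemma contDiff_cutoffDD : ContDiff ℝ ∞ cutoffDD :=
  ((contDiff_succ_iff_deriv (n := ∞)).1 contDiff_cutoffD).2.2

lemma hasDerivAt_cutoff (r : ℝ) : HasDerivAt cutoff (cutoffD r) r :=
  (contDiff_cutoff.differentiable (by simp) r).hasDerivAt

lemma hasDerivAt_cutoffD (r : ℝ) :
    HasDerivAt cutoffD (cutoffDD r) r :=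
  (contDiff_cutoffD.differentiable (by simp) r).hasDerivAt

lemma deriv_eq_zero_of_const_outside {f : ℝ → ℝ} (hf : ContDiff ℝ ∞ f) {a b : ℝ}
    (h1 : ∀ r ≤ 1, f r = a) (h2 : ∀ r, 2 ≤ r → f r = b) {r : ℝ} (hr : r ≤ 1 ∨ 2 ≤ r) :
    deriv f r = 0 := by
  have hc : Continuous (deriv f) := ((contDiff_succ_iff_deriv (n := ∞)).1 hf).2.2.continuous
  have hcl : IsClosed {r | deriv f r = 0} := isClosed_eq hc continuous_const
  rcases hr with hr | hr
  · have hs : Set.Iio (1:ℝ) ⊆ {r | deriv f r = 0} := fun s hs => by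
      have : f =ᶠ[nhds s] fun _ => a := by
        filter_upwards [Iio_mem_nhds hs] with t ht using h1 t (le_of_lt ht)
      simp [this.deriv_eq]
    have := hcl.closure_subset_iff.2 hs
    rw [closure_Iio] at this
    exact this hr
  · have hs : Set.Ioi (2:ℝ) ⊆ {r | deriv f r = 0} := fun s hs => by
      have : f =ᶠ[nhds s] fun _ => b := by
        filter_upwards [Ioi_mem_nhds hs] with t ht using h2 t (le_of_lt ht)
      simp [this.deriv_eq]
    have := hcl.closure_subset_iff.2 hs
    rw [closure_Ioi] at this
    exact this hr

lemma cutoffD_eq_zero {r : ℝ} (hr : r ≤ 1 ∨ 2 ≤ r) : cutoffD r = 0 :=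
  deriv_eq_zero_of_const_outside contDiff_cutoff (fun _ h => cutoff_of_le h)
    (fun _ h => cutoff_of_ge h) hr

lemma cutoffDD_eq_zero {r : ℝ} (hr : r ≤ 1 ∨ 2 ≤ r) : cutoffDD r = 0 :=
  deriv_eq_zero_of_const_outside contDiff_cutoffD (fun _ h => cutoffD_eq_zero (.inl h))
    (fun _ h => cutoffD_eq_zero (.inr h)) hr

lemma exists_cutoff_deriv_bound :
    ∃ K, 0 ≤ K ∧ ∀ r, |cutoffD r| ≤ K ∧ |cutoffDD r| ≤ K := by
  obtain ⟨K₁, h1⟩ := (isCompact_Icc (a := (1:ℝ)) (b := 2)).exists_bound_of_continuousOn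
    contDiff_cutoffD.continuous.continuousOn
  obtain ⟨K₂, h2⟩ := (isCompact_Icc (a := (1:ℝ)) (b := 2)).exists_bound_of_continuousOn
    contDiff_cutoffDD.continuous.continuousOn
  refine ⟨|K₁| + |K₂|, by positivity, fun r => ?_⟩
  by_cases hr : r ∈ Set.Icc (1:ℝ) 2
  · have a1 := h1 r hr
    have a2 := h2 r hr
    rw [Real.norm_eq_abs] at a1 a2
    constructor <;> linarith [le_abs_self K₁, le_abs_self K₂, abs_nonneg K₁, abs_nonneg K₂]
  · have hr' : r ≤ 1 ∨ 2 ≤ r := by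
      by_contra hcon
      push Not at hcon
      exact hr ⟨hcon.1.le, hcon.2.le⟩
    rw [cutoffD_eq_zero hr', cutoffDD_eq_zero hr', abs_zero]
    constructor <;> positivity

/-- The oscillating factor `e^{iκr}`. -/
noncomputable def osc (κ : ℂ) (r : ℝ) : ℂ := Complex.exp (Complex.I * κ * (r : ℂ))

lemma norm_osc (κ : ℂ) (r : ℝ) : ‖osc κ r‖ = Real.exp (-(κ.im * r)) := by
  rw [osc, Complex.norm_exp]
  congr 1
  simp

lemma norm_osc_le_one {κ : ℂ} (hκ : 0 ≤ κ.im) {r : ℝ} (hr : 0 ≤ r) : ‖osc κ r‖ ≤ 1 := by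
  rw [norm_osc, Real.exp_le_one_iff]
  have := mul_nonneg hκ hr
  linarith

lemma hasDerivAt_osc (κ : ℂ) (r : ℝ) :
    HasDerivAt (osc κ) (Complex.I * κ * osc κ r) r := by
  have h1 : HasDerivAt (fun r : ℝ => Complex.I * κ * (r : ℂ)) (Complex.I * κ) r := by
    simpa using ((hasDerivAt_id r).ofReal_comp).const_mul (Complex.I * κ)
  refine h1.cexp.congr_deriv ?_
  rw [osc, mul_comm]

lemma measurable_osc (κ : ℂ) : Measurable (osc κ) := by
  unfold osc
  exact Continuous.measurable (by fun_prop)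

/-- `r` times the radial profile of the regularized spherical wave. -/
noncomputable def waveNum (κ : ℂ) (r : ℝ) : ℂ := (cutoff r : ℂ) * osc κ r

/-- The derivative of `waveNum κ`. -/
noncomputable def waveNumD (κ : ℂ) (r : ℝ) : ℂ :=
  ((cutoffD r : ℂ) + Complex.I * κ * (cutoff r : ℂ)) * osc κ r

/-- The second derivative of `waveNum κ`. -/
noncomputable def waveNumDD (κ : ℂ) (r : ℝ) : ℂ :=
  ((cutoffDD r : ℂ) + 2 * (Complex.I * κ) * (cutoffD r : ℂ)
    - κ ^ 2 * (cutoff r : ℂ)) * osc κ r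

lemma hasDerivAt_waveNum (κ : ℂ) (r : ℝ) : HasDerivAt (waveNum κ) (waveNumD κ r) r := by
  refine ((hasDerivAt_cutoff r).ofReal_comp.mul (hasDerivAt_osc κ r)).congr_deriv ?_
  rw [waveNumD]; ring

lemma hasDerivAt_waveNumD (κ : ℂ) (r : ℝ) : HasDerivAt (waveNumD κ) (waveNumDD κ r) r := by
  refine (((hasDerivAt_cutoffD r).ofReal_comp.add
    ((hasDerivAt_cutoff r).ofReal_comp.const_mul (Complex.I * κ))).mul
    (hasDerivAt_osc κ r)).congr_deriv ?_
  rw [waveNumDD]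
  simp only [Pi.add_apply]
  linear_combination (cutoff r : ℂ) * osc κ r * κ ^ 2 * Complex.I_sq

/-- The radial profile `b(r) e^{iκr} / r` of the regularized spherical wave, `b` being the
cutoff. -/
noncomputable def waveProfile (κ : ℂ) (r : ℝ) : ℂ := waveNum κ r * (r : ℂ)⁻¹

/-- The derivative of `waveProfile κ` on `(0, ∞)`. -/
noncomputable def waveProfileD (κ : ℂ) (r : ℝ) : ℂ :=
  waveNumD κ r * (r : ℂ)⁻¹ - waveNum κ r * (r : ℂ)⁻¹ ^ 2

/-- The second derivative of `waveProfile κ` on `(0, ∞)`. -/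
noncomputable def waveProfileDD (κ : ℂ) (r : ℝ) : ℂ :=
  waveNumDD κ r * (r : ℂ)⁻¹ - 2 * waveNumD κ r * (r : ℂ)⁻¹ ^ 2 + 2 * waveNum κ r * (r : ℂ)⁻¹ ^ 3

lemma hasDerivAt_inv_ofReal {r : ℝ} (hr : 0 < r) :
    HasDerivAt (fun s : ℝ => (s : ℂ)⁻¹) (-(r : ℂ)⁻¹ ^ 2) r := by
  have h := ((hasDerivAt_id r).ofReal_comp).inv (Complex.ofReal_ne_zero.2 hr.ne')
  refine h.congr_deriv ?_
  simp [neg_div]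

lemma exists_waveNum_bound (κ : ℂ) (hκ : 0 ≤ κ.im) : ∃ M, 0 ≤ M ∧ ∀ r, 0 ≤ r →
    ‖waveNum κ r‖ ≤ M ∧ ‖waveNumD κ r‖ ≤ M ∧ ‖waveNumDD κ r‖ ≤ M := by
  obtain ⟨K, hK0, hK⟩ := exists_cutoff_deriv_bound
  refine ⟨1 + (K + ‖κ‖) + (K + 2 * ‖κ‖ * K + ‖κ‖ ^ 2), by positivity, fun r hr => ?_⟩
  have ho := norm_osc_le_one hκ hr
  have hb : ‖(cutoff r : ℂ)‖ ≤ 1 := by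
    rw [Complex.norm_real, Real.norm_of_nonneg (cutoff_nonneg r)]; exact cutoff_le_one r
  have hb1 : ‖(cutoffD r : ℂ)‖ ≤ K := by rw [Complex.norm_real]; exact (hK r).1
  have hb2 : ‖(cutoffDD r : ℂ)‖ ≤ K := by rw [Complex.norm_real]; exact (hK r).2
  have hI : ‖Complex.I * κ‖ = ‖κ‖ := by simp
  have n0 : ‖waveNum κ r‖ ≤ 1 := by
    rw [waveNum, norm_mul]
    exact mul_le_one₀ hb (norm_nonneg _) ho
  have n1 : ‖waveNumD κ r‖ ≤ K + ‖κ‖ := by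
    rw [waveNumD, norm_mul]
    have : ‖(cutoffD r : ℂ) + Complex.I * κ * (cutoff r : ℂ)‖ ≤ K + ‖κ‖ := by
      refine (norm_add_le _ _).trans (add_le_add hb1 ?_)
      rw [norm_mul, hI]
      exact mul_le_of_le_one_right (norm_nonneg _) hb
    calc _ ≤ (K + ‖κ‖) * 1 := by gcongr
      _ = _ := mul_one _
  have n2 : ‖waveNumDD κ r‖ ≤ K + 2 * ‖κ‖ * K + ‖κ‖ ^ 2 := by
    rw [waveNumDD, norm_mul]
    have : ‖(cutoffDD r : ℂ) + 2 * (Complex.I * κ) * (cutoffD r : ℂ)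
        - κ ^ 2 * (cutoff r : ℂ)‖ ≤ K + 2 * ‖κ‖ * K + ‖κ‖ ^ 2 := by
      refine (norm_sub_le _ _).trans (add_le_add ((norm_add_le _ _).trans (add_le_add hb2 ?_)) ?_)
      · rw [norm_mul, norm_mul, hI, Complex.norm_ofNat]
        gcongr
      · rw [norm_mul, norm_pow]
        exact mul_le_of_le_one_right (by positivity) hb
    calc _ ≤ (K + 2 * ‖κ‖ * K + ‖κ‖ ^ 2) * 1 := by gcongr
      _ = _ := mul_one _
  have : 0 ≤ K + ‖κ‖ := by positivity
  have : 0 ≤ K + 2 * ‖κ‖ * K + ‖κ‖ ^ 2 := by positivity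
  refine ⟨by linarith, by linarith, by linarith⟩

lemma waveNum_eq_zero (κ : ℂ) {r : ℝ} (hr : r ≤ 1) :
    waveNum κ r = 0 ∧ waveNumD κ r = 0 ∧ waveNumDD κ r = 0 := by
  simp [waveNum, waveNumD, waveNumDD, cutoff_of_le hr, cutoffD_eq_zero (.inl hr),
    cutoffDD_eq_zero (.inl hr)]

lemma radialProfile_waveProfile (κ : ℂ) (hκ : 0 ≤ κ.im) :
    ∃ M, RadialProfile (waveProfile κ) (waveProfileD κ) (waveProfileDD κ) M := by
  obtain ⟨M, hM0, hM⟩ := exists_waveNum_bound κ hκ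
  have minv : Measurable fun r : ℝ => (r : ℂ)⁻¹ := Complex.measurable_ofReal.inv
  have mb : Measurable fun r : ℝ => (cutoff r : ℂ) :=
    Complex.measurable_ofReal.comp contDiff_cutoff.continuous.measurable
  have mb1 : Measurable fun r : ℝ => (cutoffD r : ℂ) :=
    Complex.measurable_ofReal.comp contDiff_cutoffD.continuous.measurable
  have mb2 : Measurable fun r : ℝ => (cutoffDD r : ℂ) :=
    Complex.measurable_ofReal.comp contDiff_cutoffDD.continuous.measurable
  have mo := measurable_osc κ
  have m0 : Measurable (waveNum κ) := mb.mul mo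
  have m1 : Measurable (waveNumD κ) := (mb1.add (mb.const_mul _)).mul mo
  have m2 : Measurable (waveNumDD κ) :=
    ((mb2.add (mb1.const_mul _)).sub (mb.const_mul _)).mul mo
  have hinv : ∀ r : ℝ, 1 < r → ‖(r : ℂ)⁻¹‖ ≤ 1 := fun r hr => by
    rw [norm_inv, Complex.norm_real, Real.norm_of_nonneg (by linarith)]
    exact inv_le_one_of_one_le₀ hr.le
  have hpow : ∀ r : ℝ, 1 < r → ∀ n, ‖(r : ℂ)⁻¹ ^ n‖ ≤ 1 := fun r hr n => by
    rw [norm_pow]; exact pow_le_one₀ (norm_nonneg _) (hinv r hr)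
  have hmul : ∀ r : ℝ, 1 < r → ∀ z : ℂ, ‖z‖ ≤ M → ∀ n, ‖z * (r : ℂ)⁻¹ ^ n‖ ≤ M := by
    intro r hr z hz n
    rw [norm_mul]
    calc _ ≤ M * 1 := by gcongr; exact hpow r hr n
      _ = M := mul_one M
  refine ⟨5 * M, ⟨fun r hr => ?_, fun r hr => ?_, fun r hr => ?_, fun r hr => ?_, fun r hr => ?_,
    fun r => ?_, fun r => ?_, fun r => ?_, m0.mul minv,
    (m1.mul minv).sub (m0.mul (minv.pow_const 2)),
    ((m2.mul minv).sub ((m1.const_mul 2).mul (minv.pow_const 2))).add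
      ((m0.const_mul 2).mul (minv.pow_const 3))⟩⟩
  · refine ((hasDerivAt_waveNum κ r).mul (hasDerivAt_inv_ofReal hr)).congr_deriv ?_
    rw [waveProfileD]; ring
  · refine (((hasDerivAt_waveNumD κ r).mul (hasDerivAt_inv_ofReal hr)).sub
      ((hasDerivAt_waveNum κ r).mul ((hasDerivAt_inv_ofReal hr).pow 2))).congr_deriv ?_
    rw [waveProfileDD]
    simp only [Pi.pow_apply]
    push_cast
    ring
  · simp [waveProfile, (waveNum_eq_zero κ hr).1]
  · simp [waveProfileD, (waveNum_eq_zero κ hr).1, (waveNum_eq_zero κ hr).2.1]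
  · simp [waveProfileDD, (waveNum_eq_zero κ hr).1, (waveNum_eq_zero κ hr).2.1,
      (waveNum_eq_zero κ hr).2.2]
  · rcases le_or_gt r 1 with hr | hr
    · simp [waveProfile, (waveNum_eq_zero κ hr).1, hM0]
    · obtain ⟨n0, n1, n2⟩ := hM r (by linarith)
      have := hmul r hr _ n0 1
      rw [pow_one] at this
      rw [waveProfile]; linarith
  · rcases le_or_gt r 1 with hr | hr
    · simp [waveProfileD, (waveNum_eq_zero κ hr).1, (waveNum_eq_zero κ hr).2.1, hM0]
    · obtain ⟨n0, n1, n2⟩ := hM r (by linarith)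
      have a1 := hmul r hr _ n1 1
      have a2 := hmul r hr _ n0 2
      rw [pow_one] at a1
      rw [waveProfileD]
      linarith [norm_sub_le (waveNumD κ r * (r : ℂ)⁻¹) (waveNum κ r * (r : ℂ)⁻¹ ^ 2)]
  · rcases le_or_gt r 1 with hr | hr
    · simp [waveProfileDD, (waveNum_eq_zero κ hr).1, (waveNum_eq_zero κ hr).2.1,
        (waveNum_eq_zero κ hr).2.2, hM0]
    · obtain ⟨n0, n1, n2⟩ := hM r (by linarith)
      have a1 := hmul r hr _ n2 1
      have a2 := hmul r hr _ n1 2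
      have a3 := hmul r hr _ n0 3
      rw [pow_one] at a1
      have b2 : ‖2 * waveNumD κ r * (r : ℂ)⁻¹ ^ 2‖ ≤ 2 * M := by
        rw [mul_assoc, norm_mul, Complex.norm_ofNat]; linarith
      have b3 : ‖2 * waveNum κ r * (r : ℂ)⁻¹ ^ 3‖ ≤ 2 * M := by
        rw [mul_assoc, norm_mul, Complex.norm_ofNat]; linarith
      rw [waveProfileDD]
      have c1 := norm_sub_le (waveNumDD κ r * (r : ℂ)⁻¹) (2 * waveNumD κ r * (r : ℂ)⁻¹ ^ 2)
      have c2 := norm_add_le (waveNumDD κ r * (r : ℂ)⁻¹ - 2 * waveNumD κ r * (r : ℂ)⁻¹ ^ 2)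
        (2 * waveNum κ r * (r : ℂ)⁻¹ ^ 3)
      linarith

/-- The spherical wave `e^{iκ|x|} |x|⁻¹ g(x/|x|)`, cut off near the origin. For `Im κ > 0` it
decays exponentially. -/
noncomputable def regWave (κ : ℂ) (g : S2 → ℂ) : R3 → ℂ := radialMul (waveProfile κ) g

/-- The function `(-Δ - κ²) (regWave κ g)`. The `κ²` terms cancel, as do those of first order in
`1 / r` outside the support of the derivative of the cutoff, because `e^{iκr} / r` solves the
Helmholtz equation. -/
noncomputable def regSource (κ : ℂ) (g : S2 → ℂ) (x : R3) : ℂ :=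
  -(osc κ ‖x‖ * (‖x‖ : ℂ)⁻¹ *
    (((cutoffDD ‖x‖ : ℂ) + 2 * (Complex.I * κ) * (cutoffD ‖x‖ : ℂ)) * angular g x
      + (cutoff ‖x‖ : ℂ) * angularLaplacian g x))

variable {g : S2 → ℂ}

lemma measurable_regWave (κ : ℂ) (hg : ContMDiff (𝓡 2) 𝓘(ℝ, ℂ) ∞ g) :
    Measurable (regWave κ g) := by
  have mb : Measurable fun r : ℝ => (cutoff r : ℂ) :=
    Complex.measurable_ofReal.comp contDiff_cutoff.continuous.measurable
  exact (((mb.mul (measurable_osc κ)).mul Complex.measurable_ofReal.inv).comp measurable_norm).mul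
    (measurable_angular hg)

lemma measurable_regSource (κ : ℂ) (hg : ContMDiff (𝓡 2) 𝓘(ℝ, ℂ) ∞ g) :
    Measurable (regSource κ g) := by
  have mb : Measurable fun r : ℝ => (cutoff r : ℂ) :=
    Complex.measurable_ofReal.comp contDiff_cutoff.continuous.measurable
  have mb1 : Measurable fun r : ℝ => (cutoffD r : ℂ) :=
    Complex.measurable_ofReal.comp contDiff_cutoffD.continuous.measurable
  have mb2 : Measurable fun r : ℝ => (cutoffDD r : ℂ) :=
    Complex.measurable_ofReal.comp contDiff_cutoffDD.continuous.measurable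
  have mr : Measurable fun x : R3 => ‖x‖ := measurable_norm
  have mL : Measurable (angularLaplacian g) :=
    Finset.measurable_sum _ fun j _ => measurable_angularDD hg j
  exact ((((measurable_osc κ).mul Complex.measurable_ofReal.inv).comp mr).mul
    ((((mb2.add (mb1.const_mul _)).comp mr).mul (measurable_angular hg)).add
      ((mb.comp mr).mul mL))).neg

/-- The source decays like `|x|⁻³`, uniformly for `κ` in bounded subsets of the closed upper half
plane. -/
lemma exists_regSource_bound (hg : ContMDiff (𝓡 2) 𝓘(ℝ, ℂ) ∞ g) :
    ∃ C, 0 ≤ C ∧ ∀ κ : ℂ, 0 ≤ κ.im → ∀ x,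
      ‖regSource κ g x‖ ≤ C * (1 + ‖κ‖) * ((1 + ‖x‖)⁻¹) ^ 3 := by
  obtain ⟨C, hC0, hC⟩ := exists_angular_bound hg
  obtain ⟨K, hK0, hK⟩ := exists_cutoff_deriv_bound
  refine ⟨C * (36 * K + 24), by positivity, fun κ hκ x => ?_⟩
  rcases le_or_gt ‖x‖ 1 with hx | hx
  · have : regSource κ g x = 0 := by
      simp [regSource, cutoff_of_le hx, cutoffD_eq_zero (.inl hx), cutoffDD_eq_zero (.inl hx)]
    rw [this, norm_zero]
    positivity
  · have hx0 : x ≠ 0 := by rintro rfl; simp at hx; linarith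
    obtain ⟨c0, -, c2⟩ := hC x hx0
    set r := ‖x‖ with hr
    set u := (1 + r)⁻¹ with hu
    have hu0 : 0 ≤ u := by positivity
    have hru : r⁻¹ ≤ 2 * u := by
      rw [hu, ← div_eq_mul_inv, inv_eq_one_div, div_le_div_iff₀ (by linarith) (by linarith)]
      linarith
    have hL : ‖angularLaplacian g x‖ ≤ 12 * C * u ^ 2 := by
      refine (norm_sum_le _ _).trans ?_
      calc ∑ j, ‖angularDD g j x‖ ≤ ∑ _j : Fin 3, C * (2 * u) ^ 2 := by
            refine Finset.sum_le_sum fun j _ => (c2 j).trans ?_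
            gcongr
        _ = _ := by simp; ring
    have hb : ‖(cutoff r : ℂ)‖ ≤ 1 := by
      rw [Complex.norm_real, Real.norm_of_nonneg (cutoff_nonneg r)]; exact cutoff_le_one r
    have hD : ‖(cutoffDD r : ℂ) + 2 * (Complex.I * κ) * (cutoffD r : ℂ)‖
        ≤ 9 * (K * (1 + 2 * ‖κ‖)) * u ^ 2 := by
      rcases lt_or_ge r 2 with h2 | h2
      · have h3 : 1 ≤ 3 * u := by
          rw [hu, ← div_eq_mul_inv, one_le_div (by linarith)]; linarith
        have h4 : 1 ≤ 9 * u ^ 2 := by nlinarith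
        have h5 : ‖(cutoffDD r : ℂ) + 2 * (Complex.I * κ) * (cutoffD r : ℂ)‖
            ≤ K * (1 + 2 * ‖κ‖) := by
          refine (norm_add_le _ _).trans ?_
          rw [norm_mul, norm_mul, norm_mul, Complex.norm_I, Complex.norm_real, Complex.norm_real,
            Complex.norm_ofNat, one_mul]
          have a1 := (hK r).1
          have a2 := (hK r).2
          rw [← Real.norm_eq_abs] at a1 a2
          have := mul_le_mul_of_nonneg_left a1 (by positivity : 0 ≤ 2 * ‖κ‖)
          linarith
        have : 0 ≤ K * (1 + 2 * ‖κ‖) := by positivity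
        nlinarith
      · rw [cutoffD_eq_zero (.inr h2), cutoffDD_eq_zero (.inr h2)]
        simp only [Complex.ofReal_zero, mul_zero, add_zero, norm_zero]
        positivity
    have hin : ‖((cutoffDD r : ℂ) + 2 * (Complex.I * κ) * (cutoffD r : ℂ)) * angular g x
        + (cutoff r : ℂ) * angularLaplacian g x‖
        ≤ 9 * (K * (1 + 2 * ‖κ‖)) * u ^ 2 * C + 1 * (12 * C * u ^ 2) := by
      refine (norm_add_le _ _).trans ?_
      rw [norm_mul, norm_mul]
      gcongr
    rw [regSource, norm_neg, norm_mul, norm_mul, norm_inv, Complex.norm_real,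
      Real.norm_of_nonneg (norm_nonneg x), ← hr]
    calc ‖osc κ r‖ * r⁻¹ * ‖((cutoffDD r : ℂ) + 2 * (Complex.I * κ) * (cutoffD r : ℂ)) *
          angular g x + (cutoff r : ℂ) * angularLaplacian g x‖
        ≤ 1 * (2 * u) * (9 * (K * (1 + 2 * ‖κ‖)) * u ^ 2 * C + 1 * (12 * C * u ^ 2)) := by
          gcongr
          exact norm_osc_le_one hκ (by linarith)
      _ = C * u ^ 3 * (18 * K + 24 + 36 * K * ‖κ‖) := by ring
      _ ≤ C * u ^ 3 * ((36 * K + 24) * (1 + ‖κ‖)) := by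
          gcongr
          nlinarith [norm_nonneg κ, mul_nonneg hK0 (norm_nonneg κ)]
      _ = _ := by ring

/-- The regularized wave is `O(|x|⁻¹ e^{-Im κ |x|})`. -/
lemma exists_regWave_bound (hg : ContMDiff (𝓡 2) 𝓘(ℝ, ℂ) ∞ g) :
    ∃ C, 0 ≤ C ∧ ∀ κ : ℂ, ∀ x,
      ‖regWave κ g x‖ ≤ C * Real.exp (-(κ.im * ‖x‖)) * (1 + ‖x‖)⁻¹ := by
  obtain ⟨C, hC0, hC⟩ := exists_angular_bound hg
  refine ⟨2 * C, by positivity, fun κ x => ?_⟩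
  rw [regWave, radialMul, waveProfile, waveNum, norm_mul, norm_mul, norm_mul, norm_osc, norm_inv,
    Complex.norm_real, Complex.norm_real, norm_norm, Real.norm_of_nonneg (cutoff_nonneg _)]
  rcases le_or_gt ‖x‖ 1 with hx | hx
  · rw [cutoff_of_le hx]
    simp only [zero_mul]
    positivity
  · have hx0 : x ≠ 0 := by rintro rfl; simp at hx; linarith
    have hru : ‖x‖⁻¹ ≤ 2 * (1 + ‖x‖)⁻¹ := by
      rw [← div_eq_mul_inv, inv_eq_one_div, div_le_div_iff₀ (by linarith) (by linarith)]
      linarith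
    calc _ ≤ 1 * Real.exp (-(κ.im * ‖x‖)) * (2 * (1 + ‖x‖)⁻¹) * C := by
          gcongr
          · exact cutoff_le_one _
          · exact (hC x hx0).1
      _ = _ := by ring

open Laplacian in
/-- `(-Δ - κ²) (regWave κ g) = regSource κ g` in the sense of distributions. -/
lemma integral_regWave_mul_helmholtz {κ : ℂ} (hκ : 0 ≤ κ.im)
    (hg : ContMDiff (𝓡 2) 𝓘(ℝ, ℂ) ∞ g) (φ : 𝓢(R3, ℂ)) :
    ∫ x, regWave κ g x * (-(Δ φ : 𝓢(R3, ℂ)) x - κ ^ 2 * φ x) = ∫ x, regSource κ g x * φ x := by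
  obtain ⟨M, hp⟩ := radialProfile_waveProfile κ hκ
  obtain ⟨C, hC⟩ := hp.exists_bound hg
  obtain ⟨C', hC0', hC'⟩ := exists_regSource_bound hg
  have h := hp.integral_mul_laplacian hg φ
  have i0 := fun ψ => integrable_bdd_mul_schwartz (measurable_regWave κ hg) (fun x => (hC x).1) ψ
  have hs : Integrable fun x => regSource κ g x * φ x := by
    refine integrable_bdd_mul_schwartz (measurable_regSource κ hg) (C := C' * (1 + ‖κ‖))
      (fun x => (hC' κ hκ x).trans ?_) φ
    refine mul_le_of_le_one_right (by positivity) (pow_le_one₀ (by positivity) ?_)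
    exact inv_le_one_of_one_le₀ (by linarith [norm_nonneg x])
  have key : ∀ x : R3, x ≠ 0 → (waveProfileDD κ ‖x‖ + 2 * waveProfileD κ ‖x‖ / (‖x‖ : ℂ)) *
      angular g x + waveProfile κ ‖x‖ * angularLaplacian g x
      = -regSource κ g x - κ ^ 2 * regWave κ g x := by
    intro x hx
    have hx' : (‖x‖ : ℂ) ≠ 0 := Complex.ofReal_ne_zero.2 (norm_ne_zero_iff.2 hx)
    rw [regSource, regWave, radialMul, waveProfileDD, waveProfileD, waveProfile, waveNum, waveNumD,
      waveNumDD]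
    field_simp
    ring
  have e2 : ∫ x, regWave κ g x * (Δ φ : 𝓢(R3, ℂ)) x
      = ∫ x, (-1) * (regSource κ g x * φ x) - κ ^ 2 * (regWave κ g x * φ x) := by
    rw [regWave, h]
    refine integral_congr_ae ?_
    have h0 : ∀ᵐ x : R3, x ≠ 0 := by simp [ae_iff]
    filter_upwards [h0] with x hx
    rw [key x hx, regWave]
    ring
  have e1 : ∫ x, regWave κ g x * (-(Δ φ : 𝓢(R3, ℂ)) x - κ ^ 2 * φ x)
      = (-1) * (∫ x, regWave κ g x * (Δ φ : 𝓢(R3, ℂ)) x) - κ ^ 2 * ∫ x, regWave κ g x * φ x := by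
    rw [← integral_const_mul, ← integral_const_mul,
      ← integral_sub ((i0 _).const_mul _) ((i0 _).const_mul _)]
    congr 1 with x
    ring
  rw [e1, e2, integral_sub (hs.const_mul _) ((i0 _).const_mul _), integral_const_mul,
    integral_const_mul]
  ring

/-! ### Limits of the regularized waves in weighted spaces -/

/-- Dominated convergence in `L²`. -/
lemma tendsto_eLpNorm_two_of_dominated {α : Type*} [MeasurableSpace α] {m : Measure α}
    {a : ℕ → α → ℂ} {B : α → ℝ} (hB : MemLp B 2 m) (ha : ∀ n, AEStronglyMeasurable (a n) m)
    (hb : ∀ n x, ‖a n x‖ ≤ B x) (ht : ∀ x, Filter.Tendsto (fun n => a n x) Filter.atTop (nhds 0)) :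
    Filter.Tendsto (fun n => eLpNorm (a n) 2 m) Filter.atTop (nhds 0) := by
  have h2 : ∀ f : α → ℂ, eLpNorm f 2 m = (∫⁻ x, ‖f x‖ₑ ^ (2:ℝ) ∂m) ^ (1 / (2:ℝ)) := fun f => by
    rw [eLpNorm_eq_lintegral_rpow_enorm_toReal (by simp) (by simp)]
    simp
  have hBfin : ∫⁻ x, ‖B x‖ₑ ^ (2:ℝ) ∂m ≠ ⊤ := by
    have := lintegral_rpow_enorm_lt_top_of_eLpNorm_lt_top (by simp) (by simp) hB.2
    simpa using this.ne
  have key : Filter.Tendsto (fun n => ∫⁻ x, ‖a n x‖ₑ ^ (2:ℝ) ∂m) Filter.atTop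
      (nhds (∫⁻ _, 0 ∂m)) := by
    refine tendsto_lintegral_of_dominated_convergence' (fun x => ‖B x‖ₑ ^ (2:ℝ))
      (fun n => (ha n).enorm.pow_const _) (fun n => ae_of_all _ fun x => ?_) hBfin
      (ae_of_all _ fun x => ?_)
    · exact ENNReal.rpow_le_rpow (enorm_le_iff_norm_le.2 ((hb n x).trans (le_abs_self _)))
        (by norm_num)
    · have h := (ENNReal.continuous_rpow_const (y := 2)).tendsto 0 |>.comp
        (by simpa using (continuous_enorm.tendsto (0:ℂ)).comp (ht x))
      simpa [Function.comp_def] using h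
  simp_rw [h2]
  have h := (ENNReal.continuous_rpow_const (y := 1 / (2:ℝ))).tendsto _ |>.comp key
  simpa [Function.comp_def] using h

lemma memLp_inv_one_add_norm_sq (C : ℝ) :
    MemLp (fun x : R3 => C * ((1 + ‖x‖)⁻¹) ^ 2) 2 volume := by
  refine MemLp.const_mul ?_ C
  have hc : Continuous fun x : R3 => ((1 + ‖x‖)⁻¹) ^ 2 :=
    (Continuous.inv₀ (by fun_prop) fun x => by positivity).pow 2
  rw [memLp_two_iff_integrable_sq hc.aestronglyMeasurable]
  have := integrable_one_add_norm (E := R3) (μ := volume) (r := 4) (by simp; norm_num)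
  refine this.congr (ae_of_all _ fun x => ?_)
  have h : 0 ≤ 1 + ‖x‖ := by positivity
  simp only
  rw [Real.rpow_neg h, ← pow_mul, inv_pow]
  norm_cast

lemma norm_weight_inv (x : R3) : ‖(weight x)⁻¹‖ = (1 + ‖x‖)⁻¹ := by rw [norm_inv, norm_weight]

variable {g : S2 → ℂ}

lemma aestronglyMeasurable_weight_mul {f : R3 → ℂ} (hf : Measurable f) :
    AEStronglyMeasurable (fun x => weight x * f x) volume :=
  (continuous_weight.measurable.mul hf).aestronglyMeasurable

lemma aestronglyMeasurable_weight_inv_mul {f : R3 → ℂ} (hf : Measurable f) :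
    AEStronglyMeasurable (fun x => (weight x)⁻¹ * f x) volume :=
  (continuous_weight.measurable.inv.mul hf).aestronglyMeasurable

lemma norm_weight_inv_mul_regWave_le {C : ℝ} {κ : ℂ} (hκ : 0 ≤ κ.im) (hC0 : 0 ≤ C) {x : R3}
    (h : ‖regWave κ g x‖ ≤ C * Real.exp (-(κ.im * ‖x‖)) * (1 + ‖x‖)⁻¹) :
    ‖(weight x)⁻¹ * regWave κ g x‖ ≤ C * ((1 + ‖x‖)⁻¹) ^ 2 := by
  rw [norm_mul, norm_weight_inv]
  have h1 : Real.exp (-(κ.im * ‖x‖)) ≤ 1 := by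
    rw [Real.exp_le_one_iff]
    have := mul_nonneg hκ (norm_nonneg x)
    linarith
  calc _ ≤ (1 + ‖x‖)⁻¹ * (C * 1 * (1 + ‖x‖)⁻¹) := by
        gcongr
        exact h.trans (by gcongr)
    _ = _ := by ring

lemma norm_weight_mul_regSource_le {D : ℝ} {κ : ℂ} {x : R3}
    (h : ‖regSource κ g x‖ ≤ D * ((1 + ‖x‖)⁻¹) ^ 3) :
    ‖weight x * regSource κ g x‖ ≤ D * ((1 + ‖x‖)⁻¹) ^ 2 := by
  rw [norm_mul, norm_weight]
  have h0 : 0 < 1 + ‖x‖ := by positivity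
  calc _ ≤ (1 + ‖x‖) * (D * ((1 + ‖x‖)⁻¹) ^ 3) := by gcongr
    _ = _ := by field_simp

lemma memLp_weight_inv_mul_regWave {κ : ℂ} (hκ : 0 ≤ κ.im)
    (hg : ContMDiff (𝓡 2) 𝓘(ℝ, ℂ) ∞ g) :
    MemLp (fun x => (weight x)⁻¹ * regWave κ g x) 2 volume := by
  obtain ⟨C, hC0, hC⟩ := exists_regWave_bound hg
  refine (memLp_inv_one_add_norm_sq C).of_le
    (aestronglyMeasurable_weight_inv_mul (measurable_regWave κ hg))
    (ae_of_all _ fun x => ?_)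
  exact (norm_weight_inv_mul_regWave_le hκ hC0 (hC κ x)).trans (le_abs_self _)

lemma memLp_weight_mul_regSource {κ : ℂ} (hκ : 0 ≤ κ.im)
    (hg : ContMDiff (𝓡 2) 𝓘(ℝ, ℂ) ∞ g) :
    MemLp (fun x => weight x * regSource κ g x) 2 volume := by
  obtain ⟨C, hC0, hC⟩ := exists_regSource_bound hg
  refine (memLp_inv_one_add_norm_sq (C * (1 + ‖κ‖))).of_le
    (aestronglyMeasurable_weight_mul (measurable_regSource κ hg)) (ae_of_all _ fun x => ?_)
  exact (norm_weight_mul_regSource_le (hC κ hκ x)).trans (le_abs_self _)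

lemma memLp_regWave {κ : ℂ} (hκ : 0 < κ.im) (hg : ContMDiff (𝓡 2) 𝓘(ℝ, ℂ) ∞ g) :
    MemLp (regWave κ g) 2 volume := by
  obtain ⟨C, hC0, hC⟩ := exists_regWave_bound hg
  refine (memLp_inv_one_add_norm_sq (C * (1 + κ.im⁻¹))).of_le
    (measurable_regWave κ hg).aestronglyMeasurable (ae_of_all _ fun x => ?_)
  refine ((hC κ x).trans ?_).trans (le_abs_self _)
  have h0 : 0 < 1 + ‖x‖ := by positivity
  have hx := norm_nonneg x
  -- `e^{-t r} (1 + r) ≤ 1 + 1 / t`, since `1 + t r ≤ e^{t r}`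
  have h1 : Real.exp (-(κ.im * ‖x‖)) ≤ (1 + κ.im⁻¹) * (1 + ‖x‖)⁻¹ := by
    rw [Real.exp_neg, ← div_eq_mul_inv, inv_eq_one_div, div_le_div_iff₀ (Real.exp_pos _) h0]
    have h2 := Real.add_one_le_exp (κ.im * ‖x‖)
    calc 1 * (1 + ‖x‖) ≤ (1 + κ.im⁻¹) * (κ.im * ‖x‖ + 1) := by
          have : (1 + κ.im⁻¹) * (κ.im * ‖x‖ + 1) = 1 + ‖x‖ + κ.im * ‖x‖ + κ.im⁻¹ := by
            field_simp; ring
          rw [this]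
          have : 0 ≤ κ.im * ‖x‖ := by positivity
          have : 0 ≤ κ.im⁻¹ := by positivity
          linarith
      _ ≤ _ := by gcongr
  calc _ ≤ C * ((1 + κ.im⁻¹) * (1 + ‖x‖)⁻¹) * (1 + ‖x‖)⁻¹ := by gcongr
    _ = _ := by ring

lemma continuous_osc_left (r : ℝ) : Continuous fun κ : ℂ => osc κ r := by
  unfold osc; fun_prop

lemma continuous_regWave_left (g : S2 → ℂ) (x : R3) : Continuous fun κ : ℂ => regWave κ g x := by
  have := continuous_osc_left ‖x‖
  simp only [regWave, radialMul, waveProfile, waveNum]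
  fun_prop

lemma continuous_regSource_left (g : S2 → ℂ) (x : R3) :
    Continuous fun κ : ℂ => regSource κ g x := by
  have := continuous_osc_left ‖x‖
  simp only [regSource]
  fun_prop

variable {κ : ℕ → ℂ} {κ₀ : ℂ}

lemma tendsto_eLpNorm_weight_inv_mul_regWave_sub (hκ : ∀ n, 0 ≤ (κ n).im) (hκ₀ : 0 ≤ κ₀.im)
    (ht : Filter.Tendsto κ Filter.atTop (nhds κ₀)) (hg : ContMDiff (𝓡 2) 𝓘(ℝ, ℂ) ∞ g) :
    Filter.Tendsto (fun n => eLpNorm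
      (fun x => (weight x)⁻¹ * (regWave (κ n) g x - regWave κ₀ g x)) 2 volume)
      Filter.atTop (nhds 0) := by
  obtain ⟨C, hC0, hC⟩ := exists_regWave_bound hg
  refine tendsto_eLpNorm_two_of_dominated (memLp_inv_one_add_norm_sq (C + C))
    (fun n => aestronglyMeasurable_weight_inv_mul
      ((measurable_regWave _ hg).sub (measurable_regWave _ hg)))
    (fun n x => ?_) (fun x => ?_)
  · rw [mul_sub, add_mul]
    exact (norm_sub_le _ _).trans (add_le_add
      (norm_weight_inv_mul_regWave_le (hκ n) hC0 (hC _ x))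
      (norm_weight_inv_mul_regWave_le hκ₀ hC0 (hC _ x)))
  · have := ((((continuous_regWave_left g x).tendsto κ₀).comp ht).sub_const
      (regWave κ₀ g x)).const_mul (weight x)⁻¹
    simpa using this

lemma tendsto_eLpNorm_weight_mul_regSource_sub (hκ : ∀ n, 0 ≤ (κ n).im) (hκ₀ : 0 ≤ κ₀.im)
    (ht : Filter.Tendsto κ Filter.atTop (nhds κ₀)) (hg : ContMDiff (𝓡 2) 𝓘(ℝ, ℂ) ∞ g) :
    Filter.Tendsto (fun n => eLpNorm
      (fun x => weight x * (regSource (κ n) g x - regSource κ₀ g x)) 2 volume)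
      Filter.atTop (nhds 0) := by
  obtain ⟨C, hC0, hC⟩ := exists_regSource_bound hg
  obtain ⟨K, hK⟩ := ht.norm.bddAbove_range
  have hK' : ∀ n, ‖κ n‖ ≤ K := fun n => hK ⟨n, rfl⟩
  refine tendsto_eLpNorm_two_of_dominated
    (memLp_inv_one_add_norm_sq (C * (1 + K) + C * (1 + ‖κ₀‖)))
    (fun n => aestronglyMeasurable_weight_mul
      ((measurable_regSource _ hg).sub (measurable_regSource _ hg)))
    (fun n x => ?_) (fun x => ?_)
  · rw [mul_sub, add_mul]
    refine (norm_sub_le _ _).trans (add_le_add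
      (norm_weight_mul_regSource_le ((hC _ (hκ n) x).trans ?_))
      (norm_weight_mul_regSource_le (hC _ hκ₀ x)))
    gcongr
    exact hK' n
  · have := ((((continuous_regSource_left g x).tendsto κ₀).comp ht).sub_const
      (regSource κ₀ g x)).const_mul (weight x)
    simpa using this

/-- The cutoff changes the spherical wave only by a square integrable function, because `|x|⁻¹` is
locally square integrable in dimension three. -/
lemma memLp_regWave_sub_sphericalWave (k : ℝ) (hg : ContMDiff (𝓡 2) 𝓘(ℝ, ℂ) ∞ g) :
    MemLp (fun x => regWave k g x - sphericalWave k g x) 2 volume := by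
  obtain ⟨C, hC0, hC⟩ := exists_angular_bound hg
  set b : ℝ → ℝ := fun r => (Set.Iic (2:ℝ)).indicator (fun r => C * r⁻¹) r with hb
  have hbm : Measurable b :=
    (measurable_inv.const_mul C).indicator measurableSet_Iic
  have hbL : MemLp (fun x : R3 => b ‖x‖) 2 volume := by
    have hbm' : Measurable fun x : R3 => b ‖x‖ := hbm.comp measurable_norm
    rw [memLp_two_iff_integrable_sq hbm'.aestronglyMeasurable,
      integrable_fun_norm_addHaar (μ := (volume : Measure R3)) (f := fun r => b r ^ 2)]
    have h1 : IntegrableOn (fun _ : ℝ => C ^ 2) (Set.Ioc 0 2) := by simp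
    have h2 := (integrable_indicator_iff measurableSet_Ioc).2 h1
    refine h2.integrableOn.congr_fun (fun r hr => ?_) measurableSet_Ioi
    have hr' : 0 < r := hr
    by_cases h : r ≤ 2
    · simp [hb, h, hr']
      field_simp
    · simp [hb, h]
  have hm : Measurable (sphericalWave k g) := by
    unfold sphericalWave
    have : Measurable fun x : R3 => (‖x‖ : ℂ) := Complex.measurable_ofReal.comp measurable_norm
    exact ((this.const_mul _).cexp.mul this.inv).mul (measurable_angular hg)
  refine hbL.of_le ((measurable_regWave _ hg).sub hm).aestronglyMeasurable
    (ae_of_all _ fun x => ?_)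
  rcases eq_or_ne x 0 with rfl | hx0
  · simp [regWave, radialMul, sphericalWave, waveProfile, waveNum]
  have e : regWave k g x - sphericalWave k g x
      = ((cutoff ‖x‖ - 1 : ℝ) : ℂ) * osc k ‖x‖ * (‖x‖ : ℂ)⁻¹ * angular g x := by
    simp only [regWave, radialMul, sphericalWave, waveProfile, waveNum, osc]
    push_cast
    ring
  rw [e]
  by_cases h : ‖x‖ ≤ 2
  · have h1 : ‖((cutoff ‖x‖ - 1 : ℝ) : ℂ)‖ ≤ 1 := by
      rw [Complex.norm_real, Real.norm_eq_abs, abs_le]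
      constructor <;> linarith [cutoff_nonneg ‖x‖, cutoff_le_one ‖x‖]
    have h2 : ‖osc k ‖x‖‖ ≤ 1 := norm_osc_le_one (by simp) (norm_nonneg x)
    have h3 : ‖(‖x‖ : ℂ)⁻¹‖ = ‖x‖⁻¹ := by simp
    rw [norm_mul, norm_mul, norm_mul, h3]
    refine le_trans ?_ (le_abs_self _)
    calc _ ≤ 1 * 1 * ‖x‖⁻¹ * C := by gcongr; exact (hC x hx0).1
      _ = b ‖x‖ := by simp [hb, h]; ring
  · rw [cutoff_of_ge (by linarith)]
    simp

/-! ### The radial integrals -/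

/-- Integration in polar coordinates of a product of a radial and an angular function. -/
lemma integral_radial_mul_angular (ρ : ℝ → ℂ) (G : S2 → ℂ) :
    ∫ x : R3, ρ ‖x‖ * angular G x
      = (∫ r in Set.Ioi (0:ℝ), ((r ^ 2 : ℝ) : ℂ) * ρ r)
        * ∫ θ, G θ ∂((volume : Measure R3).toSphere) := by
  -- the exponent of `r` in the volume element is natural-number subtraction `dim - 1`
  have hd : Module.finrank ℝ R3 - 1 = 2 := by simp
  calc ∫ x : R3, ρ ‖x‖ * angular G x
      = ∫ x : ({(0 : R3)}ᶜ : Set R3), ρ ‖x.1‖ * angular G x.1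
          ∂((volume : Measure R3).comap (↑)) := by
        rw [integral_subtype_comap (measurableSet_singleton _).compl
          fun x : R3 => ρ ‖x‖ * angular G x, restrict_compl_singleton]
    _ = ∫ z : S2 × Set.Ioi (0:ℝ), G z.1 * ρ z.2
          ∂((volume : Measure R3).toSphere.prod (.volumeIoiPow (Module.finrank ℝ R3 - 1))) := by
        rw [← (volume : Measure R3).measurePreserving_homeomorphUnitSphereProd.integral_comp
          (Homeomorph.measurableEmbedding _)]
        refine integral_congr_ae (ae_of_all _ fun x => ?_)
        have hx : (x : R3) ≠ 0 := x.2
        simp only [angular, hx, dite_false, homeomorphUnitSphereProd_apply_snd_coe]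
        rw [mul_comm]
        congr 2
        ext1
        simp
    _ = (∫ θ, G θ ∂((volume : Measure R3).toSphere))
          * ∫ r : Set.Ioi (0:ℝ), ρ r ∂.volumeIoiPow (Module.finrank ℝ R3 - 1) :=
        integral_prod_mul G (fun r : Set.Ioi (0:ℝ) => ρ r)
    _ = _ := by
        rw [mul_comm, hd]
        congr 1
        simp only [Measure.volumeIoiPow, ENNReal.ofReal]
        rw [integral_withDensity_eq_integral_smul,
          integral_subtype_comap measurableSet_Ioi fun a : ℝ => Real.toNNReal (a ^ 2) • ρ a]
        · refine setIntegral_congr_fun measurableSet_Ioi fun x hx => ?_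
          rw [NNReal.smul_def, Real.coe_toNNReal _ (pow_nonneg hx.out.le _), Complex.real_smul]
        · exact (measurable_subtype_coe.pow_const _).real_toNNReal

/-- `ε ∫₀^∞ b(r)² e^{-2εr} dr → 1/2`: the mass escapes to infinity. -/
lemma tendsto_mul_integral_cutoff_sq_mul_exp :
    Filter.Tendsto (fun ε : ℝ => ε * ∫ r in Set.Ioi (0:ℝ), cutoff r ^ 2 * Real.exp (-(2 * ε) * r))
      (nhdsWithin 0 (Set.Ioi 0)) (nhds (1 / 2)) := by
  have hint : ∀ ε : ℝ, 0 < ε → ∀ c, ∫ r in Set.Ioi c, Real.exp (-(2 * ε) * r)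
      = Real.exp (-(2 * ε) * c) / (2 * ε) := fun ε hε c => by
    rw [integral_exp_mul_Ioi (by linarith), neg_div_neg_eq]
  have hI : ∀ ε : ℝ, 0 < ε → ∀ c,
      IntegrableOn (fun r => Real.exp (-(2 * ε) * r)) (Set.Ioi c) := fun ε hε c =>
    integrableOn_exp_mul_Ioi (by linarith) c
  have hJ : ∀ ε : ℝ, 0 < ε → IntegrableOn
      (fun r => cutoff r ^ 2 * Real.exp (-(2 * ε) * r)) (Set.Ioi 0) := fun ε hε => by
    refine (hI ε hε 0).mono' ?_ (ae_of_all _ fun r => ?_)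
    · exact ((contDiff_cutoff.continuous.pow 2).mul (by fun_prop)).aestronglyMeasurable
    · rw [norm_mul, Real.norm_of_nonneg (Real.exp_nonneg _), Real.norm_of_nonneg (by positivity)]
      exact mul_le_of_le_one_left (Real.exp_nonneg _)
        (pow_le_one₀ (cutoff_nonneg r) (cutoff_le_one r))
  have hlow : Filter.Tendsto (fun ε : ℝ => Real.exp (-(2 * ε) * 2) / 2)
      (nhdsWithin 0 (Set.Ioi 0)) (nhds (1 / 2)) := by
    have : Continuous fun ε : ℝ => Real.exp (-(2 * ε) * 2) / 2 := by fun_prop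
    have h := this.tendsto 0
    simp only [mul_zero, neg_zero, zero_mul, Real.exp_zero] at h
    exact h.mono_left nhdsWithin_le_nhds
  refine tendsto_of_tendsto_of_tendsto_of_le_of_le' hlow tendsto_const_nhds ?_ ?_
  · filter_upwards [self_mem_nhdsWithin] with ε hε
    have hε : 0 < ε := hε
    have h1 : ∫ r in Set.Ioi (2:ℝ), Real.exp (-(2 * ε) * r)
        ≤ ∫ r in Set.Ioi (0:ℝ), cutoff r ^ 2 * Real.exp (-(2 * ε) * r) := by
      calc _ = ∫ r in Set.Ioi (2:ℝ), cutoff r ^ 2 * Real.exp (-(2 * ε) * r) :=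
            setIntegral_congr_fun measurableSet_Ioi fun r hr => by
              simp [cutoff_of_ge (le_of_lt hr)]
        _ ≤ _ := setIntegral_mono_set (hJ ε hε) (ae_of_all _ fun r => by positivity)
            (Set.Ioi_subset_Ioi (by norm_num)).eventuallyLE
    rw [hint ε hε] at h1
    calc _ = ε * (Real.exp (-(2 * ε) * 2) / (2 * ε)) := by field_simp
      _ ≤ _ := by gcongr
  · filter_upwards [self_mem_nhdsWithin] with ε hε
    have hε : 0 < ε := hε
    have h1 : ∫ r in Set.Ioi (0:ℝ), cutoff r ^ 2 * Real.exp (-(2 * ε) * r)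
        ≤ ∫ r in Set.Ioi (0:ℝ), Real.exp (-(2 * ε) * r) := by
      refine setIntegral_mono (hJ ε hε) (hI ε hε 0) fun r => ?_
      exact mul_le_of_le_one_left (Real.exp_nonneg _)
        (pow_le_one₀ (cutoff_nonneg r) (cutoff_le_one r))
    rw [hint ε hε] at h1
    calc _ ≤ ε * (Real.exp (-(2 * ε) * 0) / (2 * ε)) := by gcongr
      _ = _ := by simp; field_simp

lemma integral_regWave_mul_conj (κ : ℂ) (g g' : S2 → ℂ) :
    ∫ x, regWave κ g x * (starRingEnd ℂ) (regWave κ g' x)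
      = ((∫ r in Set.Ioi (0:ℝ), cutoff r ^ 2 * Real.exp (-(2 * κ.im) * r) : ℝ) : ℂ)
        * spherePairing g g' := by
  have e : ∀ x : R3, regWave κ g x * (starRingEnd ℂ) (regWave κ g' x)
      = (((cutoff ‖x‖ ^ 2 * Real.exp (-(2 * κ.im) * ‖x‖) * (‖x‖⁻¹) ^ 2 : ℝ)) : ℂ)
        * angular (fun θ => g θ * (starRingEnd ℂ) (g' θ)) x := by
    intro x
    rcases eq_or_ne x 0 with rfl | hx
    · simp [regWave, radialMul, waveProfile]
    have h1 : osc κ ‖x‖ * (starRingEnd ℂ) (osc κ ‖x‖)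
        = (Real.exp (-(2 * κ.im) * ‖x‖) : ℂ) := by
      rw [Complex.mul_conj, Complex.normSq_eq_norm_sq, norm_osc, ← Real.exp_nat_mul]
      congr 2
      push_cast
      ring
    have h2 : angular (fun θ => g θ * (starRingEnd ℂ) (g' θ)) x
        = angular g x * (starRingEnd ℂ) (angular g' x) := by
      simp [angular, hx]
    rw [h2]
    simp only [regWave, radialMul, waveProfile, waveNum, map_mul, map_inv₀, Complex.conj_ofReal]
    push_cast
    push_cast at h1
    rw [← h1]
    ring
  simp_rw [e]
  rw [integral_radial_mul_angular
    (fun r => ((cutoff r ^ 2 * Real.exp (-(2 * κ.im) * r) * (r⁻¹) ^ 2 : ℝ) : ℂ)), spherePairing]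
  congr 1
  rw [← integral_complex_ofReal]
  refine setIntegral_congr_fun measurableSet_Ioi fun r hr => ?_
  have hr : (r : ℂ) ≠ 0 := Complex.ofReal_ne_zero.2 (ne_of_gt hr)
  push_cast
  field_simp

variable {κ : ℕ → ℂ}

/-- The energy of the regularized wave concentrates at infinity as `Im κ → 0`. -/
lemma tendsto_im_mul_integral_regWave_mul_conj (hκ : ∀ n, 0 < (κ n).im)
    (ht : Filter.Tendsto (fun n => (κ n).im) Filter.atTop (nhds 0)) (g g' : S2 → ℂ) :
    Filter.Tendsto (fun n => ((κ n).im : ℂ) *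
      ∫ x, regWave (κ n) g x * (starRingEnd ℂ) (regWave (κ n) g' x))
      Filter.atTop (nhds (1 / 2 * spherePairing g g')) := by
  have h1 := tendsto_mul_integral_cutoff_sq_mul_exp.comp
    (tendsto_nhdsWithin_iff.2 ⟨ht, Filter.Eventually.of_forall hκ⟩)
  have h2 := ((Complex.continuous_ofReal.tendsto _).comp h1).mul_const (spherePairing g g')
  simp only [integral_regWave_mul_conj]
  convert h2 using 2 with n
  · simp [mul_assoc]
  · simp

/-! ### The half-wave source of the regularized waves -/

lemma tendsto_integral_mul_of_weight {u v : ℕ → R3 → ℂ} {u₀ v₀ : R3 → ℂ}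
    (hu : ∀ n, MemLp (fun x => (weight x)⁻¹ * u n x) 2 volume)
    (hv : ∀ n, MemLp (fun x => weight x * v n x) 2 volume)
    (hu₀ : MemLp (fun x => (weight x)⁻¹ * u₀ x) 2 volume)
    (hv₀ : MemLp (fun x => weight x * v₀ x) 2 volume)
    (htu : Filter.Tendsto (fun n => eLpNorm (fun x => (weight x)⁻¹ * (u n x - u₀ x)) 2 volume)
      Filter.atTop (nhds 0))
    (htv : Filter.Tendsto (fun n => eLpNorm (fun x => weight x * (v n x - v₀ x)) 2 volume)
      Filter.atTop (nhds 0)) :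
    Filter.Tendsto (fun n => ∫ x, u n x * v n x) Filter.atTop (nhds (∫ x, u₀ x * v₀ x)) := by
  have key : ∀ v : R3 → ℂ, MemLp (fun x => weight x * v x) 2 volume →
      MemLp (fun x => weight x * (starRingEnd ℂ) (v x)) 2 volume := fun v hv => by
    have h : MemLp (fun x => (starRingEnd ℂ) (weight x * v x)) 2 volume := hv.star
    simpa [weight] using h
  have := tendsto_integral_mul_conj_of_weight (v := fun n x => (starRingEnd ℂ) (v n x))
    (v₀ := fun x => (starRingEnd ℂ) (v₀ x)) hu (fun n => key _ (hv n)) hu₀ (key _ hv₀) htu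
    (htv.congr fun n => eLpNorm_congr_norm_ae (ae_of_all _ fun x => by
      rw [norm_mul, norm_mul, ← map_sub, RCLike.norm_conj]))
  simpa using this

lemma memLp_weight_inv_mul {f : R3 → ℂ} (hf : MemLp f 2 volume) :
    MemLp (fun x => (weight x)⁻¹ * f x) 2 volume := by
  refine hf.of_le ((continuous_weight.measurable.inv.aestronglyMeasurable).mul hf.1)
    (ae_of_all _ fun x => ?_)
  rw [norm_mul, norm_weight_inv]
  exact mul_le_of_le_one_left (norm_nonneg _)
    (inv_le_one_of_one_le₀ (by linarith [norm_nonneg x]))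

variable {g : S2 → ℂ}

/-- For `Im κ ≥ 0` and `σ = ±1` with `Re (σκ) > 0`, set
`f = ((-Δ)^{1/2} + σκ)⁻¹ (-Δ - κ²) (regWave κ g)`. Since
`((-Δ)^{1/2} + μ) ((-Δ)^{1/2} - μ) = -Δ - μ²`, this is `((-Δ)^{1/2} - σκ) (regWave κ g)` as long as
the wave is square integrable, that is for `Im κ > 0`. -/
lemma exists_regWave_halfSource {κ σ : ℂ} (hκ : 0 ≤ κ.im) (hσ : σ ^ 2 = 1) (hμ : 0 < (σ * κ).re)
    (hg : ContMDiff (𝓡 2) 𝓘(ℝ, ℂ) ∞ g) :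
    ∃ k f, HasL2Fourier (regSource κ g) k ∧
      HasL2Fourier f (fun ξ => resolventSymbol (σ * κ) ξ * k ξ) ∧
      MemLp (fun x => weight x * f x) 2 volume ∧
      (0 < κ.im → ∃ v, HasL2Fourier (regWave κ g) v ∧
        HasL2Fourier f (fun ξ => halfSymbol (σ * κ) ξ * v ξ)) := by
  have hw := memLp_weight_mul_regSource hκ hg
  obtain ⟨k, hk⟩ := HasL2Fourier.exists_right (memLp_of_weight_mul hw)
  obtain ⟨f, hf⟩ :=
    exists_multiplier (continuous_resolventSymbol hμ) (norm_resolventSymbol_le hμ) hk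
  refine ⟨k, f, hk, hf, memLp_weight_mul_resolvent hμ hk hf hw, fun hκ' => ?_⟩
  obtain ⟨v, hv⟩ := HasL2Fourier.exists_right (memLp_regWave hκ' hg)
  refine ⟨v, hv, hf.congr_right ?_⟩
  have h := (forall_integral_neg_laplacian_sub_iff (σ * κ) hv hk).1 fun φ => by
    rw [mul_pow, hσ, one_mul]
    exact integral_regWave_mul_helmholtz hκ hg φ
  filter_upwards [h] with ξ hξ
  rw [halfSymbol_eq_resolventSymbol_mul hμ, mul_assoc, hξ]

/-- Continuity of `h ↦ ((-Δ)^{1/2} + μ)⁻¹ h` in `L^{2,1}`, jointly in `h` and `μ`, by the resolvent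
identity. -/
lemma tendsto_eLpNorm_weight_mul_resolvent {lam : ℝ} (hlam : 0 < lam) {μ : ℕ → ℂ}
    (hμ : ∀ n, (μ n).re = lam) (hμt : Filter.Tendsto μ Filter.atTop (nhds lam))
    {h k f : ℕ → R3 → ℂ} {h₀ k₀ f₀ : R3 → ℂ} (hh : ∀ n, HasL2Fourier (h n) (k n))
    (hh₀ : HasL2Fourier h₀ k₀)
    (hf : ∀ n, HasL2Fourier (f n) (fun ξ => resolventSymbol (μ n) ξ * k n ξ))
    (hf₀ : HasL2Fourier f₀ (fun ξ => resolventSymbol lam ξ * k₀ ξ))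
    (hw : ∀ n, MemLp (fun x => weight x * h n x) 2 volume)
    (hw₀ : MemLp (fun x => weight x * h₀ x) 2 volume)
    (ht : Filter.Tendsto (fun n => eLpNorm (fun x => weight x * (h n x - h₀ x)) 2 volume)
      Filter.atTop (nhds 0)) :
    Filter.Tendsto (fun n => eLpNorm (fun x => weight x * (f n x - f₀ x)) 2 volume)
      Filter.atTop (nhds 0) := by
  have hlam' : 0 < (lam : ℂ).re := by simpa
  have hwf₀ := memLp_weight_mul_resolvent hlam' hh₀ hf₀ hw₀
  have hb : ∀ n, eLpNorm (fun x => weight x * (f n x - f₀ x)) 2 volume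
      ≤ ENNReal.ofReal (resolventBound lam) *
        (eLpNorm (fun x => weight x * (h n x - h₀ x)) 2 volume
          + ‖μ n - lam‖ₑ * eLpNorm (fun x => weight x * f₀ x) 2 volume) := by
    intro n
    have hμn : 0 < (μ n).re := by rw [hμ n]; exact hlam
    have h1 := ((hh n).sub hh₀).sub (hf₀.const_mul (μ n - lam))
    have h2 : HasL2Fourier (fun x => f n x - f₀ x) (fun ξ => resolventSymbol (μ n) ξ *
        (k n ξ - k₀ ξ - (μ n - lam) * (resolventSymbol lam ξ * k₀ ξ))) := by
      refine ((hf n).sub hf₀).congr_right (ae_of_all _ fun ξ => ?_)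
      have a1 := add_ne_zero_of_re_pos hμn ξ
      have a2 := add_ne_zero_of_re_pos hlam' ξ
      simp only [resolventSymbol]
      field_simp
      ring
    have h3 := eLpNorm_weight_mul_resolvent_le hμn h1 h2
    rw [hμ n] at h3
    refine h3.trans ?_
    gcongr
    have e : (fun x => weight x * (h n x - h₀ x - (μ n - lam) * f₀ x))
        = (fun x => weight x * (h n x - h₀ x)) - (μ n - lam) • fun x => weight x * f₀ x := by
      ext x
      simp only [Pi.sub_apply, Pi.smul_apply, smul_eq_mul]
      ring
    rw [e]
    refine (eLpNorm_sub_le ?_ (hwf₀.1.const_smul _) (by norm_num)).trans ?_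
    · refine ((hw n).1.sub hw₀.1).congr (ae_of_all _ fun x => ?_)
      simp only [Pi.sub_apply]
      ring
    · rw [eLpNorm_const_smul]
  have hlim : Filter.Tendsto (fun n => ENNReal.ofReal (resolventBound lam) *
        (eLpNorm (fun x => weight x * (h n x - h₀ x)) 2 volume
          + ‖μ n - lam‖ₑ * eLpNorm (fun x => weight x * f₀ x) 2 volume)) Filter.atTop (nhds 0) := by
    have h1 : Filter.Tendsto (fun n => ‖μ n - (lam : ℂ)‖ₑ) Filter.atTop (nhds 0) := by
      have := (continuous_enorm.tendsto (0:ℂ)).comp (by simpa using hμt.sub_const (lam : ℂ))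
      simpa [Function.comp_def] using this
    have h2 := ENNReal.Tendsto.mul_const (b := eLpNorm (fun x => weight x * f₀ x) 2 volume) h1
      (Or.inr hwf₀.2.ne)
    have h3 := ENNReal.Tendsto.const_mul (a := ENNReal.ofReal (resolventBound lam)) (ht.add h2)
      (Or.inr ENNReal.ofReal_ne_top)
    simpa using h3
  exact tendsto_of_tendsto_of_tendsto_of_le_of_le tendsto_const_nhds hlim (fun _ => zero_le) hb

/-- The equation `((-Δ)^{1/2} - μ) u = f` passes to the limit in `L^{2,-1} × L^{2,1}`. -/
lemma integral_mul_halfLaplacian_sub_of_tendsto {lam : ℝ} {μ : ℕ → ℂ}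
    (hμt : Filter.Tendsto μ Filter.atTop (nhds lam)) {u f v : ℕ → R3 → ℂ} {u₀ f₀ : R3 → ℂ}
    (huv : ∀ n, HasL2Fourier (u n) (v n))
    (hfv : ∀ n, HasL2Fourier (f n) (fun ξ => halfSymbol (μ n) ξ * v n ξ))
    (hu₀ : MemLp (fun x => (weight x)⁻¹ * u₀ x) 2 volume)
    (hf : ∀ n, MemLp (fun x => weight x * f n x) 2 volume)
    (hf₀ : MemLp (fun x => weight x * f₀ x) 2 volume)
    (htu : Filter.Tendsto (fun n => eLpNorm (fun x => (weight x)⁻¹ * (u n x - u₀ x)) 2 volume)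
      Filter.atTop (nhds 0))
    (htf : Filter.Tendsto (fun n => eLpNorm (fun x => weight x * (f n x - f₀ x)) 2 volume)
      Filter.atTop (nhds 0)) (φ : 𝓢(R3, ℂ)) :
    ∫ x, u₀ x * (halfLaplacian φ x - lam * φ x) = ∫ x, f₀ x * φ x := by
  have hφ := memLp_weight_inv_mul (φ.memLp 2)
  have hφw := memLp_weight_mul_schwartz φ
  have h1 : Filter.Tendsto (fun n => ∫ x, u n x * (halfLaplacian φ x - μ n * φ x)) Filter.atTop
      (nhds (∫ x, u₀ x * (halfLaplacian φ x - lam * φ x))) := by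
    refine tendsto_integral_mul_of_weight
      (v := fun n x => halfLaplacian φ x - μ n * φ x)
      (fun n => memLp_weight_inv_mul (huv n).memLp_left)
      (fun n => memLp_weight_mul_halfLaplacian_sub (μ n) φ) hu₀
      (memLp_weight_mul_halfLaplacian_sub lam φ) htu ?_
    have e : ∀ n, eLpNorm (fun x => weight x * (halfLaplacian φ x - μ n * φ x
        - (halfLaplacian φ x - lam * φ x))) 2 volume
        = ‖lam - μ n‖ₑ * eLpNorm (fun x => weight x * φ x) 2 volume := fun n => by
      rw [← eLpNorm_const_smul]
      congr 1
      ext x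
      simp only [Pi.smul_apply, smul_eq_mul]
      ring
    simp_rw [e]
    have h1 : Filter.Tendsto (fun n => ‖(lam : ℂ) - μ n‖ₑ) Filter.atTop (nhds 0) := by
      have := (continuous_enorm.tendsto (0:ℂ)).comp
        (by simpa using hμt.const_sub (lam : ℂ))
      simpa [Function.comp_def] using this
    simpa using ENNReal.Tendsto.mul_const h1 (Or.inr hφw.2.ne)
  have h2 : Filter.Tendsto (fun n => ∫ x, f n x * φ x) Filter.atTop
      (nhds (∫ x, f₀ x * φ x)) := by
    have := tendsto_integral_mul_of_weight (u := fun _ => φ) (u₀ := φ) (fun _ => hφ) hf hφ hf₀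
      (by simp) htf
    simpa only [mul_comm] using this
  refine tendsto_nhds_unique h1 (h2.congr fun n => ?_)
  exact ((forall_integral_halfLaplacian_sub_iff (μ n) (huv n) (hfv n)).2 (ae_of_all _ fun _ => rfl)
    φ).symm

/-- The scaled wave `Im κ · regWave κ g` tends to `0` in `L²`, its norm being `O((Im κ)^{1/2})`. -/
lemma tendsto_eLpNorm_im_mul_regWave {κ : ℕ → ℂ} (hκ : ∀ n, 0 < (κ n).im)
    (ht : Filter.Tendsto (fun n => (κ n).im) Filter.atTop (nhds 0))
    (hg : ContMDiff (𝓡 2) 𝓘(ℝ, ℂ) ∞ g) :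
    Filter.Tendsto (fun n => eLpNorm (fun x => ((κ n).im : ℂ) * regWave (κ n) g x) 2 volume)
      Filter.atTop (nhds 0) := by
  have hL : ∀ n, MemLp (fun x => ((κ n).im : ℂ) * regWave (κ n) g x) 2 volume := fun n =>
    (memLp_regWave (hκ n) hg).const_mul _
  have h1 := ((Complex.continuous_ofReal.tendsto 0).comp ht).mul
    (tendsto_im_mul_integral_regWave_mul_conj hκ ht g g)
  have h2 : Filter.Tendsto (fun n => ‖(hL n).toLp _‖ ^ 2) Filter.atTop (nhds 0) := by
    have h3 := h1.norm
    simp only [Complex.ofReal_zero, zero_mul, norm_zero] at h3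
    refine h3.congr fun n => ?_
    have hn : ((‖(hL n).toLp _‖ ^ 2 : ℝ) : ℂ) = inner ℂ ((hL n).toLp _) ((hL n).toLp _) := by
      rw [Complex.ofReal_pow]
      exact (inner_self_eq_norm_sq_to_K (𝕜 := ℂ) ((hL n).toLp _)).symm
    rw [← Complex.norm_of_nonneg (sq_nonneg _), hn, inner_toLp]
    congr 1
    simp only [Function.comp_apply]
    rw [← integral_const_mul, ← integral_const_mul]
    congr 1 with x
    rw [map_mul, Complex.conj_ofReal]
    ring
  have h4 := (h2.sqrt)
  simp only [Real.sqrt_zero, Real.sqrt_sq (norm_nonneg _)] at h4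
  have h5 := (ENNReal.continuous_ofReal.tendsto 0).comp h4
  simp only [ENNReal.ofReal_zero] at h5
  refine h5.congr fun n => ?_
  rw [Function.comp_apply, Lp.norm_toLp, ENNReal.ofReal_toReal (hL n).2.ne]

/-! ### Regularization of the solutions -/

/-- The complex frequencies `σλ + iε`, with `ε = 1 / (n + 1)`. -/
noncomputable def freq (σ lam : ℝ) (n : ℕ) : ℂ :=
  ((σ * lam : ℝ) : ℂ) + Complex.I * ((1 / (n + 1) : ℝ) : ℂ)

lemma freq_im (σ lam : ℝ) (n : ℕ) : (freq σ lam n).im = 1 / (n + 1) := by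
  rw [freq, Complex.add_im, Complex.ofReal_im, Complex.I_mul_im, Complex.ofReal_re, zero_add]

lemma freq_im_pos (σ lam : ℝ) (n : ℕ) : 0 < (freq σ lam n).im := by
  rw [freq_im]; positivity

lemma tendsto_freq_im (σ lam : ℝ) :
    Filter.Tendsto (fun n => (freq σ lam n).im) Filter.atTop (nhds 0) := by
  simp only [freq_im]
  exact tendsto_one_div_add_atTop_nhds_zero_nat

lemma tendsto_freq (σ lam : ℝ) :
    Filter.Tendsto (freq σ lam) Filter.atTop (nhds ((σ * lam : ℝ) : ℂ)) := by
  have h := (((Complex.continuous_ofReal.tendsto 0).comp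
    (tendsto_one_div_add_atTop_nhds_zero_nat (𝕜 := ℝ))).const_mul Complex.I).const_add
      ((σ * lam : ℝ) : ℂ)
  rw [Complex.ofReal_zero, mul_zero, add_zero] at h
  exact h

variable {lam : ℝ}

/-- The regularized waves with frequencies `σλ + iε` satisfy half-wave equations whose right-hand
sides converge in `L^{2,1}`. -/
lemma exists_regWave_halfSource_seq (hlam : 0 < lam) {σ : ℝ} (hσ : σ ^ 2 = 1) {g : S2 → ℂ}
    (hg : ContMDiff (𝓡 2) 𝓘(ℝ, ℂ) ∞ g) :
    ∃ (f : ℕ → R3 → ℂ) (f₀ : R3 → ℂ), MemLp (fun x => weight x * f₀ x) 2 volume ∧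
      (∀ n, MemLp (fun x => weight x * f n x) 2 volume) ∧
      Filter.Tendsto (fun n => eLpNorm (fun x => weight x * (f n x - f₀ x)) 2 volume)
        Filter.atTop (nhds 0) ∧
      (∀ n, ∃ v, HasL2Fourier (regWave (freq σ lam n) g) v ∧
        HasL2Fourier (f n) (fun ξ => halfSymbol (σ * freq σ lam n) ξ * v ξ)) ∧
      ∀ φ : 𝓢(R3, ℂ), ∫ x, regWave ((σ * lam : ℝ) : ℂ) g x * (halfLaplacian φ x - lam * φ x)
        = ∫ x, f₀ x * φ x := by
  have hσ' : (σ : ℂ) ^ 2 = 1 := by exact_mod_cast hσ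
  have e₀ : (σ : ℂ) * ((σ * lam : ℝ) : ℂ) = lam := by
    push_cast
    linear_combination (lam : ℂ) * hσ'
  have hre : ∀ n, ((σ : ℂ) * freq σ lam n).re = lam := fun n => by
    rw [Complex.re_ofReal_mul, freq, Complex.add_re, Complex.ofReal_re, Complex.I_mul_re,
      Complex.ofReal_im, neg_zero, add_zero, ← mul_assoc, ← sq, hσ, one_mul]
  have him := fun n => (freq_im_pos σ lam n).le
  have him₀ : 0 ≤ (((σ * lam : ℝ) : ℂ)).im := by rw [Complex.ofReal_im]
  have hμt : Filter.Tendsto (fun n => (σ : ℂ) * freq σ lam n) Filter.atTop (nhds lam) := by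
    rw [← e₀]
    exact (tendsto_freq σ lam).const_mul _
  choose k f hk hf hfw hv using fun n => exists_regWave_halfSource (g := g) (him n) hσ'
    (by rw [hre n]; exact hlam) hg
  obtain ⟨k₀, f₀, hk₀, hf₀, hfw₀, -⟩ := exists_regWave_halfSource (g := g) him₀ hσ'
    (by rw [e₀]; simpa) hg
  rw [e₀] at hf₀
  have htf := tendsto_eLpNorm_weight_mul_resolvent hlam hre hμt hk hk₀ hf hf₀
    (fun n => memLp_weight_mul_regSource (him n) hg) (memLp_weight_mul_regSource him₀ hg)
    (tendsto_eLpNorm_weight_mul_regSource_sub him him₀ (tendsto_freq σ lam) hg)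
  refine ⟨f, f₀, hfw₀, hfw, htf, fun n => hv n (freq_im_pos σ lam n), fun φ => ?_⟩
  choose v hv1 hv2 using fun n => hv n (freq_im_pos σ lam n)
  exact integral_mul_halfLaplacian_sub_of_tendsto hμt hv1 hv2
    (memLp_weight_inv_mul_regWave him₀ hg) hfw hfw₀
    (tendsto_eLpNorm_weight_inv_mul_regWave_sub him him₀ (tendsto_freq σ lam) hg) htf φ

lemma tendsto_eLpNorm_add_zero {a b : ℕ → R3 → ℂ} (ha : ∀ n, AEStronglyMeasurable (a n) volume)
    (hb : ∀ n, AEStronglyMeasurable (b n) volume)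
    (hta : Filter.Tendsto (fun n => eLpNorm (a n) 2 volume) Filter.atTop (nhds 0))
    (htb : Filter.Tendsto (fun n => eLpNorm (b n) 2 volume) Filter.atTop (nhds 0)) :
    Filter.Tendsto (fun n => eLpNorm (a n + b n) 2 volume) Filter.atTop (nhds 0) := by
  refine tendsto_of_tendsto_of_tendsto_of_le_of_le tendsto_const_nhds
    (by simpa using hta.add htb) (fun _ => zero_le) fun n => ?_
  exact eLpNorm_add_le (ha n) (hb n) (by norm_num)

/-- A solution `u` of `((-Δ)^{1/2} - λ) u = f` with the given asymptotics is the limit of square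
integrable functions `w + W⁺ + W⁻` satisfying `((-Δ)^{1/2} - λ) (w + W⁺ + W⁻) = F + iε (W⁺ - W⁻)`
with `F → f` in `L^{2,1}`, where `W^±` are the regularized waves of frequency `±λ + iε` and
`ε = 1 / (n + 1)`. The limit is taken in `L^{2,-1}`, to which the spherical waves belong. -/
lemma exists_regularization (hlam : 0 < lam) {u f : R3 → ℂ} {gp gm : S2 → ℂ}
    (hgp : ContMDiff (𝓡 2) 𝓘(ℝ, ℂ) ∞ gp) (hgm : ContMDiff (𝓡 2) 𝓘(ℝ, ℂ) ∞ gm)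
    (hu : MemLp (fun x => u x - (sphericalWave (-lam) gm x + sphericalWave lam gp x)) 2 volume)
    (huf : HalfLaplacianSubEq lam u f) (hf : MemLp (fun x => weight x * f x) 2 volume) :
    MemLp (fun x => (weight x)⁻¹ * u x) 2 volume ∧
    ∃ (w : R3 → ℂ) (F : ℕ → R3 → ℂ), MemLp w 2 volume ∧
      (∀ n, MemLp (fun x => weight x * F n x) 2 volume) ∧
      Filter.Tendsto (fun n => eLpNorm (fun x => weight x * (F n x - f x)) 2 volume)
        Filter.atTop (nhds 0) ∧
      Filter.Tendsto (fun n => eLpNorm (fun x => (weight x)⁻¹ *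
        (w x + (regWave (freq 1 lam n) gp x + regWave (freq (-1) lam n) gm x) - u x)) 2 volume)
        Filter.atTop (nhds 0) ∧
      ∀ n, ∃ v, HasL2Fourier
        (fun x => w x + (regWave (freq 1 lam n) gp x + regWave (freq (-1) lam n) gm x)) v ∧
        HasL2Fourier (fun x => F n x + Complex.I * ((1 / (n + 1) : ℝ) : ℂ) *
          (regWave (freq 1 lam n) gp x - regWave (freq (-1) lam n) gm x))
          (fun ξ => halfSymbol lam ξ * v ξ) := by
  obtain ⟨fp, fp₀, hfp₀, hfp, htp, hvp, hDp⟩ :=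
    exists_regWave_halfSource_seq hlam (σ := 1) (by norm_num) hgp
  obtain ⟨fm, fm₀, hfm₀, hfm, htm, hvm, hDm⟩ :=
    exists_regWave_halfSource_seq hlam (σ := -1) (by norm_num) hgm
  set Wp : R3 → ℂ := regWave ((1 * lam : ℝ) : ℂ) gp with hWp
  set Wm : R3 → ℂ := regWave ((-1 * lam : ℝ) : ℂ) gm with hWm
  have him : ∀ s : ℝ, 0 ≤ ((s : ℝ) : ℂ).im := fun s => by rw [Complex.ofReal_im]
  have hWpw : MemLp (fun x => (weight x)⁻¹ * Wp x) 2 volume :=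
    memLp_weight_inv_mul_regWave (him _) hgp
  have hWmw : MemLp (fun x => (weight x)⁻¹ * Wm x) 2 volume :=
    memLp_weight_inv_mul_regWave (him _) hgm
  have hw : MemLp (fun x => u x - (Wp x + Wm x)) 2 volume := by
    have h1 := memLp_regWave_sub_sphericalWave (1 * lam) hgp
    have h2 := memLp_regWave_sub_sphericalWave (-1 * lam) hgm
    refine (memLp_congr_ae (ae_of_all _ fun x => ?_)).1 ((hu.sub h1).sub h2)
    simp only [Pi.sub_apply, hWp, hWm, one_mul, neg_mul]
    ring
  have huw : MemLp (fun x => (weight x)⁻¹ * u x) 2 volume := by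
    refine (memLp_congr_ae (ae_of_all _ fun x => ?_)).1
      (((memLp_weight_inv_mul hw).add hWpw).add hWmw)
    simp only [Pi.add_apply]
    ring
  have hpw : MemLp (fun x => weight x * (f x - (fp₀ x + fm₀ x))) 2 volume := by
    refine (memLp_congr_ae (ae_of_all _ fun x => ?_)).1 (hf.sub (hfp₀.add hfm₀))
    simp only [Pi.sub_apply, Pi.add_apply]
    ring
  obtain ⟨ŵ, hŵ⟩ := HasL2Fourier.exists_right hw
  obtain ⟨p, hp⟩ := HasL2Fourier.exists_right (memLp_of_weight_mul hpw)
  have hwp : (fun ξ => halfSymbol lam ξ * ŵ ξ) =ᵐ[volume] p := by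
    refine (forall_integral_halfLaplacian_sub_iff lam hŵ hp).1 fun φ => ?_
    have hD := memLp_weight_mul_halfLaplacian_sub lam φ
    have hφ := memLp_weight_inv_mul (φ.memLp 2 (μ := (volume : Measure R3)))
    have i1 := integrable_mul_of_weight huw hD
    have i2 := integrable_mul_of_weight hWpw hD
    have i3 := integrable_mul_of_weight hWmw hD
    have j1 := integrable_mul_of_weight hφ hf
    have j2 := integrable_mul_of_weight hφ hfp₀
    have j3 := integrable_mul_of_weight hφ hfm₀
    simp only [mul_comm (φ _)] at j1 j2 j3
    simp only [sub_mul, add_mul]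
    rw [integral_sub i1 (i2.fun_add i3), integral_add i2 i3, integral_sub j1 (j2.fun_add j3),
      integral_add j2 j3, huf φ, hDp φ, hDm φ]
  refine ⟨huw, fun x => u x - (Wp x + Wm x),
    fun n x => f x - (fp₀ x + fm₀ x) + (fp n x + fm n x), hw, fun n => ?_, ?_, ?_, fun n => ?_⟩
  · refine (memLp_congr_ae (ae_of_all _ fun x => ?_)).1 (hpw.add ((hfp n).add (hfm n)))
    simp only [Pi.add_apply]
    ring
  · refine (tendsto_eLpNorm_add_zero (fun n => ?_) (fun n => ?_) htp htm).congr fun n => ?_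
    · refine ((hfp n).1.sub hfp₀.1).congr (ae_of_all _ fun x => ?_)
      simp only [Pi.sub_apply]; ring
    · refine ((hfm n).1.sub hfm₀.1).congr (ae_of_all _ fun x => ?_)
      simp only [Pi.sub_apply]; ring
    · congr 1 with x
      simp only [Pi.add_apply]; ring
  · refine (tendsto_eLpNorm_add_zero (fun n => ?_) (fun n => ?_)
      (tendsto_eLpNorm_weight_inv_mul_regWave_sub (fun n => (freq_im_pos 1 lam n).le) (him _)
        (tendsto_freq 1 lam) hgp)
      (tendsto_eLpNorm_weight_inv_mul_regWave_sub (fun n => (freq_im_pos (-1) lam n).le) (him _)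
        (tendsto_freq (-1) lam) hgm)).congr fun n => ?_
    · exact aestronglyMeasurable_weight_inv_mul
        ((measurable_regWave _ hgp).sub (measurable_regWave _ hgp))
    · exact aestronglyMeasurable_weight_inv_mul
        ((measurable_regWave _ hgm).sub (measurable_regWave _ hgm))
    · congr 1 with x
      simp only [Pi.add_apply, hWp, hWm]; ring
  · obtain ⟨vp, hvp1, hvp2⟩ := hvp n
    obtain ⟨vm, hvm1, hvm2⟩ := hvm n
    refine ⟨_, hŵ.add (hvp1.add hvm1), ?_⟩
    have h1 := (hp.add (hvp2.add hvm2)).add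
      ((hvp1.sub hvm1).const_mul (Complex.I * ((1 / (n + 1) : ℝ) : ℂ)))
    refine h1.congr_right ?_
    filter_upwards [hwp] with ξ hξ
    rw [← hξ]
    -- `σκ = λ + iσε`, so replacing `σκ` by `λ` costs `+ iε W⁺` and `- iε W⁻`
    simp only [halfSymbol, freq]
    push_cast
    ring

lemma integrable_mul_conj {u v : R3 → ℂ} (hu : MemLp u 2 volume) (hv : MemLp v 2 volume) :
    Integrable (fun x => u x * (starRingEnd ℂ) (v x)) :=
  hu.integrable_mul (show MemLp (fun x => (starRingEnd ℂ) (v x)) 2 volume from hv.star)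

/-! ### The boundary pairing -/

/-- `(-Δ)^{1/2} - λ` is symmetric on `L²`, its symbol being real. -/
lemma integral_mul_conj_halfSymbol {u û v v' p q : R3 → ℂ} (hu : HasL2Fourier u û)
    (hp : HasL2Fourier p (fun ξ => halfSymbol lam ξ * û ξ)) (hv : HasL2Fourier v v')
    (hq : HasL2Fourier q (fun ξ => halfSymbol lam ξ * v' ξ)) :
    ∫ x, u x * (starRingEnd ℂ) (q x) = ∫ x, p x * (starRingEnd ℂ) (v x) := by
  rw [hu.integral_mul_conj hq, hp.integral_mul_conj hv]
  congr 1 with ξ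
  simp only [halfSymbol, map_mul, map_sub, Complex.conj_ofReal]
  ring

/-- The algebra of the boundary pairing: the cross terms between outgoing and incoming waves
cancel. -/
lemma integral_sub_integral_eq_of_symm {w Wp Wm F v Vp Vm K : R3 → ℂ} {ε : ℝ}
    (hw : MemLp w 2 volume) (hWp : MemLp Wp 2 volume) (hWm : MemLp Wm 2 volume)
    (hF : MemLp F 2 volume) (hv : MemLp v 2 volume) (hVp : MemLp Vp 2 volume)
    (hVm : MemLp Vm 2 volume) (hK : MemLp K 2 volume)
    (h : ∫ x, (w x + (Wp x + Wm x)) * (starRingEnd ℂ) (K x + Complex.I * ε * (Vp x - Vm x))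
      = ∫ x, (F x + Complex.I * ε * (Wp x - Wm x)) * (starRingEnd ℂ) (v x + (Vp x + Vm x))) :
    (∫ x, (w x + (Wp x + Wm x)) * (starRingEnd ℂ) (K x))
        - ∫ x, F x * (starRingEnd ℂ) (v x + (Vp x + Vm x))
      = Complex.I * (2 * (ε * ∫ x, Wp x * (starRingEnd ℂ) (Vp x))
          - 2 * (ε * ∫ x, Wm x * (starRingEnd ℂ) (Vm x))
          + ((∫ x, w x * (starRingEnd ℂ) (ε * Vp x)) - ∫ x, w x * (starRingEnd ℂ) (ε * Vm x))
          + ((∫ x, (ε * Wp x) * (starRingEnd ℂ) (v x))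
            - ∫ x, (ε * Wm x) * (starRingEnd ℂ) (v x))) := by
  have hU : MemLp (fun x => w x + (Wp x + Wm x)) 2 volume := hw.add (hWp.add hWm)
  have hV : MemLp (fun x => v x + (Vp x + Vm x)) 2 volume := hv.add (hVp.add hVm)
  have hVd : MemLp (fun x => Vp x - Vm x) 2 volume := hVp.sub hVm
  have hWd : MemLp (fun x => Wp x - Wm x) 2 volume := hWp.sub hWm
  have i1 := integrable_mul_conj hU hK
  have i2 := integrable_mul_conj hU hVd
  have i3 := integrable_mul_conj hF hV
  have i4 := integrable_mul_conj hWd hV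
  have hL : ∫ x, (w x + (Wp x + Wm x)) * (starRingEnd ℂ) (K x + Complex.I * ε * (Vp x - Vm x))
      = (∫ x, (w x + (Wp x + Wm x)) * (starRingEnd ℂ) (K x))
        - Complex.I * ε * ∫ x, (w x + (Wp x + Wm x)) * (starRingEnd ℂ) (Vp x - Vm x) := by
    rw [← integral_const_mul, ← integral_sub i1 (i2.const_mul _)]
    congr 1 with x
    simp only [map_add, map_mul, Complex.conj_I, Complex.conj_ofReal]
    ring
  have hR : ∫ x, (F x + Complex.I * ε * (Wp x - Wm x)) * (starRingEnd ℂ) (v x + (Vp x + Vm x))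
      = (∫ x, F x * (starRingEnd ℂ) (v x + (Vp x + Vm x)))
        + Complex.I * ε * ∫ x, (Wp x - Wm x) * (starRingEnd ℂ) (v x + (Vp x + Vm x)) := by
    rw [← integral_const_mul, ← integral_add i3 (i4.const_mul _)]
    congr 1 with x
    ring
  have a1 := integrable_mul_conj hWp hVp
  have a2 := integrable_mul_conj hWm hVm
  have a3 := integrable_mul_conj hw hVp
  have a4 := integrable_mul_conj hw hVm
  have a5 := integrable_mul_conj hWp hv
  have a6 := integrable_mul_conj hWm hv
  have hS : (∫ x, (w x + (Wp x + Wm x)) * (starRingEnd ℂ) (Vp x - Vm x))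
        + ∫ x, (Wp x - Wm x) * (starRingEnd ℂ) (v x + (Vp x + Vm x))
      = 2 * (∫ x, Wp x * (starRingEnd ℂ) (Vp x)) - 2 * (∫ x, Wm x * (starRingEnd ℂ) (Vm x))
        + ((∫ x, w x * (starRingEnd ℂ) (Vp x)) - ∫ x, w x * (starRingEnd ℂ) (Vm x))
        + ((∫ x, Wp x * (starRingEnd ℂ) (v x)) - ∫ x, Wm x * (starRingEnd ℂ) (v x)) := by
    rw [← integral_const_mul, ← integral_const_mul,
      ← integral_sub (a1.const_mul 2) (a2.const_mul 2), ← integral_sub a3 a4, ← integral_sub a5 a6,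
      ← integral_add ((a1.const_mul 2).sub' (a2.const_mul 2)) (a3.sub' a4),
      ← integral_add (((a1.const_mul 2).sub' (a2.const_mul 2)).fun_add (a3.sub' a4))
        (a5.sub' a6), ← integral_add i2 i4]
    congr 1 with x
    simp only [map_add, map_sub]
    ring
  have hc : ∀ a b : R3 → ℂ, ∫ x, a x * (starRingEnd ℂ) (ε * b x)
      = ε * ∫ x, a x * (starRingEnd ℂ) (b x) := fun a b => by
    rw [← integral_const_mul]
    congr 1 with x
    rw [map_mul, Complex.conj_ofReal]
    ring
  have hc' : ∀ a b : R3 → ℂ, ∫ x, (ε * a x) * (starRingEnd ℂ) (b x)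
      = ε * ∫ x, a x * (starRingEnd ℂ) (b x) := fun a b => by
    rw [← integral_const_mul]
    congr 1 with x
    ring
  rw [hL, hR] at h
  rw [hc, hc, hc', hc']
  linear_combination h + Complex.I * ε * hS

end BoundaryPairing

open BoundaryPairing

theorem lemma2p1 (lam : ℝ) (hlam : 0 < lam) (s : ℝ) (hs : 1 ≤ s)
    (up um fp fm : BoundaryPairing.R3 → ℂ)
    (gpp gpm gmp gmm : BoundaryPairing.S2 → ℂ)
    (hgpp : ContMDiff (𝓡 2) 𝓘(ℝ, ℂ) ∞ gpp)
    (hgpm : ContMDiff (𝓡 2) 𝓘(ℝ, ℂ) ∞ gpm)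
    (hgmp : ContMDiff (𝓡 2) 𝓘(ℝ, ℂ) ∞ gmp)
    (hgmm : ContMDiff (𝓡 2) 𝓘(ℝ, ℂ) ∞ gmm)
    (hup : MemLp (fun x => up x - (BoundaryPairing.sphericalWave (-lam) gpm x
      + BoundaryPairing.sphericalWave lam gpp x)) 2 volume)
    (hum : MemLp (fun x => um x - (BoundaryPairing.sphericalWave (-lam) gmm x
      + BoundaryPairing.sphericalWave lam gmp x)) 2 volume)
    (hfp : BoundaryPairing.HalfLaplacianSubEq lam up fp)
    (hfm : BoundaryPairing.HalfLaplacianSubEq lam um fm)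
    (hfp2 : BoundaryPairing.MemWeightedL2 s fp)
    (hfm2 : BoundaryPairing.MemWeightedL2 s fm) :
    Integrable (fun x => up x * (starRingEnd ℂ) (fm x)) volume ∧
    Integrable (fun x => fp x * (starRingEnd ℂ) (um x)) volume ∧
    (∫ x, up x * (starRingEnd ℂ) (fm x)) - (∫ x, fp x * (starRingEnd ℂ) (um x))
      = Complex.I * (BoundaryPairing.spherePairing gpp gmp
        - BoundaryPairing.spherePairing gpm gmm) := by
  -- only the membership in `L^{2,1}` of the two right-hand sides matters
  have hfpw := hfp2.memLp_weight_mul hs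
  have hfmw := hfm2.memLp_weight_mul hs
  obtain ⟨hupw, w, F, hw, hFw, htF, htU, hU⟩ := exists_regularization hlam hgpp hgpm hup hfp hfpw
  obtain ⟨humw, v, K, hv, hKw, htK, htV, hV⟩ := exists_regularization hlam hgmp hgmm hum hfm hfmw
  choose û hU₁ hU₂ using hU
  choose v' hV₁ hV₂ using hV
  have conj_swap : ∀ a b : R3 → ℂ, (fun x => a x * (starRingEnd ℂ) (b x))
      = fun x => (starRingEnd ℂ) (b x * (starRingEnd ℂ) (a x)) := fun a b => by
    ext x
    rw [map_mul, Complex.conj_conj, mul_comm]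
  refine ⟨integrable_mul_conj_of_weight hupw hfmw, ?_, ?_⟩
  · rw [conj_swap]
    exact (Complex.conjCLE.integrable_comp_iff).2 (integrable_mul_conj_of_weight humw hfpw)
  have hlim1 := tendsto_integral_mul_conj_of_weight
    (fun n => memLp_weight_inv_mul (hU₁ n).memLp_left) hKw hupw hfmw htU htK
  have hlim2 := tendsto_integral_mul_conj_of_weight
    (fun n => memLp_weight_inv_mul (hV₁ n).memLp_left) hFw humw hfpw htV htF
  have hlim2' : Filter.Tendsto (fun n => ∫ x, F n x * (starRingEnd ℂ)
      (v x + (regWave (freq 1 lam n) gmp x + regWave (freq (-1) lam n) gmm x)))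
      Filter.atTop (nhds (∫ x, fp x * (starRingEnd ℂ) (um x))) := by
    have hc : ∀ a b : R3 → ℂ, ∫ x, a x * (starRingEnd ℂ) (b x)
        = (starRingEnd ℂ) (∫ x, b x * (starRingEnd ℂ) (a x)) := fun a b => by
      rw [conj_swap, integral_conj]
    rw [hc fp um]
    exact ((Complex.continuous_conj.tendsto _).comp hlim2).congr fun n => (hc _ _).symm
  have hpos := fun σ n => freq_im_pos σ lam n
  have hW : ∀ σ n (g : S2 → ℂ), ContMDiff (𝓡 2) 𝓘(ℝ, ℂ) ∞ g →
      MemLp (regWave (freq σ lam n) g) 2 volume := fun σ n g hg => memLp_regWave (hpos σ n) hg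
  have key := fun n => integral_sub_integral_eq_of_symm hw (hW 1 n _ hgpp) (hW (-1) n _ hgpm)
    (memLp_of_weight_mul (hFw n)) hv (hW 1 n _ hgmp) (hW (-1) n _ hgmm)
    (memLp_of_weight_mul (hKw n)) (integral_mul_conj_halfSymbol (hU₁ n) (hU₂ n) (hV₁ n) (hV₂ n))
  have hdiag : ∀ σ (g g' : S2 → ℂ), Filter.Tendsto (fun n : ℕ => ((1 / (n + 1) : ℝ) : ℂ) *
      ∫ x, regWave (freq σ lam n) g x * (starRingEnd ℂ) (regWave (freq σ lam n) g' x))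
      Filter.atTop (nhds (1 / 2 * spherePairing g g')) := fun σ g g' => by
    simpa only [freq_im] using
      tendsto_im_mul_integral_regWave_mul_conj (hpos σ) (tendsto_freq_im σ lam) g g'
  have hsmall : ∀ σ (g : S2 → ℂ), ContMDiff (𝓡 2) 𝓘(ℝ, ℂ) ∞ g → Filter.Tendsto
      (fun n : ℕ => eLpNorm (fun x => ((1 / (n + 1) : ℝ) : ℂ) * regWave (freq σ lam n) g x) 2
        volume) Filter.atTop (nhds 0) := fun σ g hg => by
    simpa only [freq_im] using tendsto_eLpNorm_im_mul_regWave (hpos σ) (tendsto_freq_im σ lam) hg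
  have hright : ∀ σ (g : S2 → ℂ), ContMDiff (𝓡 2) 𝓘(ℝ, ℂ) ∞ g → ∀ a : R3 → ℂ, MemLp a 2 volume →
      Filter.Tendsto (fun n : ℕ => ∫ x, a x * (starRingEnd ℂ)
        (((1 / (n + 1) : ℝ) : ℂ) * regWave (freq σ lam n) g x)) Filter.atTop (nhds 0) :=
    fun σ g hg a ha => by
      simpa using tendsto_integral_mul_conj (b₀ := 0) (fun _ => ha)
        (fun n => (hW σ n g hg).const_mul ((1 / (n + 1) : ℝ) : ℂ)) ha MemLp.zero' (by simp)
        (by simpa only [sub_zero] using hsmall σ g hg)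
  have hleft : ∀ σ (g : S2 → ℂ), ContMDiff (𝓡 2) 𝓘(ℝ, ℂ) ∞ g → ∀ a : R3 → ℂ, MemLp a 2 volume →
      Filter.Tendsto (fun n : ℕ => ∫ x, (((1 / (n + 1) : ℝ) : ℂ) * regWave (freq σ lam n) g x)
        * (starRingEnd ℂ) (a x)) Filter.atTop (nhds 0) :=
    fun σ g hg a ha => by
      simpa using tendsto_integral_mul_conj (a₀ := 0)
        (fun n => (hW σ n g hg).const_mul ((1 / (n + 1) : ℝ) : ℂ)) (fun _ => ha) MemLp.zero' ha
        (by simpa only [sub_zero] using hsmall σ g hg) (by simp)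
  -- `ε → 0` in the identity `key`: only the two diagonal terms survive
  have hlim := (((((hdiag 1 gpp gmp).const_mul 2).sub ((hdiag (-1) gpm gmm).const_mul 2)).add
    ((hright 1 _ hgmp w hw).sub (hright (-1) _ hgmm w hw))).add
    ((hleft 1 _ hgpp v hv).sub (hleft (-1) _ hgpm v hv))).const_mul Complex.I
  have h := tendsto_nhds_unique (hlim1.sub hlim2') (hlim.congr fun n => (key n).symm)
  rw [h]
  ring
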